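/- **Setting.** Let $(V,\eta)$ be a Lorentzian inner product space with $\dim V>2$, $S$ a (possibly $N$-extended) real spinor module of $\mathfrak{so}(V)$, and $\kappa:\odot^2S\to V$ an $\mathfrak{so}(V)$-equivariant symmetric map which is causal ($\kappa_s:=\kappa(s,s)$ is timelike or null for all $s\in S$; the zero vector is allowed) and non-degenerate ($\kappa(s,\cdot)=0$ implies $s=0$). Let $\mathfrak{s}=V\oplus S\oplus\mathfrak{so}(V)$, with $V,S,\mathfrak{so}(V)$ in degrees $-2,-1,0$, be the Poincaré superalgebra: $[A,B]=AB-BA$, $[A,v]=Av$, $[A,s]=A\cdot s$, $[s,s]=\kappa_s$, $[v,s]=0$, $[v,w]=0$. Let $\mathfrak{a}=V\oplus S'\oplus\mathfrak{h}$ be a graded subalgebra of $\mathfrak{s}$ (so $\mathfrak{h}\subseteq\mathfrak{so}(V)$ is a subalgebra preserving the subspace $S'\subseteq S$) which is highly supersymmetric, i.e. $\dim S'>\frac12\dim S$, and put $\mathfrak{a}_-=V\oplus S'$. Let $\mathcal{H}^{2,2}(\mathfrak{a}_-)$ be the space of normalised cocycles: the degree-2 Chevalley–Eilenberg 2-cocycles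 $\Lambda^2\mathfrak{a}_-\to\mathfrak{s}$ ($\Lambda^2$ in the super sense) whose component $\Lambda^2V\to V$ vanishes. Its elements are the sums $\beta+\gamma$ of maps $\beta:V\otimes S'\to S$ and $\gamma:\odot^2S'\to\mathfrak{so}(V)$ with $\gamma(s,s)v+2\kappa(s,\beta(v,s))=0$ and $\beta(\kappa_s,s)+\gamma(s,s)\cdot s=0$. Let $\mathcal{H}^{2,2}(\mathfrak{a}_-)^{\mathfrak{h}}$ be its subspace of $\mathfrak{h}$-invariants. A filtered deformation of $\mathfrak{a}$ is a Lie superalgebra $F$ with a finite decreasing filtration $F^\bullet$, compatible with the bracket and with the parity, together with an isomorphism $\operatorname{Gr}F\cong\mathfrak{a}$ of graded Lie superalgebras. Two filtered deformations of $\mathfrak{a}$ are isomorphic if there is a strict isomorphism of filtered Lie superalgebras between them which induces the identity on the associated graded algebra $\mathfrak{a}$. A presentation of $F$ is a parity-preserving filtered linear isomorphism $\mathfrak{a}\to F$ inducing the given identification $\mathfrak{a}\cong\operatorname{Gr}F$; it transports the bracket of $F$ to a bracket on the vector space $\mathfrak{a}$. **Proposition.** 1. Every filtered deformation of $\mathfrak{a}$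 has a presentation in which its bracket is $$[A,B]=AB-BA,\qquad [A,s]=A\cdot s,\qquad [A,v]=Av+[A,\lambda(v)]-\lambda(Av),$$ $$[s,s]=\kappa_s+\tilde\gamma(s,s)-\lambda(\kappa_s),\qquad [v,s]=\tilde\beta(v,s)+\lambda(v)\cdot s,$$ $$[v,w]=\lambda(v)w-\lambda(w)v+\tilde\theta(v,w)-\lambda(\lambda(v)w-\lambda(w)v)+[\lambda(v),\lambda(w)]$$ for $A,B\in\mathfrak{h}$, $v,w\in V$, $s\in S'$, where $\tilde\beta+\tilde\gamma\in\mathcal{H}^{2,2}(\mathfrak{a}_-)^{\mathfrak{h}}$, $\lambda:V\to\mathfrak{so}(V)$ is linear and $\tilde\theta:\Lambda^2V\to\mathfrak{so}(V)$ is linear and $\mathfrak{h}$-invariant, and where $[v,s]\in S'$ and $[A,v]-Av$, $[s,s]-\kappa_s$ and $[v,w]-(\lambda(v)w-\lambda(w)v)$ lie in $\mathfrak{h}$. 2. For any maps $(\tilde\beta,\tilde\gamma,\lambda,\tilde\theta)$ as in 1, the bracket displayed there satisfies the (super) Jacobi identities if and only if, for all $u,v,w\in V$ and $s\in S'$, $$\tilde\theta(\kappa_s,v)+2\tilde\gamma\big(s,\tilde\beta(v,s)+\lambda(v)\cdot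 s\big)-[\lambda(v),\tilde\gamma(s,s)]=0,$$ $$\begin{aligned}\tilde\theta(v,w)\cdot s&=\tilde\beta\big(v,\tilde\beta(w,s)+\lambda(w)\cdot s\big)-\lambda(w)\cdot\tilde\beta(v,s)+\tilde\beta(\lambda(w)v,s)\\&\quad-\tilde\beta\big(w,\tilde\beta(v,s)+\lambda(v)\cdot s\big)+\lambda(v)\cdot\tilde\beta(w,s)-\tilde\beta(\lambda(v)w,s),\end{aligned}$$ $$\tilde\theta(u,v)w+\tilde\theta(v,w)u+\tilde\theta(w,u)v=0,$$ $$(\lambda(u)\cdot\tilde\theta)(v,w)+(\lambda(v)\cdot\tilde\theta)(w,u)+(\lambda(w)\cdot\tilde\theta)(u,v)=0.$$ 3. Two filtered deformations of $\mathfrak{a}$, each with a presentation as in 1, are isomorphic if and only if the two presentations have the same element $\tilde\beta+\tilde\gamma\in\mathcal{H}^{2,2}(\mathfrak{a}_-)^{\mathfrak{h}}$. -/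

import Mathlib

attribute [local instance 100] LieRing.ofAssociativeRing

namespace KillingAlg

/-! ### Spinors -/

section Spin

variable {V : Type*} [AddCommGroup V] [Module ℝ V]

/-- The Lie algebra `𝔰𝔬(V)` of `η`-skew-symmetric endomorphisms, with the commutator bracket. -/
abbrev so (η : LinearMap.BilinForm ℝ V) : LieSubalgebra ℝ (Module.End ℝ V) :=
  skewAdjointLieSubalgebra η

/-- The quadratic form of the Clifford relation `v · v = - η(v,v) 1`. -/
def cliffordForm (η : LinearMap.BilinForm ℝ V) : QuadraticForm ℝ V :=
  -(LinearMap.BilinMap.toQuadraticMap η)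

/-- The element of the even Clifford algebra representing `A ∈ 𝔰𝔬(V)`, namely
`-¼ ∑ᵢ (A eᵢ) · eⁱ` for a basis `eᵢ` with `η`-dual basis `eⁱ`.
For `A ∈ 𝔰𝔬(V)` it is characterised by `[spinLift A, v] = A v` in the Clifford algebra
and by being a linear combination of commutators of vectors (see `spinLift_commutator`). -/
noncomputable def spinLift [FiniteDimensional ℝ V] (η : LinearMap.BilinForm ℝ V)
    (hη : η.Nondegenerate) (A : Module.End ℝ V) : CliffordAlgebra.even (cliffordForm η) :=
  -((1 / 4 : ℝ) • ∑ i, (CliffordAlgebra.even.ι (cliffordForm η)).bilin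
      (A (Module.finBasis ℝ V i)) (η.dualBasis hη (Module.finBasis ℝ V) i))

/-- In the Clifford algebra, the commutator of `spinLift η hη A` with a vector `v` is `A v`. -/
theorem spinLift_commutator [FiniteDimensional ℝ V] (η : LinearMap.BilinForm ℝ V)
    (hη : η.Nondegenerate) (hs : η.IsSymm) (A : Module.End ℝ V) (hA : A ∈ so η) (v : V) :
    (spinLift η hη A : CliffordAlgebra (cliffordForm η)) * CliffordAlgebra.ι (cliffordForm η) v
      - CliffordAlgebra.ι (cliffordForm η) v *
        (spinLift η hη A : CliffordAlgebra (cliffordForm η))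
      = CliffordAlgebra.ι (cliffordForm η) (A v) := by
  set b := Module.finBasis ℝ V with hb
  set d := η.dualBasis hη b with hd
  have hsw : ∀ x y : V, CliffordAlgebra.ι (cliffordForm η) x * CliffordAlgebra.ι (cliffordForm η) y
      = (-2 * η x y) • (1 : CliffordAlgebra (cliffordForm η))
        - CliffordAlgebra.ι (cliffordForm η) y * CliffordAlgebra.ι (cliffordForm η) x := by
    intro x y
    rw [eq_sub_iff_add_eq, CliffordAlgebra.ι_mul_ι_add_swap, Algebra.algebraMap_eq_smul_one]
    congr 1
    simp only [QuadraticMap.polar, cliffordForm, _root_.neg_apply,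
      LinearMap.BilinMap.toQuadraticMap_apply, map_add, LinearMap.add_apply, hs.eq y x]
    have : η y x = η x y := hs.eq y x
    linarith
  have hterm : ∀ x y : V,
      (CliffordAlgebra.ι (cliffordForm η) x * CliffordAlgebra.ι (cliffordForm η) y)
          * CliffordAlgebra.ι (cliffordForm η) v
        - CliffordAlgebra.ι (cliffordForm η) v
          * (CliffordAlgebra.ι (cliffordForm η) x * CliffordAlgebra.ι (cliffordForm η) y)
      = CliffordAlgebra.ι (cliffordForm η) ((-2 * η y v) • x + (2 * η x v) • y) := by
    intro x y
    rw [mul_assoc, hsw y v, ← mul_assoc (CliffordAlgebra.ι _ v), hsw v x, mul_sub, sub_mul,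
      map_add, map_smul, map_smul, mul_smul_comm, smul_mul_assoc, mul_one, one_mul, mul_assoc]
    have : η v x = η x v := hs.eq v x
    rw [this]
    module
  have hcoe : (spinLift η hη A : CliffordAlgebra (cliffordForm η))
      = -((1 / 4 : ℝ) • ∑ i, CliffordAlgebra.ι (cliffordForm η) (A (b i))
          * CliffordAlgebra.ι (cliffordForm η) (d i)) := by
    simp only [spinLift, NegMemClass.coe_neg, SetLike.val_smul, AddSubmonoidClass.coe_finsetSum]
    rfl
  have h1 : ∑ i, η (d i) v • b i = v := by
    have key : ∀ i, η (d i) v = b.repr v i := by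
      intro i
      have h := congrArg (η (d i)) (b.sum_repr v)
      rw [← h, map_sum, Finset.sum_eq_single i]
      · simp [hd, LinearMap.BilinForm.apply_dualBasis_left]
      · intro j _ hj
        simp [hd, LinearMap.BilinForm.apply_dualBasis_left, hj]
      · simp
    simp only [key, b.sum_repr]
  have h2 : ∑ i, η (A (b i)) v • d i = -(A v) := by
    have := d.sum_repr (A v)
    rw [← this, ← Finset.sum_neg_distrib]
    refine Finset.sum_congr rfl fun i _ => ?_
    rw [← neg_smul]
    congr 1
    rw [hd, LinearMap.BilinForm.dualBasis_repr_apply]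
    have hA' : η (A (b i)) v = (-η) (b i) (A v) := hA (b i) v
    have h3 : η (A v) (b i) = η (b i) (A v) := hs.eq _ _
    rw [hA', h3]
    simp
  rw [hcoe, neg_mul, mul_neg, smul_mul_assoc, mul_smul_comm, Finset.sum_mul, Finset.mul_sum,
    neg_sub_neg, ← smul_sub, ← Finset.sum_sub_distrib]
  have h4 : ∀ i, CliffordAlgebra.ι (cliffordForm η) v *
        (CliffordAlgebra.ι (cliffordForm η) (A (b i)) * CliffordAlgebra.ι (cliffordForm η) (d i))
      - CliffordAlgebra.ι (cliffordForm η) (A (b i)) * CliffordAlgebra.ι (cliffordForm η) (d i)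
        * CliffordAlgebra.ι (cliffordForm η) v
      = CliffordAlgebra.ι (cliffordForm η)
          ((2 : ℝ) • A (η (d i) v • b i) - (2 : ℝ) • (η (A (b i)) v • d i)) := by
    intro i
    rw [← neg_sub, hterm, ← map_neg, map_smul A]
    congr 1
    module
  rw [Finset.sum_congr rfl fun i _ => h4 i, ← map_sum, Finset.sum_sub_distrib, ← Finset.smul_sum,
    ← Finset.smul_sum, ← map_sum, h1, h2, ← map_smul]
  congr 1
  module

/-- `η` has signature `(-,+,…,+)`. -/
def IsLorentzian (η : LinearMap.BilinForm ℝ V) : Prop :=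
  ∃ (n : ℕ) (b : Module.Basis (Fin (n + 1)) ℝ V),
    ∀ i j, η (b i) (b j) = if i = j then (if i = 0 then -1 else 1) else 0

end Spin

/-! ### The flat model superalgebra `𝔰 = V ⊕ S ⊕ 𝔰𝔬(V)` -/

/-- The data `(V, η, S, κ)`. A finite-dimensional real module of the even Clifford algebra (given
here by `ρ`) is the same thing as a (possibly extended) spinor module, because the even Clifford
algebra is semisimple and the irreducible spinor modules are its irreducible modules. -/
structure FlatModel (V S : Type*) [AddCommGroup V] [Module ℝ V] [FiniteDimensional ℝ V]
    [AddCommGroup S] [Module ℝ S] where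
  /-- the inner product -/
  η : LinearMap.BilinForm ℝ V
  η_symm : η.IsSymm
  η_nondeg : η.Nondegenerate
  /-- the spinor module structure -/
  ρ : CliffordAlgebra.even (cliffordForm η) →ₐ[ℝ] Module.End ℝ S
  /-- the squaring map -/
  κ : S →ₗ[ℝ] S →ₗ[ℝ] V
  κ_symm : ∀ s t, κ s t = κ t s
  κ_equivariant : ∀ A ∈ so η, ∀ s t,
    A (κ s t) = κ (ρ (spinLift η η_nondeg A) s) t + κ s (ρ (spinLift η η_nondeg A) t)

namespace FlatModel

variable {V S : Type*} [AddCommGroup V] [Module ℝ V] [FiniteDimensional ℝ V]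
  [AddCommGroup S] [Module ℝ S] (𝔰 : FlatModel V S)

/-- The action of `𝔰𝔬(V)` on spinors. -/
noncomputable def act (A : so 𝔰.η) : Module.End ℝ S := 𝔰.ρ (spinLift 𝔰.η 𝔰.η_nondeg A)

/-- `κ(s,s)` is timelike or null for all `s`. -/
def IsCausal : Prop := ∀ s, 𝔰.η (𝔰.κ s s) (𝔰.κ s s) ≤ 0

/-- No non-zero spinor is `κ`-orthogonal to all spinors. -/
def IsNondegenerate : Prop := ∀ s, (∀ t, 𝔰.κ s t = 0) → s = 0

/-- The underlying space of `𝔰`. -/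
abbrev Alg : Type _ := V × S × so 𝔰.η

/-- The bracket of `𝔰`. -/
noncomputable def bracket (X Y : 𝔰.Alg) : 𝔰.Alg :=
  ((X.2.2 : Module.End ℝ V) Y.1 - (Y.2.2 : Module.End ℝ V) X.1 + 𝔰.κ X.2.1 Y.2.1,
    𝔰.act X.2.2 Y.2.1 - 𝔰.act Y.2.2 X.2.1,
    ⁅X.2.2, Y.2.2⁆)

/-- The homogeneous subspaces of `𝔰`: `V`, `S`, `𝔰𝔬(V)` in degrees `-2`, `-1`, `0`. -/
def piece (k : ℤ) : Submodule ℝ 𝔰.Alg :=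
  if k = -2 then (⊤ : Submodule ℝ V).prod ⊥
  else if k = -1 then (⊥ : Submodule ℝ V).prod ((⊤ : Submodule ℝ S).prod ⊥)
  else if k = 0 then (⊥ : Submodule ℝ V).prod ((⊥ : Submodule ℝ S).prod ⊤)
  else ⊥

end FlatModel

/-! ### Graded subalgebras `𝔞 = V ⊕ S' ⊕ 𝔥` -/

/-- A graded subalgebra of `𝔰` with `𝔞₋₂ = V`. -/
structure GradedSubalgebra {V S : Type*} [AddCommGroup V] [Module ℝ V] [FiniteDimensional ℝ V]
    [AddCommGroup S] [Module ℝ S] (𝔰 : FlatModel V S) where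
  /-- the odd part `𝔞₋₁` -/
  S' : Submodule ℝ S
  /-- the degree-zero part `𝔞₀` -/
  h : LieSubalgebra ℝ (so 𝔰.η)
  act_mem : ∀ A ∈ h, ∀ s ∈ S', 𝔰.act A s ∈ S'

/-- The Koszul sign `(-1)^(ij)`. -/
def sgn (i j : ZMod 2) : ℝ := if i = 1 ∧ j = 1 then -1 else 1

namespace GradedSubalgebra

variable {V S : Type*} [AddCommGroup V] [Module ℝ V] [FiniteDimensional ℝ V]
  [AddCommGroup S] [Module ℝ S] {𝔰 : FlatModel V S} (𝔞 : GradedSubalgebra 𝔰)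

/-- `dim S' > ½ dim S`. -/
def IsHighlySupersymmetric : Prop := Module.finrank ℝ S < 2 * Module.finrank ℝ 𝔞.S'

/-- The underlying space of `𝔞`. -/
abbrev Alg : Type _ := V × 𝔞.S' × 𝔞.h

/-- The action of `𝔥` on `S'`. -/
noncomputable def act (A : 𝔞.h) (s : 𝔞.S') : 𝔞.S' :=
  ⟨𝔰.act (A : so 𝔰.η) s, 𝔞.act_mem _ A.2 _ s.2⟩

/-- The action of `𝔥` on `V`. -/
def actV (A : 𝔞.h) (v : V) : V := ((A : so 𝔰.η) : Module.End ℝ V) v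

/-- The bracket of `𝔰` restricted to `𝔞`. -/
noncomputable def bracket (X Y : 𝔞.Alg) : 𝔞.Alg :=
  (𝔞.actV X.2.2 Y.1 - 𝔞.actV Y.2.2 X.1 + 𝔰.κ X.2.1 Y.2.1,
    𝔞.act X.2.2 Y.2.1 - 𝔞.act Y.2.2 X.2.1,
    ⁅X.2.2, Y.2.2⁆)

/-- The homogeneous subspaces `V`, `S'`, `𝔥` of `𝔞`, in degrees `-2`, `-1`, `0`. -/
def piece (k : ℤ) : Submodule ℝ 𝔞.Alg :=
  if k = -2 then (⊤ : Submodule ℝ V).prod ⊥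
  else if k = -1 then (⊥ : Submodule ℝ V).prod ((⊤ : Submodule ℝ 𝔞.S').prod ⊥)
  else if k = 0 then (⊥ : Submodule ℝ V).prod ((⊥ : Submodule ℝ 𝔞.S').prod ⊤)
  else ⊥

/-! ### Spencer cochains `Λ² 𝔞₋ → 𝔰` -/

/-- The negatively graded part `𝔞₋ = V ⊕ S'`. -/
abbrev Neg : Type _ := V × 𝔞.S'

/-- The inclusion of `𝔞₋` in `𝔰`. -/
def negIncl (X : 𝔞.Neg) : 𝔰.Alg := (X.1, (X.2 : S), 0)

/-- The bracket of `𝔞₋`. -/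
def negBracket (X Y : 𝔞.Neg) : 𝔞.Neg := (𝔰.κ X.2 Y.2, 0)

/-- The homogeneous subspaces of `𝔞₋`. -/
def negPiece (k : ℤ) : Submodule ℝ 𝔞.Neg :=
  if k = -2 then (⊤ : Submodule ℝ V).prod ⊥
  else if k = -1 then (⊥ : Submodule ℝ V).prod (⊤ : Submodule ℝ 𝔞.S')
  else ⊥

/-- Bilinear maps `𝔞₋ × 𝔞₋ → 𝔰`. -/
abbrev BilinNeg : Type _ := 𝔞.Neg →ₗ[ℝ] 𝔞.Neg →ₗ[ℝ] 𝔰.Alg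

/-- `φ` belongs to `C^{d,2}(𝔞₋; 𝔰)`: it is super-skew-symmetric and of degree `d`. -/
def IsCochain (d : ℤ) (φ : 𝔞.BilinNeg) : Prop :=
  ∀ k l : ℤ, ∀ X ∈ 𝔞.negPiece k, ∀ Y ∈ 𝔞.negPiece l,
    φ X Y ∈ 𝔰.piece (k + l + d) ∧ φ X Y = -(sgn k l • φ Y X)

/-- The Spencer differential of a `2`-cochain vanishes. -/
def IsClosedCochain (φ : 𝔞.BilinNeg) : Prop :=
  ∀ k l m : ℤ, ∀ X ∈ 𝔞.negPiece k, ∀ Y ∈ 𝔞.negPiece l, ∀ Z ∈ 𝔞.negPiece m,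
    (𝔰.bracket (𝔞.negIncl X) (φ Y Z) - φ (𝔞.negBracket X Y) Z)
      + sgn k (l + m) •
        (𝔰.bracket (𝔞.negIncl Y) (φ Z X) - φ (𝔞.negBracket Y Z) X)
      + sgn (k + l) m •
        (𝔰.bracket (𝔞.negIncl Z) (φ X Y) - φ (𝔞.negBracket Z X) Y) = 0

/-- `φ` is a normalised cocycle: a cocycle in `C^{2,2}(𝔞₋; 𝔰)` without `Λ²V → V` component.
(A degree-`2` map takes `Λ²V` to `V`.) -/
def IsNormalisedCocycle (φ : 𝔞.BilinNeg) : Prop :=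
  𝔞.IsCochain 2 φ ∧ 𝔞.IsClosedCochain φ ∧ ∀ v w : V, φ (v, 0) (w, 0) = 0

/-- `φ` is `𝔥`-invariant, for the action of `𝔥` on `𝔞₋` and on `𝔰`. -/
def IsInvariant (φ : 𝔞.BilinNeg) : Prop :=
  ∀ (A : 𝔞.h) (X Y : 𝔞.Neg),
    𝔰.bracket (0, 0, (A : so 𝔰.η)) (φ X Y) =
      φ (𝔞.actV A X.1, 𝔞.act A X.2) Y + φ X (𝔞.actV A Y.1, 𝔞.act A Y.2)

/-- The space `ℋ^{2,2}(𝔞₋)^𝔥` of `𝔥`-invariant normalised cocycles. -/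
def invNormalisedCocycles : Set 𝔞.BilinNeg :=
  {φ | 𝔞.IsNormalisedCocycle φ ∧ 𝔞.IsInvariant φ}

/-- The component `β : V ⊗ S' → S` of a cochain of degree `2`. -/
def betaOf (φ : 𝔞.BilinNeg) (v : V) (s : 𝔞.S') : S := (φ (v, 0) (0, s)).2.1

/-- The component `γ : ⊙² S' → 𝔰𝔬(V)` of a cochain of degree `2`. -/
def gammaOf (φ : 𝔞.BilinNeg) (s t : 𝔞.S') : so 𝔰.η := (φ (0, s) (0, t)).2.2

end GradedSubalgebra

/-! ### Filtered Lie superalgebras and filtered deformations -/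

/-- The structure of a real Lie superalgebra on `F`. -/
structure LieSuperalgebra (F : Type*) [AddCommGroup F] [Module ℝ F] where
  /-- the even and the odd subspace -/
  part : ZMod 2 → Submodule ℝ F
  isCompl : IsCompl (part 0) (part 1)
  /-- the bracket -/
  bracket : F →ₗ[ℝ] F →ₗ[ℝ] F
  bracket_mem : ∀ i j, ∀ x ∈ part i, ∀ y ∈ part j, bracket x y ∈ part (i + j)
  skew : ∀ i j, ∀ x ∈ part i, ∀ y ∈ part j, bracket x y = -(sgn i j • bracket y x)
  jacobi : ∀ i j l, ∀ x ∈ part i, ∀ y ∈ part j, ∀ z ∈ part l,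
    bracket x (bracket y z) = bracket (bracket x y) z + sgn i j • bracket y (bracket x z)

/-- The structure of a Lie superalgebra with a finite decreasing filtration. -/
structure FilteredLieSuperalgebra (F : Type*) [AddCommGroup F] [Module ℝ F]
    extends LieSuperalgebra F where
  /-- the filtration -/
  fil : ℤ → Submodule ℝ F
  fil_anti : Antitone fil
  fil_exhaustive : ∃ k, fil k = ⊤
  fil_separated : ∃ k, fil k = ⊥
  fil_split : ∀ k, fil k = (fil k ⊓ part 0) ⊔ (fil k ⊓ part 1)
  fil_even : ∀ k, fil (2 * k - 1) ⊓ part 0 = fil (2 * k) ⊓ part 0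
  fil_odd : ∀ k, fil (2 * k) ⊓ part 1 = fil (2 * k + 1) ⊓ part 1
  fil_bracket : ∀ k l, ∀ x ∈ fil k, ∀ y ∈ fil l, bracket x y ∈ fil (k + l)

namespace FilteredLieSuperalgebra

variable {F : Type*} [AddCommGroup F] [Module ℝ F] (L : FilteredLieSuperalgebra F)

/-- The piece `F^k / F^{k+1}` of the associated graded space. -/
abbrev Gr (k : ℤ) : Type _ := L.fil k ⧸ (L.fil (k + 1)).submoduleOf (L.fil k)

/-- The class in `Gr_k F` of an element of `F^k`. -/
def cls (k : ℤ) (x : F) (hx : x ∈ L.fil k) : L.Gr k := Submodule.Quotient.mk ⟨x, hx⟩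

end FilteredLieSuperalgebra

variable {V S : Type*} [AddCommGroup V] [Module ℝ V] [FiniteDimensional ℝ V]
  [AddCommGroup S] [Module ℝ S] {𝔰 : FlatModel V S}

/-- A filtered deformation of `𝔞`: a filtered Lie superalgebra `F` with an isomorphism
`Gr F ≅ 𝔞` of graded Lie superalgebras. (The bracket of `Gr F` is the one induced by
the bracket of `F` on representatives.) -/
structure FilteredDeformation (𝔞 : GradedSubalgebra 𝔰) (F : Type*) [AddCommGroup F] [Module ℝ F]
    extends FilteredLieSuperalgebra F where
  /-- the isomorphism `Gr F ≅ 𝔞`, degree by degree -/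
  gr : ∀ k : ℤ, toFilteredLieSuperalgebra.Gr k ≃ₗ[ℝ] 𝔞.piece k
  gr_bracket : ∀ (k l : ℤ) (x y : F) (hx : x ∈ fil k) (hy : y ∈ fil l),
    (gr (k + l) (toFilteredLieSuperalgebra.cls (k + l) (bracket x y)
        (fil_bracket k l x hx y hy)) : 𝔞.Alg) =
      𝔞.bracket (gr k (toFilteredLieSuperalgebra.cls k x hx))
        (gr l (toFilteredLieSuperalgebra.cls l y hy))

/-- `Ψ` is an isomorphism between two filtered deformations of `𝔞`: a strict isomorphism of
filtered Lie superalgebras which induces the identity on the associated graded algebra `𝔞`. -/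
structure IsDeformationIso {𝔞 : GradedSubalgebra 𝔰} {F F' : Type*} [AddCommGroup F] [Module ℝ F]
    [AddCommGroup F'] [Module ℝ F'] (L : FilteredDeformation 𝔞 F) (L' : FilteredDeformation 𝔞 F')
    (Ψ : F ≃ₗ[ℝ] F') : Prop where
  map_bracket : ∀ x y, Ψ (L.bracket x y) = L'.bracket (Ψ x) (Ψ y)
  map_part : ∀ i, ∀ x, Ψ x ∈ L'.part i ↔ x ∈ L.part i
  map_fil : ∀ k, ∀ x, Ψ x ∈ L'.fil k ↔ x ∈ L.fil k
  map_gr : ∀ k x (hx : x ∈ L.fil k),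
    L'.gr k (L'.cls k (Ψ x) ((map_fil k x).2 hx)) = L.gr k (L.cls k x hx)

/-! ### The deforming maps -/

/-- Maps `β + γ ∈ ℋ^{2,2}(𝔞₋)^𝔥`, `lam : V → 𝔰𝔬(V)` and `theta : Λ²V → 𝔰𝔬(V)`, the latter
`𝔥`-invariant, such that the brackets written in terms of them take values in `𝔞`. -/
structure DeformingMaps (𝔞 : GradedSubalgebra 𝔰) where
  /-- the cocycle `β + γ` -/
  cocycle : 𝔞.BilinNeg
  cocycle_mem : cocycle ∈ 𝔞.invNormalisedCocycles
  /-- the map `λ` -/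
  lam : V →ₗ[ℝ] so 𝔰.η
  /-- the map `θ` -/
  theta : V →ₗ[ℝ] V →ₗ[ℝ] so 𝔰.η
  theta_alt : ∀ v, theta v v = 0
  theta_inv : ∀ (A : 𝔞.h) (v w : V),
    ⁅(A : so 𝔰.η), theta v w⁆ = theta (𝔞.actV A v) w + theta v (𝔞.actV A w)
  mem_vs : ∀ v (s : 𝔞.S'), 𝔞.betaOf cocycle v s + 𝔰.act (lam v) s ∈ 𝔞.S'
  mem_ss : ∀ s t : 𝔞.S', 𝔞.gammaOf cocycle s t - lam (𝔰.κ s t) ∈ 𝔞.h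
  mem_hv : ∀ (A : 𝔞.h) v, ⁅(A : so 𝔰.η), lam v⁆ - lam (𝔞.actV A v) ∈ 𝔞.h
  mem_vw : ∀ v w,
    theta v w - lam ((lam v : Module.End ℝ V) w - (lam w : Module.End ℝ V) v)
      + ⁅lam v, lam w⁆ ∈ 𝔞.h

namespace DeformingMaps

variable {𝔞 : GradedSubalgebra 𝔰} (D : DeformingMaps 𝔞)

/-- `β(v,s)` -/
def beta (v : V) (s : 𝔞.S') : S := 𝔞.betaOf D.cocycle v s

/-- `γ(s,t)` -/
def gamma (s t : 𝔞.S') : so 𝔰.η := 𝔞.gammaOf D.cocycle s t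

/-- The component `[s,t]_𝔥 = γ(s,t) - λ(κ(s,t))`. -/
def ssH (s t : 𝔞.S') : 𝔞.h := ⟨_, D.mem_ss s t⟩

/-- The component `[A,v]_𝔥 = [A,λ(v)] - λ(Av)`. -/
def hvH (A : 𝔞.h) (v : V) : 𝔞.h := ⟨_, D.mem_hv A v⟩

/-- The bracket `[v,s] = β(v,s) + λ(v)·s`. -/
noncomputable def vsS (v : V) (s : 𝔞.S') : 𝔞.S' := ⟨_, D.mem_vs v s⟩

/-- The component `[v,w]_V = λ(v)w - λ(w)v`. -/
def vwV (v w : V) : V := (D.lam v : Module.End ℝ V) w - (D.lam w : Module.End ℝ V) v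

/-- The component `[v,w]_𝔥 = θ(v,w) - λ(λ(v)w - λ(w)v) + [λ(v),λ(w)]`. -/
def vwH (v w : V) : 𝔞.h := ⟨_, D.mem_vw v w⟩

/-- The deformed bracket on the vector space `𝔞 = V ⊕ S' ⊕ 𝔥`. -/
noncomputable def bracket (X Y : 𝔞.Alg) : 𝔞.Alg :=
  (𝔞.actV X.2.2 Y.1 - 𝔞.actV Y.2.2 X.1 + 𝔰.κ X.2.1 Y.2.1 + D.vwV X.1 Y.1,
    𝔞.act X.2.2 Y.2.1 - 𝔞.act Y.2.2 X.2.1 + D.vsS X.1 Y.2.1 - D.vsS Y.1 X.2.1,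
    ⁅X.2.2, Y.2.2⁆ + D.hvH X.2.2 Y.1 - D.hvH Y.2.2 X.1 + D.ssH X.2.1 Y.2.1 + D.vwH X.1 Y.1)

/-- The (super) Jacobi identities for the deformed bracket. -/
def Jacobi : Prop :=
  ∀ k l m : ℤ, ∀ X ∈ 𝔞.piece k, ∀ Y ∈ 𝔞.piece l, ∀ Z ∈ 𝔞.piece m,
    D.bracket X (D.bracket Y Z) =
      D.bracket (D.bracket X Y) Z + sgn k l • D.bracket Y (D.bracket X Z)

/-- `Φ : 𝔞 → F` presents the filtered deformation `F` by the deforming maps `D`: it maps each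
homogeneous subspace of `𝔞` into the corresponding term of the filtration, respecting parity, it
lifts the identification `𝔞 ≅ Gr F`, and the bracket of `F` corresponds to that of `D`. -/
structure IsPresentation {F : Type*} [AddCommGroup F] [Module ℝ F]
    (L : FilteredDeformation 𝔞 F) (Φ : 𝔞.Alg ≃ₗ[ℝ] F) : Prop where
  mem_fil : ∀ k, ∀ X ∈ 𝔞.piece k, Φ X ∈ L.fil k
  mem_part : ∀ k : ℤ, ∀ X ∈ 𝔞.piece k, Φ X ∈ L.part k
  gr_eq : ∀ k X (hX : X ∈ 𝔞.piece k),
    (L.gr k (L.cls k (Φ X) (mem_fil k X hX)) : 𝔞.Alg) = X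
  map_bracket : ∀ X Y, Φ (D.bracket X Y) = L.bracket (Φ X) (Φ Y)

/-- `(λ(u) · θ)(v,w)` -/
def lamTheta (u v w : V) : so 𝔰.η :=
  ⁅D.lam u, D.theta v w⁆ - D.theta ((D.lam u : Module.End ℝ V) v) w
    - D.theta v ((D.lam u : Module.End ℝ V) w)

/-- `θ(κ_s,v) + 2γ(s, β(v,s) + λ(v)·s) - [λ(v), γ(s,s)] = 0` -/
def ThetaKappa : Prop :=
  ∀ (v : V) (s : 𝔞.S'),
    D.theta (𝔰.κ s s) v + (2 : ℝ) • D.gamma s (D.vsS v s) - ⁅D.lam v, D.gamma s s⁆ = 0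

/-- `θ(v,w)·s` expressed through `β` and `λ`. -/
def ThetaSpinor : Prop :=
  ∀ (v w : V) (s : 𝔞.S'),
    𝔰.act (D.theta v w) s =
      D.beta v (D.vsS w s) - 𝔰.act (D.lam w) (D.beta v s)
          + D.beta ((D.lam w : Module.End ℝ V) v) s
        - D.beta w (D.vsS v s) + 𝔰.act (D.lam v) (D.beta w s)
          - D.beta ((D.lam v : Module.End ℝ V) w) s

/-- The algebraic Bianchi identity for `θ`. -/
def Bianchi : Prop :=
  ∀ u v w : V, (D.theta u v : Module.End ℝ V) w + (D.theta v w : Module.End ℝ V) u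
    + (D.theta w u : Module.End ℝ V) v = 0

/-- The differential-type Bianchi identity for `θ`. -/
def LamBianchi : Prop :=
  ∀ u v w : V, D.lamTheta u v w + D.lamTheta v w u + D.lamTheta w u v = 0

end DeformingMaps

end KillingAlg

/-! The substitution `v ↦ v + λ(v)` explains all the formulas. Replacing the `𝔥`-coordinate `A` of
`(x, s, A)` by `A + λ(x)` in `𝔰𝔬(V)` (`twist`) turns the deformed bracket into the flat bracket of
`𝔰` plus the three terms `β`, `γ`, `θ`. In these coordinates the cocycle conditions and
`𝔥`-invariance settle every component of the Jacobi identities except the four listed equations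
(`jacobi_iff`).

Existence. A linear lift of `𝔞 ≅ Gr F` transports the bracket to `𝔞`. By parity and filtration it
differs from the flat bracket only by maps of degree 2 and a map `Λ²V → 𝔥` of degree 4. A linear map
`V → 𝔰𝔬(V)` is the same thing as its torsion `Λ²V → V` (`exists_contorsion`,
`eq_zero_of_torsion_eq_zero`). Hence the component `Λ²V → V` of the bracket is the torsion of some
`λ`. Uniqueness forces `[A,v]` to have the stated form, and the Jacobi identities make the corrected
`β` and `γ` an invariant normalised cocycle.

Isomorphism. An isomorphism inducing the identity on `𝔞` can only add to `v` an element of `𝔥`.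
Uniqueness of `λ` for a given torsion shows that it preserves twisted coordinates, hence the
cocycle. For the converse the vectors `κ_s` with `s ∈ S'` must span `V` (`span_κ_eq_top`). Since
`γ(s,s) - λ(κ_s)` lies in `𝔥`, two choices of `λ` with the same `γ` then differ by a map into `𝔥`.
The equation `ThetaKappa` determines `θ`, and the shift by `λ - λ'` is an isomorphism.

Spanning. A non-zero `v` orthogonal to all `κ_s` lies in a Lorentzian plane spanned by `e₀` and
`e₁`. The Clifford product `e₀e₁` splits `S` into two eigenspaces of half the dimension. On each of
them `κ_s`, for `s ≠ 0`, is a non-zero multiple of one of the two null directions of the plane. As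
`v` is not orthogonal to both, `S'` meets one eigenspace trivially, against `dim S' > ½ dim S`. -/

namespace KillingAlg

/-! ### The spin lift of `𝔰𝔬(V)` into the even Clifford algebra. -/

section Spin

variable {V : Type*} [AddCommGroup V] [Module ℝ V]

theorem sum_dualBasis_smul_basis {ι : Type*} [Fintype ι] [DecidableEq ι]
    (η : LinearMap.BilinForm ℝ V) (hη : η.Nondegenerate)
    (b : Module.Basis ι ℝ V) (v : V) : ∑ i, η (η.dualBasis hη b i) v • b i = v := by
  have key : ∀ i, η (η.dualBasis hη b i) v = b.repr v i := by
    intro i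
    rw [← b.sum_repr v, map_sum, Finset.sum_eq_single i]
    · simp [LinearMap.BilinForm.apply_dualBasis_left]
    · intro j _ hj
      simp [LinearMap.BilinForm.apply_dualBasis_left, hj]
    · simp
  simp only [key, b.sum_repr]

theorem sum_basis_smul_dualBasis {ι : Type*} [Fintype ι] [DecidableEq ι]
    (η : LinearMap.BilinForm ℝ V) (hη : η.Nondegenerate)
    (hs : η.IsSymm) (b : Module.Basis ι ℝ V) (v : V) :
    ∑ i, η (b i) v • η.dualBasis hη b i = v := by
  conv_rhs => rw [← (η.dualBasis hη b).sum_repr v]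
  refine Finset.sum_congr rfl fun i _ => ?_
  rw [LinearMap.BilinForm.dualBasis_repr_apply]
  congr 1
  exact hs.eq _ _

theorem so_apply_left {η : LinearMap.BilinForm ℝ V} {A : Module.End ℝ V} (hA : A ∈ so η)
    (v w : V) : η (A v) w = -η v (A w) := by
  have h : η (A v) w = (-η) v (A w) := hA v w
  simpa using h

theorem mem_so_iff {η : LinearMap.BilinForm ℝ V} {A : Module.End ℝ V} :
    A ∈ so η ↔ ∀ v w, η (A v) w = -η v (A w) :=
  ⟨fun h => so_apply_left h, fun h v w => by
    have := h v w
    simpa using this⟩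

/-- The tensor `∑ bᵢ ⊗ bⁱ` is the inverse of `η`, hence annihilated by `𝔰𝔬(V)`. -/
theorem sum_basis_dualBasis_skew {M : Type*} [AddCommGroup M] [Module ℝ M]
    {ι : Type*} [Fintype ι] [DecidableEq ι]
    (η : LinearMap.BilinForm ℝ V) (hη : η.Nondegenerate) (hs : η.IsSymm)
    (b : Module.Basis ι ℝ V) {A : Module.End ℝ V} (hA : A ∈ so η) (f : V →ₗ[ℝ] V →ₗ[ℝ] M) :
    ∑ i, f (b i) (A (η.dualBasis hη b i)) = -∑ i, f (A (b i)) (η.dualBasis hη b i) := by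
  have h1 : ∀ i, f (b i) (A (η.dualBasis hη b i))
      = ∑ j, η (b j) (A (η.dualBasis hη b i)) • f (b i) (η.dualBasis hη b j) := by
    intro i
    conv_lhs => rw [← sum_basis_smul_dualBasis η hη hs b (A (η.dualBasis hη b i))]
    simp only [map_sum, map_smul]
  have h2 : ∀ j, f (A (b j)) (η.dualBasis hη b j)
      = ∑ i, η (η.dualBasis hη b i) (A (b j)) • f (b i) (η.dualBasis hη b j) := by
    intro j
    conv_lhs => rw [← sum_dualBasis_smul_basis η hη b (A (b j))]
    simp only [map_sum, map_smul, LinearMap.sum_apply, LinearMap.smul_apply]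
  rw [Finset.sum_congr rfl fun i _ => h1 i, Finset.sum_congr rfl fun i _ => h2 i,
    Finset.sum_comm, ← Finset.sum_neg_distrib]
  refine Finset.sum_congr rfl fun j _ => ?_
  rw [← Finset.sum_neg_distrib]
  refine Finset.sum_congr rfl fun i _ => ?_
  rw [← neg_smul]
  congr 1
  have h3 : η (A (b j)) (η.dualBasis hη b i) = η (η.dualBasis hη b i) (A (b j)) := hs.eq _ _
  rw [← h3, so_apply_left hA, neg_neg]

theorem spinLift_add [FiniteDimensional ℝ V] (η : LinearMap.BilinForm ℝ V) (hη : η.Nondegenerate)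
    (A B : Module.End ℝ V) : spinLift η hη (A + B) = spinLift η hη A + spinLift η hη B := by
  simp only [spinLift, LinearMap.add_apply, map_add, Finset.sum_add_distrib, smul_add, neg_add]

theorem spinLift_smul [FiniteDimensional ℝ V] (η : LinearMap.BilinForm ℝ V) (hη : η.Nondegenerate)
    (c : ℝ) (A : Module.End ℝ V) : spinLift η hη (c • A) = c • spinLift η hη A := by
  simp only [spinLift, LinearMap.smul_apply, map_smul, ← Finset.smul_sum, smul_neg]
  rw [smul_comm]

theorem coe_spinLift [FiniteDimensional ℝ V] (η : LinearMap.BilinForm ℝ V)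
    (hη : η.Nondegenerate) (A : Module.End ℝ V) :
    (spinLift η hη A : CliffordAlgebra (cliffordForm η))
      = -((1 / 4 : ℝ) • ∑ i, CliffordAlgebra.ι (cliffordForm η) (A (Module.finBasis ℝ V i))
          * CliffordAlgebra.ι (cliffordForm η) (η.dualBasis hη (Module.finBasis ℝ V) i)) := by
  simp only [spinLift, NegMemClass.coe_neg, SetLike.val_smul, AddSubmonoidClass.coe_finsetSum]
  rfl

/-- The commutator with the lift of `A` is a derivation of the Clifford algebra which acts as `A` on
vectors. Applied to `∑ B(bᵢ) bⁱ` it gives one sum with `AB` and one with `A` on the dual basis.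
Invariance of `∑ bᵢ ⊗ bⁱ` turns the latter into the sum with `-BA`. -/
theorem spinLift_lie [FiniteDimensional ℝ V] (η : LinearMap.BilinForm ℝ V)
    (hη : η.Nondegenerate) (hs : η.IsSymm) (A B : Module.End ℝ V) (hA : A ∈ so η) :
    spinLift η hη (A * B - B * A)
      = spinLift η hη A * spinLift η hη B - spinLift η hη B * spinLift η hη A := by
  apply Subtype.ext
  set b := Module.finBasis ℝ V
  set d := η.dualBasis hη b
  set L : CliffordAlgebra (cliffordForm η) := (spinLift η hη A : CliffordAlgebra (cliffordForm η))
    with hL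
  have hcomm : ∀ v, L * CliffordAlgebra.ι (cliffordForm η) v
      = CliffordAlgebra.ι (cliffordForm η) v * L + CliffordAlgebra.ι (cliffordForm η) (A v) :=
    fun v => by rw [← spinLift_commutator η hη hs A hA v]; abel
  have hterm : ∀ x y, L * (CliffordAlgebra.ι (cliffordForm η) x
        * CliffordAlgebra.ι (cliffordForm η) y)
      - (CliffordAlgebra.ι (cliffordForm η) x * CliffordAlgebra.ι (cliffordForm η) y) * L
      = CliffordAlgebra.ι (cliffordForm η) (A x) * CliffordAlgebra.ι (cliffordForm η) y
        + CliffordAlgebra.ι (cliffordForm η) x * CliffordAlgebra.ι (cliffordForm η) (A y) := by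
    intro x y
    rw [← mul_assoc, hcomm x, add_mul, mul_assoc, hcomm y, mul_add, mul_assoc]
    abel
  have hskew := sum_basis_dualBasis_skew η hη hs b hA
    (((LinearMap.mul ℝ (CliffordAlgebra (cliffordForm η))).compl₁₂
      ((CliffordAlgebra.ι (cliffordForm η)).comp B) (CliffordAlgebra.ι (cliffordForm η))))
  simp only [LinearMap.compl₁₂_apply, LinearMap.mul_apply', LinearMap.comp_apply] at hskew
  change _ = L * (spinLift η hη B : CliffordAlgebra (cliffordForm η))
    - (spinLift η hη B : CliffordAlgebra (cliffordForm η)) * L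
  rw [coe_spinLift η hη B, coe_spinLift η hη (A * B - B * A), mul_neg, neg_mul, mul_smul_comm,
    smul_mul_assoc, Finset.mul_sum, Finset.sum_mul, neg_sub_neg, ← smul_sub,
    ← Finset.sum_sub_distrib, ← smul_neg]
  congr 1
  rw [← Finset.sum_neg_distrib]
  have : ∀ i, (CliffordAlgebra.ι (cliffordForm η) (B (b i)) * CliffordAlgebra.ι (cliffordForm η)
        (d i)) * L - L * (CliffordAlgebra.ι (cliffordForm η) (B (b i))
        * CliffordAlgebra.ι (cliffordForm η) (d i))
      = -(CliffordAlgebra.ι (cliffordForm η) (A (B (b i))) * CliffordAlgebra.ι (cliffordForm η) (d i))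
        - CliffordAlgebra.ι (cliffordForm η) (B (b i))
          * CliffordAlgebra.ι (cliffordForm η) (A (d i)) := by
    intro i
    rw [← neg_sub, hterm]
    abel
  rw [Finset.sum_congr rfl fun i _ => this i, Finset.sum_sub_distrib, hskew]
  simp only [LinearMap.sub_apply, Module.End.mul_apply, map_sub, sub_mul,
    Finset.sum_neg_distrib, Finset.sum_sub_distrib]
  abel

/-- The rank-two endomorphism `w ↦ η(u,w) v - η(v,w) u`. -/
noncomputable def wedge (η : LinearMap.BilinForm ℝ V) (u v : V) : Module.End ℝ V :=
  (η u).smulRight v - (η v).smulRight u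

theorem wedge_apply (η : LinearMap.BilinForm ℝ V) (u v w : V) :
    wedge η u v w = η u w • v - η v w • u := rfl

theorem wedge_mem_so {η : LinearMap.BilinForm ℝ V} (hs : η.IsSymm) (u v : V) :
    wedge η u v ∈ so η := by
  rw [mem_so_iff]
  intro x y
  have h1 : η x v = η v x := hs.eq _ _
  have h2 : η x u = η u x := hs.eq _ _
  simp only [wedge_apply, map_sub, map_smul, LinearMap.sub_apply, LinearMap.smul_apply,
    smul_eq_mul, h1, h2]
  ring

/-- Orthogonal vectors anticommute. Single vectors are not in the even algebra, so the relation for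
`u · u` is polarised instead. -/
theorem even_bilin_swap (η : LinearMap.BilinForm ℝ V) (hs : η.IsSymm) {u v : V}
    (h : η u v = 0) : (CliffordAlgebra.even.ι (cliffordForm η)).bilin v u
      = -(CliffordAlgebra.even.ι (cliffordForm η)).bilin u v := by
  set f := CliffordAlgebra.even.ι (cliffordForm η)
  have h' : η v u = 0 := by rw [← h]; exact hs.eq _ _
  have h1 := f.contract (u + v)
  have hq : cliffordForm η (u + v) = cliffordForm η u + cliffordForm η v := by
    simp [cliffordForm, h, h']
    ring
  rw [hq, (algebraMap ℝ _).map_add, ← f.contract u, ← f.contract v, map_add, map_add,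
    LinearMap.add_apply, LinearMap.add_apply] at h1
  rw [eq_neg_iff_add_eq_zero, ← sub_eq_zero.2 h1]
  abel

/-- Makes equivariance of `κ` explicit: the rotation or boost in a plane acts on spinors by half a
Clifford product. -/
theorem spinLift_wedge [FiniteDimensional ℝ V] (η : LinearMap.BilinForm ℝ V)
    (hη : η.Nondegenerate) (hs : η.IsSymm) {u v : V} (h : η u v = 0) :
    spinLift η hη (wedge η u v)
      = (1 / 2 : ℝ) • (CliffordAlgebra.even.ι (cliffordForm η)).bilin u v := by
  have key : ∀ x y, ∑ i, (CliffordAlgebra.even.ι (cliffordForm η)).bilin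
      (η x (Module.finBasis ℝ V i) • y) (η.dualBasis hη (Module.finBasis ℝ V) i)
      = (CliffordAlgebra.even.ι (cliffordForm η)).bilin y x := by
    intro x y
    conv_rhs => rw [← sum_basis_smul_dualBasis η hη hs (Module.finBasis ℝ V) x]
    simp only [map_sum, map_smul, LinearMap.smul_apply]
    refine Finset.sum_congr rfl fun i _ => ?_
    congr 1
    exact hs.eq _ _
  simp only [spinLift, wedge_apply, map_sub, LinearMap.sub_apply, Finset.sum_sub_distrib]
  rw [key, key, even_bilin_swap η hs h]
  module

end Spin

/-! ### The representation of `𝔰𝔬(V)` on spinors. -/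

namespace FlatModel

variable {V S : Type*} [AddCommGroup V] [Module ℝ V] [FiniteDimensional ℝ V]
  [AddCommGroup S] [Module ℝ S] (𝔰 : FlatModel V S)

@[simp] theorem act_add (A B : so 𝔰.η) : 𝔰.act (A + B) = 𝔰.act A + 𝔰.act B := by
  simp [act, spinLift_add]

@[simp] theorem act_smul (c : ℝ) (A : so 𝔰.η) : 𝔰.act (c • A) = c • 𝔰.act A := by
  simp [act, spinLift_smul]

@[simp] theorem act_neg (A : so 𝔰.η) : 𝔰.act (-A) = -𝔰.act A := by
  rw [← neg_one_smul ℝ A, act_smul, neg_one_smul]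

@[simp] theorem act_sub (A B : so 𝔰.η) : 𝔰.act (A - B) = 𝔰.act A - 𝔰.act B := by
  rw [sub_eq_add_neg, act_add, act_neg, ← sub_eq_add_neg]

@[simp] theorem act_zero : 𝔰.act 0 = 0 := by
  rw [← zero_smul ℝ (0 : so 𝔰.η), act_smul, zero_smul]

theorem act_lie (A B : so 𝔰.η) (s : S) :
    𝔰.act ⁅A, B⁆ s = 𝔰.act A (𝔰.act B s) - 𝔰.act B (𝔰.act A s) := by
  have h : ((⁅A, B⁆ : so 𝔰.η) : Module.End ℝ V)
      = (A : Module.End ℝ V) * B - (B : Module.End ℝ V) * A := rfl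
  simp only [act, h, spinLift_lie 𝔰.η 𝔰.η_nondeg 𝔰.η_symm _ _ A.2, map_sub, map_mul]
  rfl

theorem coe_lie_apply (A B : so 𝔰.η) (v : V) :
    ((⁅A, B⁆ : so 𝔰.η) : Module.End ℝ V) v
      = (A : Module.End ℝ V) ((B : Module.End ℝ V) v)
        - (B : Module.End ℝ V) ((A : Module.End ℝ V) v) := rfl

theorem apply_κ (A : so 𝔰.η) (s t : S) :
    (A : Module.End ℝ V) (𝔰.κ s t) = 𝔰.κ (𝔰.act A s) t + 𝔰.κ s (𝔰.act A t) :=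
  𝔰.κ_equivariant A A.2 s t

/-- Elements of `𝔰𝔬(V)` with equal values on vectors are equal. -/
theorem so_ext {A B : so 𝔰.η} (h : ∀ v, (A : Module.End ℝ V) v = (B : Module.End ℝ V) v) :
    A = B := Subtype.ext (LinearMap.ext h)

end FlatModel

end KillingAlg

namespace KillingAlg

/-! ### Homogeneity -/

/-! ### Orthonormal triples in a Lorentzian space. -/

section Lorentzian

variable {V : Type*} [AddCommGroup V] [Module ℝ V]

/-- All that is needed of the signature: a unit timelike vector with positive definite orthogonal
complement. -/
theorem IsLorentzian.exists_timelike {η : LinearMap.BilinForm ℝ V} (h : IsLorentzian η) :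
    ∃ e : V, η e e = -1 ∧ ∀ x, η e x = 0 → x ≠ 0 → 0 < η x x := by
  obtain ⟨n, b, hb⟩ := h
  have hform : ∀ x, η x x = ∑ i, b.repr x i * b.repr x i * (if i = 0 then -1 else 1) := by
    intro x
    conv_lhs => rw [← b.sum_repr x]
    simp only [map_sum, LinearMap.sum_apply, map_smul, LinearMap.smul_apply, hb, smul_eq_mul]
    refine Finset.sum_congr rfl fun i _ => ?_
    simp
  refine ⟨b 0, by simp [hb], fun x hx hx0 => ?_⟩
  have h0 : b.repr x 0 = 0 := by
    rw [← b.sum_repr x, map_sum] at hx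
    simpa only [map_smul, hb, smul_eq_mul, ↓reduceIte, mul_ite, mul_neg, mul_one, mul_zero,
      Finset.sum_ite_eq, Finset.mem_univ, neg_eq_zero] using hx
  obtain ⟨j, hj⟩ : ∃ j, b.repr x j ≠ 0 := by
    by_contra! hc
    exact hx0 (b.repr.map_eq_zero_iff.1 (Finsupp.ext hc))
  rw [hform]
  refine Finset.sum_pos' (fun i _ => ?_) ⟨j, Finset.mem_univ _, ?_⟩
  · by_cases hi : i = 0
    · simp [hi, h0]
    · simpa [hi] using mul_self_nonneg (b.repr x i)
  · have hj0 : j ≠ 0 := fun h => hj (h ▸ h0)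
    simpa [hj0] using hj

theorem exists_ne_zero_orthogonal [FiniteDimensional ℝ V] (hdim : 2 < Module.finrank ℝ V)
    (f g : Module.Dual ℝ V) : ∃ x : V, x ≠ 0 ∧ f x = 0 ∧ g x = 0 := by
  have hk : LinearMap.ker (f.prod g) ≠ ⊥ :=
    LinearMap.ker_ne_bot_of_finrank_lt (by simpa using hdim)
  obtain ⟨x, hx, hx0⟩ := Submodule.exists_mem_ne_zero_of_ne_bot hk
  have h : f x = 0 ∧ g x = 0 := by simpa using hx
  exact ⟨x, hx0, h⟩

/-- The vector `e₁` is the normalised part of `v` orthogonal to `e`; the condition `dim V > 2`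
leaves room for `e₂`. -/
theorem exists_orthonormal_triple [FiniteDimensional ℝ V] {η : LinearMap.BilinForm ℝ V}
    (hdim : 2 < Module.finrank ℝ V) {e : V} (he : η e e = -1)
    (hpos : ∀ x, η e x = 0 → x ≠ 0 → 0 < η x x) (v : V) :
    ∃ e₁ e₂ : V, η e₁ e₁ = 1 ∧ η e₂ e₂ = 1 ∧ η e e₁ = 0 ∧ η e e₂ = 0 ∧ η e₁ e₂ = 0 ∧
      ∃ x y : ℝ, v = x • e + y • e₁ := by
  have hunit : ∀ w, η e w = 0 → w ≠ 0 →
      η ((√(η w w))⁻¹ • w) ((√(η w w))⁻¹ • w) = 1 := by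
    intro w hw hw0
    have h1 := hpos w hw hw0
    have h2 : √(η w w) ≠ 0 := (Real.sqrt_pos.2 h1).ne'
    simp only [map_smul, LinearMap.smul_apply, smul_eq_mul]
    nth_rw 3 [← Real.mul_self_sqrt h1.le]
    field_simp
  obtain ⟨e₁, h11, h01, hv⟩ : ∃ e₁ : V, η e₁ e₁ = 1 ∧ η e e₁ = 0 ∧
      ∃ x y : ℝ, v = x • e + y • e₁ := by
    -- As `η e e = -1`, the part of `v` orthogonal to `e` is `v + η(e,v) e`. If it vanishes, any
    -- unit vector orthogonal to `e` serves as `e₁`.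
    by_cases hw : v + η e v • e = 0
    · obtain ⟨w, hw0, hew, -⟩ := exists_ne_zero_orthogonal hdim (η e) (η e)
      refine ⟨_, hunit w hew hw0, by simp [hew], -η e v, 0, ?_⟩
      rw [zero_smul, add_zero, neg_smul]
      exact eq_neg_of_add_eq_zero_left hw
    · have hew : η e (v + η e v • e) = 0 := by simp [he]
      refine ⟨_, hunit _ hew hw, by rw [map_smul, hew, smul_zero], -η e v,
        √(η (v + η e v • e) (v + η e v • e)), ?_⟩
      rw [smul_smul, mul_inv_cancel₀ (Real.sqrt_pos.2 (hpos _ hew hw)).ne', one_smul]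
      module
  obtain ⟨w, hw0, hew, hew1⟩ := exists_ne_zero_orthogonal hdim (η e) (η e₁)
  exact ⟨e₁, _, h11, hunit w hew hw0, h01, by simp [hew], by simp [hew1], hv⟩

end Lorentzian

/-! ### The squaring map on the eigenspaces of a boost. -/

namespace FlatModel

variable {V S : Type*} [AddCommGroup V] [Module ℝ V] [FiniteDimensional ℝ V]
  [AddCommGroup S] [Module ℝ S] (𝔰 : FlatModel V S)

/-- The action on spinors of the Clifford product of two vectors. -/
noncomputable def cl (u v : V) : Module.End ℝ S :=
  𝔰.ρ ((CliffordAlgebra.even.ι (cliffordForm 𝔰.η)).bilin u v)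

theorem cl_self (u : V) : 𝔰.cl u u = -(𝔰.η u u) • (1 : Module.End ℝ S) := by
  rw [cl, (CliffordAlgebra.even.ι (cliffordForm 𝔰.η)).contract, AlgHom.commutes,
    Algebra.algebraMap_eq_smul_one]
  rfl

theorem cl_mul (u v w : V) : 𝔰.cl u v * 𝔰.cl v w = -(𝔰.η v v) • 𝔰.cl u w := by
  rw [cl, cl, ← map_mul, (CliffordAlgebra.even.ι (cliffordForm 𝔰.η)).contract_mid, map_smul]
  rfl

theorem cl_swap {u v : V} (h : 𝔰.η u v = 0) : 𝔰.cl v u = -𝔰.cl u v := by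
  rw [cl, even_bilin_swap 𝔰.η 𝔰.η_symm h, map_neg, cl]

theorem κ_cl {u v : V} (h : 𝔰.η u v = 0) (s t : S) :
    𝔰.κ (𝔰.cl u v s) t + 𝔰.κ s (𝔰.cl u v t)
      = (2 : ℝ) • (𝔰.η u (𝔰.κ s t) • v - 𝔰.η v (𝔰.κ s t) • u) := by
  have h1 := 𝔰.κ_equivariant _ (wedge_mem_so 𝔰.η_symm u v) s t
  rw [wedge_apply, spinLift_wedge 𝔰.η 𝔰.η_nondeg 𝔰.η_symm h] at h1
  rw [h1]
  simp only [map_smul, LinearMap.smul_apply, cl]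
  module

/-- An orthonormal triple whose first vector is timelike. -/
structure IsTriple (e₀ e₁ e₂ : V) : Prop where
  h00 : 𝔰.η e₀ e₀ = -1
  h11 : 𝔰.η e₁ e₁ = 1
  h22 : 𝔰.η e₂ e₂ = 1
  h01 : 𝔰.η e₀ e₁ = 0
  h02 : 𝔰.η e₀ e₂ = 0
  h12 : 𝔰.η e₁ e₂ = 0
  pos : ∀ x, 𝔰.η e₀ x = 0 → x ≠ 0 → 0 < 𝔰.η x x

namespace IsTriple

variable {𝔰} {e₀ e₁ e₂ : V}

theorem h10 (T : 𝔰.IsTriple e₀ e₁ e₂) : 𝔰.η e₁ e₀ = 0 := by rw [← T.h01]; exact 𝔰.η_symm.eq _ _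

theorem h21 (T : 𝔰.IsTriple e₀ e₁ e₂) : 𝔰.η e₂ e₁ = 0 := by rw [← T.h12]; exact 𝔰.η_symm.eq _ _

/-- The relation `v · v = -η(v,v)` makes `e₀e₁` an involution and `e₁e₂` a complex structure;
sharing one vector, they anticommute. Vectors do not act on `S`, so products are contracted inside
the even algebra. -/
theorem boost_boost (T : 𝔰.IsTriple e₀ e₁ e₂) (s : S) : 𝔰.cl e₀ e₁ (𝔰.cl e₀ e₁ s) = s := by
  have h : 𝔰.cl e₀ e₁ * 𝔰.cl e₀ e₁ = 1 := by
    nth_rw 2 [𝔰.cl_swap T.h10]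
    rw [mul_neg, cl_mul, cl_self, T.h11, T.h00]
    simp
  exact LinearMap.congr_fun h s

theorem rot_rot (T : 𝔰.IsTriple e₀ e₁ e₂) (s : S) : 𝔰.cl e₁ e₂ (𝔰.cl e₁ e₂ s) = -s := by
  have h : 𝔰.cl e₁ e₂ * 𝔰.cl e₁ e₂ = -1 := by
    nth_rw 2 [𝔰.cl_swap T.h21]
    rw [mul_neg, cl_mul, cl_self, T.h11, T.h22]
    simp
  exact LinearMap.congr_fun h s

theorem boost_rot (T : 𝔰.IsTriple e₀ e₁ e₂) (s : S) : 𝔰.cl e₀ e₁ (𝔰.cl e₁ e₂ s) = -𝔰.cl e₁ e₂ (𝔰.cl e₀ e₁ s) := by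
  have h : 𝔰.cl e₀ e₁ * 𝔰.cl e₁ e₂ = -(𝔰.cl e₁ e₂ * 𝔰.cl e₀ e₁) := by
    have h' : 𝔰.cl e₁ e₂ * 𝔰.cl e₀ e₁ = 𝔰.cl e₂ e₁ * 𝔰.cl e₁ e₀ := by
      rw [𝔰.cl_swap T.h21, 𝔰.cl_swap T.h10, neg_mul_neg]
    rw [h', cl_mul, cl_mul, 𝔰.cl_swap T.h02, smul_neg, neg_neg]
  exact LinearMap.congr_fun h s

theorem rot_injective (T : 𝔰.IsTriple e₀ e₁ e₂) : Function.Injective (𝔰.cl e₁ e₂) := by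
  intro s t h
  have := congrArg (𝔰.cl e₁ e₂) h
  rwa [T.rot_rot, T.rot_rot, neg_inj] at this

/-- The squaring map paired with the timelike vector is invariant under the rotation. -/
theorem η_κ_rot (T : 𝔰.IsTriple e₀ e₁ e₂) (s : S) :
    𝔰.η e₀ (𝔰.κ (𝔰.cl e₁ e₂ s) (𝔰.cl e₁ e₂ s)) = 𝔰.η e₀ (𝔰.κ s s) := by
  have h := congrArg (𝔰.η e₀) (𝔰.κ_cl T.h12 s (𝔰.cl e₁ e₂ s))
  rw [T.rot_rot] at h
  simp only [map_add, map_neg, map_smul, map_sub, T.h01, T.h02, smul_zero, sub_zero] at h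
  linarith

/-- Equivariance makes `κ(s,t)` an eigenvector of the boost acting on `V`, hence a multiple of a
null vector of the plane. -/
theorem κ_plus_plus (T : 𝔰.IsTriple e₀ e₁ e₂) {s t : S} (hs : 𝔰.cl e₀ e₁ s = s) (ht : 𝔰.cl e₀ e₁ t = t) :
    𝔰.κ s t = 𝔰.η e₀ (𝔰.κ s t) • (e₁ - e₀) := by
  have h := 𝔰.κ_cl T.h01 s t
  rw [hs, ht, ← two_smul ℝ (𝔰.κ s t)] at h
  have h' := smul_right_injective V (two_ne_zero (α := ℝ)) h
  have h0 := congrArg (𝔰.η e₀) h'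
  simp only [map_smul, map_sub, T.h00, T.h01, smul_eq_mul] at h0
  conv_lhs => rw [h']
  rw [show 𝔰.η e₁ (𝔰.κ s t) = 𝔰.η e₀ (𝔰.κ s t) by linarith, smul_sub]

theorem κ_minus_minus (T : 𝔰.IsTriple e₀ e₁ e₂) {s t : S} (hs : 𝔰.cl e₀ e₁ s = -s) (ht : 𝔰.cl e₀ e₁ t = -t) :
    𝔰.κ s t = -𝔰.η e₀ (𝔰.κ s t) • (e₀ + e₁) := by
  have h := 𝔰.κ_cl T.h01 s t
  rw [hs, ht, map_neg, map_neg, LinearMap.neg_apply, ← neg_add, ← two_smul ℝ (𝔰.κ s t),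
    ← smul_neg] at h
  have h' := smul_right_injective V (two_ne_zero (α := ℝ)) h
  have h0 := congrArg (𝔰.η e₀) h'
  simp only [map_smul, map_sub, map_neg, T.h00, T.h01, smul_eq_mul] at h0
  rw [show 𝔰.η e₁ (𝔰.κ s t) = -𝔰.η e₀ (𝔰.κ s t) by linarith] at h'
  rw [← neg_inj, h']
  module

/-- Opposite weights cancel, so the boost annihilates `κ(s,t)`, which must be orthogonal to the
plane. -/
theorem η_κ_plus_minus (T : 𝔰.IsTriple e₀ e₁ e₂) {s t : S} (hs : 𝔰.cl e₀ e₁ s = s) (ht : 𝔰.cl e₀ e₁ t = -t) :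
    𝔰.η e₀ (𝔰.κ s t) = 0 ∧ 𝔰.η e₁ (𝔰.κ s t) = 0 := by
  have h := 𝔰.κ_cl T.h01 s t
  rw [hs, ht, map_neg, add_neg_cancel] at h
  have h0 := congrArg (𝔰.η e₀) h
  have h1 := congrArg (𝔰.η e₁) h
  simp only [map_zero, map_smul, map_sub, T.h00, T.h01, T.h11, T.h10, smul_eq_mul] at h0 h1
  constructor <;> linarith

/-- This is causality of `κ(s + t, s + t)`. The diagonal terms are multiples of the null vectors `e₁
- e₀` and `e₀ + e₁`, whose inner product is 2, and `κ(s,t)` is orthogonal to both. -/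
theorem η_κ_mixed_le (T : 𝔰.IsTriple e₀ e₁ e₂) (hc : 𝔰.IsCausal) {s t : S} (hs : 𝔰.cl e₀ e₁ s = s)
    (ht : 𝔰.cl e₀ e₁ t = -t) :
    𝔰.η (𝔰.κ s t) (𝔰.κ s t) ≤ 𝔰.η e₀ (𝔰.κ s s) * 𝔰.η e₀ (𝔰.κ t t) := by
  have h := hc (s + t)
  obtain ⟨h0, h1⟩ := T.η_κ_plus_minus hs ht
  have h0' : 𝔰.η (𝔰.κ s t) e₀ = 0 := by rw [← h0]; exact 𝔰.η_symm.eq _ _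
  have h1' : 𝔰.η (𝔰.κ s t) e₁ = 0 := by rw [← h1]; exact 𝔰.η_symm.eq _ _
  have hsum : 𝔰.κ (s + t) (s + t) = 𝔰.η e₀ (𝔰.κ s s) • (e₁ - e₀)
      + (-𝔰.η e₀ (𝔰.κ t t)) • (e₀ + e₁) + (2 : ℝ) • 𝔰.κ s t := by
    rw [← T.κ_plus_plus hs hs, ← T.κ_minus_minus ht ht]
    simp only [map_add, LinearMap.add_apply, 𝔰.κ_symm t s]
    module
  rw [hsum] at h
  generalize 𝔰.κ s t = k at *
  simp only [map_add, map_sub, map_smul, LinearMap.add_apply, LinearMap.sub_apply,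
    LinearMap.smul_apply, smul_eq_mul, T.h00, T.h01, T.h10, T.h11, h0, h1,
    h0', h1'] at h
  nlinarith

/-- The form `η(e₀, κ_s)` has a constant sign on the eigenspace. The rotation carries `t` to the
opposite eigenspace without changing this form, and `κ(s, e₁e₂t)` is orthogonal to `e₀`, hence zero
or spacelike. -/
theorem η_κ_mul_nonneg (T : 𝔰.IsTriple e₀ e₁ e₂) (hc : 𝔰.IsCausal) {s t : S} (hs : 𝔰.cl e₀ e₁ s = s)
    (ht : 𝔰.cl e₀ e₁ t = t) : 0 ≤ 𝔰.η e₀ (𝔰.κ s s) * 𝔰.η e₀ (𝔰.κ t t) := by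
  have hJ : 𝔰.cl e₀ e₁ (𝔰.cl e₁ e₂ t) = -𝔰.cl e₁ e₂ t := by rw [T.boost_rot, ht]
  have h := T.η_κ_mixed_le hc hs hJ
  rw [T.η_κ_rot] at h
  refine le_trans ?_ h
  rcases eq_or_ne (𝔰.κ s (𝔰.cl e₁ e₂ t)) 0 with h0 | h0
  · rw [h0, map_zero]
  · exact (T.pos _ (T.η_κ_plus_minus hs hJ).1 h0).le

/-- Against the opposite eigenspace, `κ(s,t)` is spacelike or zero, and the mixed inequality forces
zero. Within its own eigenspace, `s` is an isotropic vector of a semidefinite form, hence in the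
radical. Non-degeneracy concludes. -/
theorem eq_zero_of_plus (T : 𝔰.IsTriple e₀ e₁ e₂) (hc : 𝔰.IsCausal) (hn : 𝔰.IsNondegenerate) {s : S}
    (hs : 𝔰.cl e₀ e₁ s = s) (h : 𝔰.η e₀ (𝔰.κ s s) = 0) : s = 0 := by
  have hminus : ∀ t, 𝔰.cl e₀ e₁ t = -t → 𝔰.κ s t = 0 := by
    intro t ht
    by_contra hne
    have h1 := T.η_κ_mixed_le hc hs ht
    have h2 := T.pos _ (T.η_κ_plus_minus hs ht).1 hne
    rw [h, zero_mul] at h1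
    linarith
  have hplus : ∀ t, 𝔰.cl e₀ e₁ t = t → 𝔰.κ s t = 0 := by
    intro t ht
    have hx : ∀ x y : ℝ, 0 ≤ (2 * x * 𝔰.η e₀ (𝔰.κ s t) + x * x * 𝔰.η e₀ (𝔰.κ t t))
        * (2 * y * 𝔰.η e₀ (𝔰.κ s t) + y * y * 𝔰.η e₀ (𝔰.κ t t)) := by
      intro x y
      have hq : ∀ z : ℝ, 𝔰.η e₀ (𝔰.κ (s + z • t) (s + z • t))
          = 2 * z * 𝔰.η e₀ (𝔰.κ s t) + z * z * 𝔰.η e₀ (𝔰.κ t t) := by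
        intro z
        simp only [map_add, map_smul, LinearMap.add_apply, LinearMap.smul_apply, smul_eq_mul, h,
          𝔰.κ_symm t s]
        ring
      have hp : ∀ z : ℝ, 𝔰.cl e₀ e₁ (s + z • t) = s + z • t := by
        intro z
        rw [map_add, map_smul, hs, ht]
      have := T.η_κ_mul_nonneg hc (hp x) (hp y)
      rwa [hq, hq] at this
    have hy : ∀ x : ℝ, 0 ≤ (2 * x * 𝔰.η e₀ (𝔰.κ s t) + x * x * 𝔰.η e₀ (𝔰.κ t t))
        * 𝔰.η e₀ (𝔰.κ t t) := by
      intro x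
      have hp : 𝔰.cl e₀ e₁ (s + x • t) = s + x • t := by rw [map_add, map_smul, hs, ht]
      have := T.η_κ_mul_nonneg hc hp ht
      simp only [map_add, map_smul, LinearMap.add_apply, LinearMap.smul_apply, smul_eq_mul, h,
          𝔰.κ_symm t s] at this
      linarith
    suffices ha : 𝔰.η e₀ (𝔰.κ s t) = 0 by rw [T.κ_plus_plus hs ht, ha, zero_smul]
    generalize 𝔰.η e₀ (𝔰.κ s t) = p at hx hy ⊢
    generalize 𝔰.η e₀ (𝔰.κ t t) = q at hx hy
    -- For `q = 0` the values at `1` and `-1` have opposite signs unless `p = 0`. Otherwise `-p/q`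
    -- is the vertex of `2px + qx²`, where the value times `q` is `-p²`.
    rcases eq_or_ne q 0 with rfl | hq
    · nlinarith [hx 1 (-1)]
    · have h1 := hy (-p / q)
      have h2 : (2 * (-p / q) * p + -p / q * (-p / q) * q) * q = -(p * p) := by
        field_simp
        ring
      rw [h2] at h1
      nlinarith
  refine hn s fun t => ?_
  -- `2t` is the sum of its projections to the two eigenspaces.
  have h1 := hplus (t + 𝔰.cl e₀ e₁ t) (by rw [map_add, T.boost_boost, add_comm])
  have h2 := hminus (t - 𝔰.cl e₀ e₁ t) (by rw [map_sub, T.boost_boost, neg_sub])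
  have h3 : (2 : ℝ) • 𝔰.κ s t = 0 := by
    rw [← add_zero (0 : V)]
    nth_rw 1 [← h1]
    rw [← h2, ← map_add, two_smul, ← map_add]
    congr 1
    abel
  exact (smul_eq_zero.1 h3).resolve_left two_ne_zero

theorem eq_zero_of_minus (T : 𝔰.IsTriple e₀ e₁ e₂) (hc : 𝔰.IsCausal) (hn : 𝔰.IsNondegenerate) {s : S}
    (hs : 𝔰.cl e₀ e₁ s = -s) (h : 𝔰.η e₀ (𝔰.κ s s) = 0) : s = 0 := by
  have hJ : 𝔰.cl e₀ e₁ (𝔰.cl e₁ e₂ s) = 𝔰.cl e₁ e₂ s := by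
    rw [T.boost_rot, hs, map_neg, neg_neg]
  have h1 := T.eq_zero_of_plus hc hn hJ (by rw [T.η_κ_rot, h])
  exact T.rot_injective (by rw [h1, map_zero])

/-- The rotation anticommutes with the boost and is injective, so it exchanges the two eigenspaces.
-/
theorem finrank_eigenspaces [FiniteDimensional ℝ S] (T : 𝔰.IsTriple e₀ e₁ e₂) :
    2 * Module.finrank ℝ (LinearMap.ker (𝔰.cl e₀ e₁ - 1)) = Module.finrank ℝ S ∧
      2 * Module.finrank ℝ (LinearMap.ker (𝔰.cl e₀ e₁ + 1)) = Module.finrank ℝ S := by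
  have hp : ∀ s, s ∈ LinearMap.ker (𝔰.cl e₀ e₁ - 1) ↔ 𝔰.cl e₀ e₁ s = s := by
    intro s; simp [sub_eq_zero]
  have hm : ∀ s, s ∈ LinearMap.ker (𝔰.cl e₀ e₁ + 1) ↔ 𝔰.cl e₀ e₁ s = -s := by
    intro s; simp [eq_neg_iff_add_eq_zero]
  have hcompl : IsCompl (LinearMap.ker (𝔰.cl e₀ e₁ - 1)) (LinearMap.ker (𝔰.cl e₀ e₁ + 1)) := by
    constructor
    · rw [Submodule.disjoint_def]
      intro s h1 h2
      rw [hp] at h1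
      rw [hm, h1] at h2
      rw [eq_neg_iff_add_eq_zero, ← two_smul ℝ] at h2
      exact (smul_eq_zero.1 h2).resolve_left two_ne_zero
    · rw [codisjoint_iff, eq_top_iff]
      intro s _
      have h1 : s = (1 / 2 : ℝ) • (s + 𝔰.cl e₀ e₁ s) + (1 / 2 : ℝ) • (s - 𝔰.cl e₀ e₁ s) := by
        module
      rw [h1]
      refine Submodule.add_mem_sup (Submodule.smul_mem _ _ ((hp _).2 ?_))
        (Submodule.smul_mem _ _ ((hm _).2 ?_))
      · rw [map_add, T.boost_boost, add_comm]
      · rw [map_sub, T.boost_boost, neg_sub]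
  have hsum := Submodule.finrank_add_eq_of_isCompl hcompl
  have h1 : Module.finrank ℝ (LinearMap.ker (𝔰.cl e₀ e₁ - 1))
      ≤ Module.finrank ℝ (LinearMap.ker (𝔰.cl e₀ e₁ + 1)) := by
    rw [(Submodule.equivMapOfInjective _ T.rot_injective _).finrank_eq]
    refine Submodule.finrank_mono ?_
    rintro _ ⟨s, hs, rfl⟩
    rw [hm, T.boost_rot, (hp s).1 hs]
  have h2 : Module.finrank ℝ (LinearMap.ker (𝔰.cl e₀ e₁ + 1))
      ≤ Module.finrank ℝ (LinearMap.ker (𝔰.cl e₀ e₁ - 1)) := by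
    rw [(Submodule.equivMapOfInjective _ T.rot_injective _).finrank_eq]
    refine Submodule.finrank_mono ?_
    rintro _ ⟨s, hs, rfl⟩
    rw [hp, T.boost_rot, (hm s).1 hs, map_neg, neg_neg]
  omega

/-- The pairings of `x e₀ + y e₁` with the null vectors `e₁ - e₀` and `e₀ + e₁` are `x + y` and `y -
x`, not both zero. On the eigenspace of a non-zero pairing, isotropy forces `η(e₀, κ_s) = 0`, hence
`s = 0`, so `W` is disjoint from it. -/
theorem finrank_le_of_isotropic [FiniteDimensional ℝ S] (T : 𝔰.IsTriple e₀ e₁ e₂) (hc : 𝔰.IsCausal)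
    (hn : 𝔰.IsNondegenerate) {x y : ℝ} (hv : x • e₀ + y • e₁ ≠ 0) (W : Submodule ℝ S)
    (hW : ∀ s ∈ W, 𝔰.η (x • e₀ + y • e₁) (𝔰.κ s s) = 0) :
    2 * Module.finrank ℝ W ≤ Module.finrank ℝ S := by
  obtain ⟨hp, hm⟩ := T.finrank_eigenspaces
  by_cases hxy : x + y = 0
  · have hne : x - y ≠ 0 := by
      intro h
      apply hv
      rw [show x = 0 by linarith, show y = 0 by linarith]
      simp
    have hd : Disjoint W (LinearMap.ker (𝔰.cl e₀ e₁ + 1)) := by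
      rw [Submodule.disjoint_def]
      intro s hs hs'
      have hs'' : 𝔰.cl e₀ e₁ s = -s := by simpa [eq_neg_iff_add_eq_zero] using hs'
      refine T.eq_zero_of_minus hc hn hs'' ?_
      have h1 := hW s hs
      have h2 := congrArg (𝔰.η e₁) (T.κ_minus_minus hs'' hs'')
      simp only [map_add, map_smul, LinearMap.add_apply, LinearMap.smul_apply, smul_eq_mul,
        T.h10, T.h11] at h1 h2
      rw [h2] at h1
      have h3 : (x - y) * 𝔰.η e₀ (𝔰.κ s s) = 0 := by linarith
      exact (mul_eq_zero.1 h3).resolve_left hne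
    have := Submodule.finrank_add_finrank_le_of_disjoint hd
    omega
  · have hd : Disjoint W (LinearMap.ker (𝔰.cl e₀ e₁ - 1)) := by
      rw [Submodule.disjoint_def]
      intro s hs hs'
      have hs'' : 𝔰.cl e₀ e₁ s = s := by simpa [sub_eq_zero] using hs'
      refine T.eq_zero_of_plus hc hn hs'' ?_
      have h1 := hW s hs
      have h2 := congrArg (𝔰.η e₁) (T.κ_plus_plus hs'' hs'')
      simp only [map_add, map_sub, map_smul, LinearMap.add_apply, LinearMap.smul_apply,
        smul_eq_mul, T.h10, T.h11] at h1 h2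
      rw [h2] at h1
      have h3 : (x + y) * 𝔰.η e₀ (𝔰.κ s s) = 0 := by linarith
      exact (mul_eq_zero.1 h3).resolve_left hxy
    have := Submodule.finrank_add_finrank_le_of_disjoint hd
    omega

end IsTriple

/-- A subspace of more than half the dimension of the spinor module generates `V` by squaring. -/
theorem span_κ_eq_top [FiniteDimensional ℝ S] (hdim : 2 < Module.finrank ℝ V)
    (hLor : IsLorentzian 𝔰.η) (hc : 𝔰.IsCausal) (hn : 𝔰.IsNondegenerate) (W : Submodule ℝ S)
    (hW : Module.finrank ℝ S < 2 * Module.finrank ℝ W) :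
    Submodule.span ℝ {v : V | ∃ s ∈ W, v = 𝔰.κ s s} = ⊤ := by
  by_contra hne
  obtain ⟨f, hf, hle⟩ := Submodule.exists_le_ker_of_lt_top _ (lt_top_iff_ne_top.2 hne)
  set v := (𝔰.η.toDual 𝔰.η_nondeg).symm f with hv
  have hfv : ∀ x, 𝔰.η v x = f x := fun x => LinearMap.BilinForm.apply_toDual_symm_apply _ _
  have hv0 : v ≠ 0 := by
    intro h
    exact hf (LinearMap.ext fun x => by rw [← hfv, h]; simp)
  obtain ⟨e, he, hpos⟩ := hLor.exists_timelike
  obtain ⟨e₁, e₂, h11, h22, h01, h02, h12, x, y, hxy⟩ :=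
    exists_orthonormal_triple hdim he hpos v
  have T : 𝔰.IsTriple e e₁ e₂ := ⟨he, h11, h22, h01, h02, h12, hpos⟩
  rw [hxy] at hv0
  have := T.finrank_le_of_isotropic hc hn hv0 W fun s hs => by
    rw [← hxy, hfv]
    exact hle (Submodule.subset_span ⟨s, hs, rfl⟩)
  omega

end FlatModel

end KillingAlg

namespace KillingAlg

/-! ### Instance shortcuts -/

section Shortcuts

variable {V S : Type*} [AddCommGroup V] [Module ℝ V] (η : LinearMap.BilinForm ℝ V)

scoped instance soLieRing : LieRing (so η) := inferInstance

scoped instance soAddCommGroup : AddCommGroup (so η) := LieRing.toAddCommGroup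

scoped instance soAddCommMonoid : AddCommMonoid (so η) := AddCommGroup.toAddCommMonoid

scoped instance soZero : Zero (so η) := inferInstance

scoped instance soAdd : Add (so η) := inferInstance

scoped instance soAddZeroClass : AddZeroClass (so η) := inferInstance

scoped instance soSubNegMonoid : SubNegMonoid (so η) := inferInstance

scoped instance soModule : Module ℝ (so η) := inferInstance

scoped instance soLieAlgebra : LieAlgebra ℝ (so η) := inferInstance

variable [FiniteDimensional ℝ V] [AddCommGroup S] [Module ℝ S] {𝔰 : FlatModel V S}
  (𝔞 : GradedSubalgebra 𝔰)

scoped instance hAddCommGroup : AddCommGroup 𝔞.h := inferInstance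

scoped instance hAddCommMonoid : AddCommMonoid 𝔞.h := AddCommGroup.toAddCommMonoid

scoped instance hZero : Zero 𝔞.h := inferInstance

scoped instance hModule : Module ℝ 𝔞.h := inferInstance

scoped instance algAddCommGroup : AddCommGroup 𝔞.Alg := inferInstance

scoped instance algAddCommMonoid : AddCommMonoid 𝔞.Alg := AddCommGroup.toAddCommMonoid

scoped instance algZero : Zero 𝔞.Alg := inferInstance

scoped instance algAdd : Add 𝔞.Alg := inferInstance

scoped instance algNeg : Neg 𝔞.Alg := inferInstance

scoped instance algSubNegMonoid : SubNegMonoid 𝔞.Alg := inferInstance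

scoped instance algAddZeroClass : AddZeroClass 𝔞.Alg := inferInstance

scoped instance algModule : Module ℝ 𝔞.Alg := inferInstance

end Shortcuts

namespace FlatModel

variable {V S : Type*} [AddCommGroup V] [Module ℝ V] [FiniteDimensional ℝ V]
  [AddCommGroup S] [Module ℝ S] (𝔰 : FlatModel V S)

/-! ### Contorsion -/

theorem eq_of_forall_η {x y : V} (h : ∀ u, 𝔰.η x u = 𝔰.η y u) : x = y :=
  (𝔰.η.toDual 𝔰.η_nondeg).injective (LinearMap.ext h)

/-- The first prolongation of `𝔰𝔬(V)` vanishes. -/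
theorem eq_zero_of_torsion_eq_zero (f : V → so 𝔰.η)
    (h : ∀ v w, (f v : Module.End ℝ V) w = (f w : Module.End ℝ V) v) (v : V) : f v = 0 := by
  have hskew : ∀ a b c, 𝔰.η ((f a : Module.End ℝ V) b) c = -𝔰.η ((f a : Module.End ℝ V) c) b := by
    intro a b c
    rw [so_apply_left (f a).2]
    congr 1
    exact 𝔰.η_symm.eq _ _
  refine 𝔰.so_ext fun w => 𝔰.eq_of_forall_η fun u => ?_
  -- A trilinear expression symmetric in its first two slots and skew in its last two vanishes:
  -- three exchanges of each kind return to the start with a minus sign.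
  have h1 : 𝔰.η ((f v : Module.End ℝ V) w) u = -𝔰.η ((f v : Module.End ℝ V) w) u := by
    conv_lhs => rw [h v w, hskew w v u, h w u, hskew u w v, h u v, hskew v u w]
    rw [neg_neg]
  have h2 : 𝔰.η ((f v : Module.End ℝ V) w) u = 0 := by linarith
  simp [h2]

/-- Every torsion is the torsion of a linear map `V → 𝔰𝔬(V)`. -/
theorem exists_contorsion (α : V →ₗ[ℝ] V →ₗ[ℝ] V) (hα : ∀ v, α v v = 0) :
    ∃ l : V →ₗ[ℝ] so 𝔰.η,
      ∀ v w, (l v : Module.End ℝ V) w - (l w : Module.End ℝ V) v = α v w := by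
  have hskew : ∀ v w, α w v = -α v w := by
    intro v w
    have h := hα (v + w)
    simp only [map_add, LinearMap.add_apply, hα, zero_add, add_zero] at h
    exact eq_neg_of_add_eq_zero_left h
  -- The Koszul formula for a metric connection in terms of its torsion.
  obtain ⟨g₀, hg₀⟩ : ∃ g₀ : V → V → V, ∀ v w u, 𝔰.η (g₀ v w) u
      = (1 / 2 : ℝ) * (𝔰.η (α v w) u - 𝔰.η (α w u) v + 𝔰.η (α u v) w) := by
    refine ⟨fun v w => (𝔰.η.toDual 𝔰.η_nondeg).symm
      ((1 / 2 : ℝ) • (𝔰.η (α v w) - (𝔰.η.flip v).comp (α w) + (𝔰.η.flip w).comp (α.flip v))),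
      fun v w u => ?_⟩
    rw [LinearMap.BilinForm.apply_toDual_symm_apply]
    rfl
  let g : V →ₗ[ℝ] V →ₗ[ℝ] V := LinearMap.mk₂ ℝ g₀
    (fun v v' w => 𝔰.eq_of_forall_η fun u => by
      simp only [map_add, LinearMap.add_apply, hg₀]; ring)
    (fun c v w => 𝔰.eq_of_forall_η fun u => by
      simp only [map_smul, LinearMap.smul_apply, hg₀, smul_eq_mul]; ring)
    (fun v w w' => 𝔰.eq_of_forall_η fun u => by
      simp only [map_add, LinearMap.add_apply, hg₀]; ring)
    (fun c v w => 𝔰.eq_of_forall_η fun u => by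
      simp only [map_smul, LinearMap.smul_apply, hg₀, smul_eq_mul]; ring)
  have hg : ∀ v w u, 𝔰.η (g v w) u
      = (1 / 2 : ℝ) * (𝔰.η (α v w) u - 𝔰.η (α w u) v + 𝔰.η (α u v) w) := hg₀
  have hso : ∀ v, g v ∈ so 𝔰.η := by
    intro v
    rw [mem_so_iff]
    intro w u
    have h1 : 𝔰.η w (g v u) = 𝔰.η (g v u) w := 𝔰.η_symm.eq _ _
    rw [h1, hg, hg, hskew u v, hskew w u, hskew v w]
    simp only [map_neg, LinearMap.neg_apply]
    ring
  refine ⟨{ toFun := fun v => ⟨g v, hso v⟩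
            map_add' := fun v w => Subtype.ext (map_add g v w)
            map_smul' := fun c v => Subtype.ext (map_smul g c v) }, fun v w => ?_⟩
  change g v w - g w v = α v w
  refine 𝔰.eq_of_forall_η fun u => ?_
  rw [map_sub, LinearMap.sub_apply, hg, hg, hskew v w, hskew u v, hskew w u]
  simp only [map_neg, LinearMap.neg_apply]
  ring

end FlatModel

namespace GradedSubalgebra

variable {V S : Type*} [AddCommGroup V] [Module ℝ V] [FiniteDimensional ℝ V]
  [AddCommGroup S] [Module ℝ S] {𝔰 : FlatModel V S} (𝔞 : GradedSubalgebra 𝔰)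

/-! ### The action of `𝔥` -/

theorem coe_act (A : 𝔞.h) (s : 𝔞.S') : (𝔞.act A s : S) = 𝔰.act (A : so 𝔰.η) s := rfl

@[simp] theorem act_zero_left (s : 𝔞.S') : 𝔞.act 0 s = 0 := Subtype.ext (by simp [coe_act])

@[simp] theorem act_zero_right (A : 𝔞.h) : 𝔞.act A 0 = 0 := Subtype.ext (by simp [coe_act])

@[simp] theorem actV_zero_left (v : V) : 𝔞.actV 0 v = 0 := by simp [actV]

@[simp] theorem actV_zero_right (A : 𝔞.h) : 𝔞.actV A 0 = 0 := by simp [actV]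

/-! ### Homogeneous elements -/

theorem sgn_zero_left (j : ZMod 2) : sgn 0 j = 1 := by simp [sgn]

theorem sgn_zero_right (i : ZMod 2) : sgn i 0 = 1 := by simp [sgn]

theorem sgn_one_one : sgn 1 1 = -1 := by simp [sgn]

theorem intCast_zmod_two (k : ℤ) : (k : ZMod 2) = 0 ∨ (k : ZMod 2) = 1 := by
  generalize (k : ZMod 2) = i
  revert i
  decide

theorem negPiece_cases {k : ℤ} {X : 𝔞.Neg} (hX : X ∈ 𝔞.negPiece k) :
    ((k : ZMod 2) = 0 ∧ X = (X.1, 0)) ∨ ((k : ZMod 2) = 1 ∧ X = (0, X.2)) := by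
  unfold negPiece at hX
  split_ifs at hX with h1 h2
  · subst h1
    have h : X.2 = 0 := by simpa [Submodule.mem_prod] using hX
    exact Or.inl ⟨by decide, Prod.ext rfl h⟩
  · subst h2
    have h : X.1 = 0 := by simpa [Submodule.mem_prod] using hX
    exact Or.inr ⟨by decide, Prod.ext h rfl⟩
  · have h : X = 0 := by simpa using hX
    subst h
    rcases intCast_zmod_two k with h | h
    · exact Or.inl ⟨h, rfl⟩
    · exact Or.inr ⟨h, rfl⟩

/-- Koszul signs see only parity, so degrees `-2` and `0` are merged into one even case; zero fits
either parity. -/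
theorem piece_cases {k : ℤ} {X : 𝔞.Alg} (hX : X ∈ 𝔞.piece k) :
    ((k : ZMod 2) = 0 ∧ X = (X.1, 0, X.2.2)) ∨ ((k : ZMod 2) = 1 ∧ X = (0, X.2.1, 0)) := by
  unfold piece at hX
  split_ifs at hX with h1 h2 h3
  · subst h1
    have h : X.2.1 = 0 := by
      have h' : X.2 = 0 := by simpa [Submodule.mem_prod] using hX
      rw [h']; rfl
    exact Or.inl ⟨by decide, Prod.ext rfl (Prod.ext h rfl)⟩
  · subst h2
    have h : X.1 = 0 ∧ X.2.2 = 0 := by simpa [Submodule.mem_prod] using hX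
    exact Or.inr ⟨by decide, Prod.ext h.1 (Prod.ext rfl h.2)⟩
  · subst h3
    have h : X.1 = 0 ∧ X.2.1 = 0 := by simpa [Submodule.mem_prod] using hX
    exact Or.inl ⟨by decide, Prod.ext rfl (Prod.ext h.2 rfl)⟩
  · have h : X = 0 := by simpa using hX
    subst h
    rcases intCast_zmod_two k with h | h
    · exact Or.inl ⟨h, rfl⟩
    · exact Or.inr ⟨h, rfl⟩

theorem mem_negPiece_v (v : V) : ((v, 0) : 𝔞.Neg) ∈ 𝔞.negPiece (-2) := by
  simp [negPiece, Submodule.mem_prod]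

theorem mem_negPiece_s (s : 𝔞.S') : ((0, s) : 𝔞.Neg) ∈ 𝔞.negPiece (-1) := by
  simp [negPiece, Submodule.mem_prod]

theorem mem_piece_v (v : V) : ((v, 0, 0) : 𝔞.Alg) ∈ 𝔞.piece (-2) := by
  simp [piece, Submodule.mem_prod]

theorem mem_piece_s (s : 𝔞.S') : ((0, s, 0) : 𝔞.Alg) ∈ 𝔞.piece (-1) := by
  simp [piece, Submodule.mem_prod]

theorem mem_piece_h (A : 𝔞.h) : ((0, 0, A) : 𝔞.Alg) ∈ 𝔞.piece 0 := by
  simp [piece, Submodule.mem_prod]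

/-! ### Normalised cocycles as pairs of maps -/

/-- The component `β` of a cochain as a bilinear map. -/
def betaL (φ : 𝔞.BilinNeg) : V →ₗ[ℝ] 𝔞.S' →ₗ[ℝ] S :=
  (φ.compl₁₂ (LinearMap.inl ℝ V 𝔞.S') (LinearMap.inr ℝ V 𝔞.S')).compr₂
    ((LinearMap.fst ℝ S (so 𝔰.η)).comp (LinearMap.snd ℝ V (S × so 𝔰.η)))

/-- The component `γ` of a cochain as a bilinear map. -/
def gammaL (φ : 𝔞.BilinNeg) : 𝔞.S' →ₗ[ℝ] 𝔞.S' →ₗ[ℝ] so 𝔰.η :=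
  (φ.compl₁₂ (LinearMap.inr ℝ V 𝔞.S') (LinearMap.inr ℝ V 𝔞.S')).compr₂
    ((LinearMap.snd ℝ S (so 𝔰.η)).comp (LinearMap.snd ℝ V (S × so 𝔰.η)))

/-- The cochain `β + γ`. -/
noncomputable def ofPair (β : V →ₗ[ℝ] 𝔞.S' →ₗ[ℝ] S) (γ : 𝔞.S' →ₗ[ℝ] 𝔞.S' →ₗ[ℝ] so 𝔰.η) :
    𝔞.BilinNeg :=
  LinearMap.mk₂ ℝ (fun X Y => (0, β X.1 Y.2 - β Y.1 X.2, γ X.2 Y.2))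
    (fun X X' Y => by
      ext1
      · simp
      · ext1
        · simp only [Prod.fst_add, Prod.snd_add, map_add, LinearMap.add_apply]; abel
        · simp)
    (fun c X Y => by
      ext1
      · simp
      · ext1
        · simp [smul_sub]
        · simp)
    (fun X Y Y' => by
      ext1
      · simp
      · ext1
        · simp only [Prod.fst_add, Prod.snd_add, map_add, LinearMap.add_apply]; abel
        · simp)
    (fun c X Y => by
      ext1
      · simp
      · ext1
        · simp [smul_sub]
        · simp)

theorem ofPair_apply (β : V →ₗ[ℝ] 𝔞.S' →ₗ[ℝ] S) (γ : 𝔞.S' →ₗ[ℝ] 𝔞.S' →ₗ[ℝ] so 𝔰.η)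
    (X Y : 𝔞.Neg) : 𝔞.ofPair β γ X Y = (0, β X.1 Y.2 - β Y.1 X.2, γ X.2 Y.2) := rfl

/-- The polarised cocycle and invariance conditions on `β` and `γ`. -/
structure IsCocyclePair (β : V →ₗ[ℝ] 𝔞.S' →ₗ[ℝ] S)
    (γ : 𝔞.S' →ₗ[ℝ] 𝔞.S' →ₗ[ℝ] so 𝔰.η) : Prop where
  symm : ∀ s t, γ s t = γ t s
  vss : ∀ v (s t : 𝔞.S'), (γ s t : Module.End ℝ V) v + 𝔰.κ s (β v t) + 𝔰.κ t (β v s) = 0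
  sss : ∀ s t u : 𝔞.S', β (𝔰.κ s t) u + β (𝔰.κ t u) s + β (𝔰.κ u s) t
    + 𝔰.act (γ s t) u + 𝔰.act (γ t u) s + 𝔰.act (γ u s) t = 0
  inv_beta : ∀ (A : 𝔞.h) v s, 𝔰.act (A : so 𝔰.η) (β v s) = β (𝔞.actV A v) s + β v (𝔞.act A s)
  inv_gamma : ∀ (A : 𝔞.h) s t, ⁅(A : so 𝔰.η), γ s t⁆ = γ (𝔞.act A s) t + γ s (𝔞.act A t)

/-- In degree 2 the only possible components are `β`, `γ` and one `Λ²V → V`, which the normalisation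
removes. -/
theorem eq_ofPair {φ : 𝔞.BilinNeg} (h : 𝔞.IsNormalisedCocycle φ) :
    φ = 𝔞.ofPair (𝔞.betaL φ) (𝔞.gammaL φ) := by
  obtain ⟨hco, -, hn⟩ := h
  have hvs : ∀ v s, φ (v, 0) (0, s) = (0, 𝔞.betaL φ v s, 0) := by
    intro v s
    have h1 := (hco (-2) (-1) _ (𝔞.mem_negPiece_v v) _ (𝔞.mem_negPiece_s s)).1
    norm_num [FlatModel.piece, Submodule.mem_prod] at h1
    exact Prod.ext h1.1 (Prod.ext rfl h1.2)
  have hss : ∀ s t, φ (0, s) (0, t) = (0, 0, 𝔞.gammaL φ s t) := by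
    intro s t
    have h1 := (hco (-1) (-1) _ (𝔞.mem_negPiece_s s) _ (𝔞.mem_negPiece_s t)).1
    norm_num [FlatModel.piece, Submodule.mem_prod] at h1
    exact Prod.ext h1.1 (Prod.ext h1.2 rfl)
  have hsv : ∀ v s, φ (0, s) (v, 0) = -(0, 𝔞.betaL φ v s, 0) := by
    intro v s
    rw [(hco (-1) (-2) _ (𝔞.mem_negPiece_s s) _ (𝔞.mem_negPiece_v v)).2, hvs]
    have h2 : (((-2 : ℤ) : ℤ) : ZMod 2) = 0 := by decide
    rw [h2, sgn_zero_right, one_smul]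
  refine LinearMap.ext fun X => LinearMap.ext fun Y => ?_
  obtain ⟨x, s⟩ := X
  obtain ⟨y, t⟩ := Y
  have hX : ((x, s) : 𝔞.Neg) = (x, 0) + (0, s) := by simp
  have hY : ((y, t) : 𝔞.Neg) = (y, 0) + (0, t) := by simp
  rw [ofPair_apply]
  conv_lhs => rw [hX, hY]
  simp only [map_add, LinearMap.add_apply, hn, hvs, hss, hsv]
  ext1
  · simp
  · ext1
    · simp [sub_eq_add_neg, add_comm]
    · simp

theorem isCocyclePair_of_mem {φ : 𝔞.BilinNeg} (h : φ ∈ 𝔞.invNormalisedCocycles) :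
    𝔞.IsCocyclePair (𝔞.betaL φ) (𝔞.gammaL φ) := by
  obtain ⟨hn, hinv⟩ := h
  have hφ := 𝔞.eq_ofPair hn
  obtain ⟨hco, hcl, -⟩ := hn
  have e1 : ((-1 : ℤ) : ZMod 2) = 1 := by decide
  have e2 : ((-2 : ℤ) : ZMod 2) = 0 := by decide
  have e3 : (1 + 1 : ZMod 2) = 0 := by decide
  have hsymm : ∀ s t, 𝔞.gammaL φ s t = 𝔞.gammaL φ t s := by
    intro s t
    have h1 := (hco (-1) (-1) _ (𝔞.mem_negPiece_s s) _ (𝔞.mem_negPiece_s t)).2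
    rw [e1, sgn_one_one, neg_one_smul, neg_neg] at h1
    exact congrArg (fun X => X.2.2) h1
  generalize 𝔞.betaL φ = β at *
  generalize 𝔞.gammaL φ = γ at *
  subst hφ
  refine ⟨hsymm, fun v s t => ?_, fun s t u => ?_, fun A v s => ?_, fun A s t => ?_⟩
  · have h1 := congrArg Prod.fst (hcl (-2) (-1) (-1) _ (𝔞.mem_negPiece_v v) _ (𝔞.mem_negPiece_s s)
      _ (𝔞.mem_negPiece_s t))
    simp [e1, e2, sgn_zero_left, sgn_one_one, ofPair_apply, FlatModel.bracket, negIncl,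
      negBracket] at h1
    rw [← neg_eq_zero, ← h1]
    abel
  · have h1 := congrArg (fun X => X.2.1) (hcl (-1) (-1) (-1) _ (𝔞.mem_negPiece_s s) _
      (𝔞.mem_negPiece_s t) _ (𝔞.mem_negPiece_s u))
    simp [e1, e3, sgn_zero_left, sgn_zero_right, ofPair_apply, FlatModel.bracket, negIncl,
      negBracket] at h1
    rw [← neg_eq_zero, ← h1]
    abel
  · have h1 := congrArg (fun X => X.2.1) (hinv A (v, 0) (0, s))
    simpa [ofPair_apply, FlatModel.bracket] using h1
  · have h1 := congrArg (fun X => X.2.2) (hinv A (0, s) (0, t))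
    simpa [ofPair_apply, FlatModel.bracket] using h1

/-- Closedness is a condition only on triples with at least two spinors: on the others each term
vanishes. Three orderings of one vector and two spinors, and three spinors, remain. -/
theorem ofPair_mem {β : V →ₗ[ℝ] 𝔞.S' →ₗ[ℝ] S} {γ : 𝔞.S' →ₗ[ℝ] 𝔞.S' →ₗ[ℝ] so 𝔰.η}
    (h : 𝔞.IsCocyclePair β γ) : 𝔞.ofPair β γ ∈ 𝔞.invNormalisedCocycles := by
  have e3 : (1 + 1 : ZMod 2) = 0 := by decide
  refine ⟨⟨fun k l X hX Y hY => ⟨?_, ?_⟩, fun k l m X hX Y hY Z hZ => ?_, fun v w => ?_⟩,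
    fun A X Y => ?_⟩
  · unfold negPiece at hX hY
    split_ifs at hX hY with h1 h2 h3 h4 h5 h6 h7 <;>
    simp [Submodule.mem_prod, Prod.ext_iff] at hX hY <;>
    simp [*, ofPair_apply, FlatModel.piece, Submodule.mem_prod]
    all_goals exact Submodule.zero_mem _
  · rcases 𝔞.negPiece_cases hX with ⟨hk, hX⟩ | ⟨hk, hX⟩ <;>
    rcases 𝔞.negPiece_cases hY with ⟨hl, hY⟩ | ⟨hl, hY⟩ <;>
    rw [hX, hY, hk, hl] <;>
    simp [ofPair_apply, sgn_zero_left, sgn_zero_right, sgn_one_one]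
    exact h.symm _ _
  · rcases 𝔞.negPiece_cases hX with ⟨hk, hX⟩ | ⟨hk, hX⟩ <;>
    rcases 𝔞.negPiece_cases hY with ⟨hl, hY⟩ | ⟨hl, hY⟩ <;>
    rcases 𝔞.negPiece_cases hZ with ⟨hm, hZ⟩ | ⟨hm, hZ⟩ <;>
    rw [hX, hY, hZ, hk, hl, hm] <;>
    simp [ofPair_apply, sgn_zero_left, sgn_zero_right, sgn_one_one, FlatModel.bracket, negIncl,
      negBracket, e3]
    · rw [← neg_eq_zero, ← h.vss X.1 Y.2 Z.2]
      abel
    · rw [← h.vss Y.1 X.2 Z.2, h.symm Z.2 X.2]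
      abel
    · rw [← neg_eq_zero, ← h.vss Z.1 X.2 Y.2]
      abel
    · rw [← neg_eq_zero, ← h.sss X.2 Y.2 Z.2]
      abel
  · simp [ofPair_apply]
  · simp only [ofPair_apply, FlatModel.bracket]
    ext1
    · simp
    · ext1
      · simp [h.inv_beta]
        abel
      · simp [h.inv_gamma]

end GradedSubalgebra

end KillingAlg

namespace KillingAlg

namespace DeformingMaps

variable {V S : Type*} [AddCommGroup V] [Module ℝ V] [FiniteDimensional ℝ V]
  [AddCommGroup S] [Module ℝ S] {𝔰 : FlatModel V S} {𝔞 : GradedSubalgebra 𝔰}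
  (D : DeformingMaps 𝔞)

/-! ### The deformed bracket in coordinates twisted by `λ` -/

theorem isCocyclePair : 𝔞.IsCocyclePair (𝔞.betaL D.cocycle) (𝔞.gammaL D.cocycle) :=
  𝔞.isCocyclePair_of_mem D.cocycle_mem

/-- The `𝔰𝔬(V)`-coordinate after the substitution `v ↦ v + λ(v)`. -/
def twist (X : 𝔞.Alg) : so 𝔰.η := (X.2.2 : so 𝔰.η) + D.lam X.1

theorem twist_apply (x : V) (s : 𝔞.S') (A : 𝔞.h) :
    D.twist (x, s, A) = (A : so 𝔰.η) + D.lam x := rfl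

@[simp] theorem twist_odd (s : 𝔞.S') : D.twist (0, s, 0) = 0 := by
  simp [twist]

@[simp] theorem twist_add (X Y : 𝔞.Alg) : D.twist (X + Y) = D.twist X + D.twist Y := by
  simp only [twist, Prod.fst_add, Prod.snd_add, AddMemClass.coe_add, map_add]
  abel

@[simp] theorem twist_neg (X : 𝔞.Alg) : D.twist (-X) = -D.twist X := by
  simp only [twist, Prod.fst_neg, Prod.snd_neg, NegMemClass.coe_neg, map_neg]
  abel

/-- For fixed `x` the map `A ↦ A + λ(x)` is injective, so identities in `𝔞` may be checked inside `V
⊕ S ⊕ 𝔰𝔬(V)`. -/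
theorem ext_twist {X Y : 𝔞.Alg} :
    X = Y ↔ X.1 = Y.1 ∧ (X.2.1 : S) = Y.2.1 ∧ D.twist X = D.twist Y := by
  refine ⟨fun h => by rw [h]; exact ⟨rfl, rfl, rfl⟩, fun ⟨h1, h2, h3⟩ => ?_⟩
  refine Prod.ext h1 (Prod.ext (Subtype.ext h2) (Subtype.ext ?_))
  rw [twist, twist, h1] at h3
  exact add_right_cancel h3

theorem coe_hvH (A : 𝔞.h) (v : V) :
    (D.hvH A v : so 𝔰.η) = ⁅(A : so 𝔰.η), D.lam v⁆ - D.lam (𝔞.actV A v) := rfl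

theorem coe_ssH (s t : 𝔞.S') :
    (D.ssH s t : so 𝔰.η) = 𝔞.gammaL D.cocycle s t - D.lam (𝔰.κ s t) := rfl

theorem coe_vsS (v : V) (s : 𝔞.S') :
    (D.vsS v s : S) = 𝔞.betaL D.cocycle v s + 𝔰.act (D.lam v) s := rfl

theorem coe_vwH (v w : V) :
    (D.vwH v w : so 𝔰.η) = D.theta v w - D.lam (D.vwV v w) + ⁅D.lam v, D.lam w⁆ := rfl

/-- In twisted coordinates the explicit `λ`-terms disappear. This formula and the next two show the
flat bracket corrected by `β` in the spinor component and by `γ + θ` in the `𝔰𝔬(V)` component. -/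
theorem bracket_fst (X Y : 𝔞.Alg) : (D.bracket X Y).1 =
    (D.twist X : Module.End ℝ V) Y.1 - (D.twist Y : Module.End ℝ V) X.1 + 𝔰.κ X.2.1 Y.2.1 := by
  simp only [bracket, twist, GradedSubalgebra.actV, vwV, AddMemClass.coe_add,
    LinearMap.add_apply]
  abel

theorem coe_bracket_snd_fst (X Y : 𝔞.Alg) : ((D.bracket X Y).2.1 : S) =
    𝔰.act (D.twist X) Y.2.1 - 𝔰.act (D.twist Y) X.2.1
      + 𝔞.betaL D.cocycle X.1 Y.2.1 - 𝔞.betaL D.cocycle Y.1 X.2.1 := by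
  simp only [bracket, twist, Submodule.coe_add, Submodule.coe_sub, coe_vsS,
    GradedSubalgebra.coe_act, FlatModel.act_add, LinearMap.add_apply]
  abel

theorem twist_bracket (X Y : 𝔞.Alg) : D.twist (D.bracket X Y) =
    ⁅D.twist X, D.twist Y⁆ + 𝔞.gammaL D.cocycle X.2.1 Y.2.1 + D.theta X.1 Y.1 := by
  rw [twist, bracket_fst]
  simp only [bracket, twist, AddMemClass.coe_add, AddSubgroupClass.coe_sub,
    LieSubalgebra.coe_bracket, coe_hvH, coe_ssH, coe_vwH, vwV, GradedSubalgebra.actV, map_add,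
    map_sub, LinearMap.add_apply, lie_add, add_lie]
  rw [← lie_skew (D.lam X.1) (Y.2.2 : so 𝔰.η)]
  abel

theorem bracket_snd_fst_of_even_of_odd (x : V) (A : 𝔞.h) (s : 𝔞.S') :
    (D.bracket (x, 0, A) (0, s, 0)).2.1 = 𝔞.act A s + D.vsS x s := by
  apply Subtype.ext
  rw [coe_bracket_snd_fst]
  simp [twist_apply, coe_vsS, GradedSubalgebra.coe_act]
  abel

theorem theta_skew (v w : V) : D.theta w v = -D.theta v w := by
  have h := D.theta_alt (v + w)
  simp only [map_add, LinearMap.add_apply, D.theta_alt, zero_add, add_zero] at h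
  exact eq_neg_of_add_eq_zero_left h

theorem bracket_neg_left (X Y : 𝔞.Alg) : D.bracket (-X) Y = -D.bracket X Y := by
  rw [D.ext_twist]
  refine ⟨?_, ?_, ?_⟩
  · simp only [bracket_fst, twist_neg, Prod.fst_neg, Prod.snd_neg, NegMemClass.coe_neg,
      LinearMap.neg_apply, map_neg]
    simp
    abel
  · simp only [coe_bracket_snd_fst, twist_neg, Prod.fst_neg, Prod.snd_neg, Submodule.coe_neg,
      FlatModel.act_neg, LinearMap.neg_apply, map_neg]
    abel
  · simp only [twist_bracket, twist_neg, Prod.fst_neg, Prod.snd_neg, map_neg, neg_lie,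
      LinearMap.neg_apply]
    abel

theorem bracket_neg_right (X Y : 𝔞.Alg) : D.bracket X (-Y) = -D.bracket X Y := by
  rw [D.ext_twist]
  refine ⟨?_, ?_, ?_⟩
  · simp only [bracket_fst, twist_neg, Prod.fst_neg, Prod.snd_neg, NegMemClass.coe_neg,
      LinearMap.neg_apply, map_neg]
    abel
  · simp only [coe_bracket_snd_fst, twist_neg, Prod.fst_neg, Prod.snd_neg, Submodule.coe_neg,
      FlatModel.act_neg, LinearMap.neg_apply, map_neg]
    abel
  · simp only [twist_bracket, twist_neg, Prod.fst_neg, Prod.snd_neg, map_neg, lie_neg]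
    abel

theorem bracket_skew_of_even (X Y : 𝔞.Alg) (hX : X.2.1 = 0) :
    D.bracket X Y = -D.bracket Y X := by
  rw [D.ext_twist]
  refine ⟨?_, ?_, ?_⟩
  · simp [bracket_fst, hX]
  · simp [coe_bracket_snd_fst, hX]
    abel
  · rw [twist_neg, twist_bracket, twist_bracket, D.theta_skew Y.1, ← lie_skew (D.twist X)]
    simp [hX]
    abel

theorem bracket_comm_of_odd (s t : 𝔞.S') :
    D.bracket (0, s, 0) (0, t, 0) = D.bracket (0, t, 0) (0, s, 0) := by
  rw [D.ext_twist]
  refine ⟨?_, ?_, ?_⟩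
  · simp [bracket_fst, 𝔰.κ_symm t s]
  · simp [coe_bracket_snd_fst]
  · simp [twist_bracket, D.isCocyclePair.symm t s]

theorem bracket_even_even_snd_fst (X Y : 𝔞.Alg) (hX : X.2.1 = 0) (hY : Y.2.1 = 0) :
    (D.bracket X Y).2.1 = 0 := by
  apply Subtype.ext
  simp [coe_bracket_snd_fst, hX, hY]

theorem bracket_even_odd (x : V) (A : 𝔞.h) (s : 𝔞.S') :
    D.bracket (x, 0, A) (0, s, 0) = (0, 𝔞.act A s + D.vsS x s, 0) := by
  rw [D.ext_twist]
  refine ⟨?_, ?_, ?_⟩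
  · simp [bracket_fst]
  · rw [bracket_snd_fst_of_even_of_odd]
  · simp [twist_bracket]

theorem bracket_odd_odd_snd_fst (s t : 𝔞.S') :
    (D.bracket (0, s, 0) (0, t, 0)).2.1 = 0 := by
  apply Subtype.ext
  simp [coe_bracket_snd_fst]

/-! ### The Jacobi identities -/

/-- The `𝔥`-part of the twisted coordinate preserves `θ`; only its `λ`-part contributes a defect. -/
theorem twist_lie_theta (X : 𝔞.Alg) (v w : V) :
    ⁅D.twist X, D.theta v w⁆ = D.lamTheta X.1 v w
      + D.theta ((D.twist X : Module.End ℝ V) v) w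
      + D.theta v ((D.twist X : Module.End ℝ V) w) := by
  have h := D.theta_inv X.2.2 v w
  simp only [GradedSubalgebra.actV] at h
  simp only [twist, lamTheta, add_lie, h, AddMemClass.coe_add, LinearMap.add_apply, map_add]
  abel

/-- The two conditions are the `V` and twisted components. The flat terms cancel by the Jacobi
identity in `𝔰𝔬(V)`, and `A`, `B`, `C` drop out by invariance of `θ`. -/
theorem jacobi_even_even_even (x y z : V) (A B C : 𝔞.h) :
    D.bracket (x, 0, A) (D.bracket (y, 0, B) (z, 0, C))
        = D.bracket (D.bracket (x, 0, A) (y, 0, B)) (z, 0, C)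
          + D.bracket (y, 0, B) (D.bracket (x, 0, A) (z, 0, C)) ↔
      (D.theta x y : Module.End ℝ V) z + (D.theta y z : Module.End ℝ V) x
        + (D.theta z x : Module.End ℝ V) y = 0 ∧
      D.lamTheta x y z + D.lamTheta y z x + D.lamTheta z x y = 0 := by
  rw [D.ext_twist]
  have hodd : ∀ X Y : 𝔞.Alg, X.2.1 = 0 → Y.2.1 = 0 → (D.bracket X Y).2.1 = 0 :=
    D.bracket_even_even_snd_fst
  have h2 : ((D.bracket (x, 0, A) (D.bracket (y, 0, B) (z, 0, C))).2.1 : S)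
      = (D.bracket (D.bracket (x, 0, A) (y, 0, B)) (z, 0, C)
          + D.bracket (y, 0, B) (D.bracket (x, 0, A) (z, 0, C))).2.1 := by
    rw [Prod.snd_add, Prod.fst_add, hodd, hodd, hodd, add_zero] <;> first | rfl | (apply hodd <;> rfl)
  rw [and_iff_right h2]
  refine and_congr ?_ ?_
  · rw [← sub_eq_zero, ← neg_eq_zero]
    refine Eq.congr_left ?_
    simp only [Prod.fst_add, bracket_fst, twist_bracket, hodd, map_sub, map_zero,
      AddMemClass.coe_add, LinearMap.add_apply, FlatModel.coe_lie_apply, Submodule.coe_zero,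
      add_zero, D.theta_skew z x, NegMemClass.coe_neg,
      LinearMap.neg_apply]
    abel
  · rw [← sub_eq_zero]
    refine Eq.congr_left ?_
    have hl : ∀ P Q R : so 𝔰.η, ⁅⁅P, Q⁆, R⁆ = ⁅P, ⁅Q, R⁆⁆ - ⁅Q, ⁅P, R⁆⁆ := lie_lie
    simp only [twist_add, twist_bracket, bracket_fst, map_sub, map_zero,
      LinearMap.zero_apply, add_zero, LinearMap.sub_apply, lie_add, add_lie, hl,
      Submodule.coe_zero]
    rw [← lie_skew (D.theta x y) (D.twist (z, 0, C))]
    rw [D.theta_skew z x, lie_neg]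
    simp only [twist_lie_theta]
    rw [D.theta_skew z ((D.twist (x, 0, A) : Module.End ℝ V) y),
      D.theta_skew z ((D.twist (y, 0, B) : Module.End ℝ V) x),
      D.theta_skew y ((D.twist (z, 0, C) : Module.End ℝ V) x),
      D.theta_skew x ((D.twist (y, 0, B) : Module.End ℝ V) z)]
    abel

/-- Only the spinor component is not zero by parity; invariance of `β` removes `A` and `B`. -/
theorem jacobi_even_even_odd (x y : V) (A B : 𝔞.h) (s : 𝔞.S') :
    D.bracket (x, 0, A) (D.bracket (y, 0, B) (0, s, 0))
        = D.bracket (D.bracket (x, 0, A) (y, 0, B)) (0, s, 0)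
          + D.bracket (y, 0, B) (D.bracket (x, 0, A) (0, s, 0)) ↔
      𝔰.act (D.theta x y) s =
        D.beta x (D.vsS y s) - 𝔰.act (D.lam y) (D.beta x s)
            + D.beta ((D.lam y : Module.End ℝ V) x) s
          - D.beta y (D.vsS x s) + 𝔰.act (D.lam x) (D.beta y s)
            - D.beta ((D.lam x : Module.End ℝ V) y) s := by
  rw [D.ext_twist, D.bracket_even_odd, D.bracket_even_odd, D.bracket_even_odd, D.bracket_even_odd]
  have h1 : (D.bracket (D.bracket (x, 0, A) (y, 0, B)) (0, s, 0)).1 = 0 := by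
    simp [bracket_fst, D.bracket_even_even_snd_fst]
  have h3 : D.twist (D.bracket (D.bracket (x, 0, A) (y, 0, B)) (0, s, 0)) = 0 := by
    simp [twist_bracket, D.bracket_even_even_snd_fst]
  simp only [Prod.fst_add, Prod.snd_add, twist_add, h1, h3, twist_odd, add_zero, true_and,
    and_true, Submodule.coe_add, coe_bracket_snd_fst, twist_bracket, bracket_fst, coe_vsS,
    GradedSubalgebra.coe_act]
  rw [eq_comm, ← sub_eq_zero, ← sub_eq_zero (a := 𝔰.act (D.theta x y) s)]
  refine Eq.congr_left ?_
  have hb : ∀ v t, D.beta v t = 𝔞.betaL D.cocycle v t := fun _ _ => rfl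
  have hA := D.isCocyclePair.inv_beta A y s
  have hB := D.isCocyclePair.inv_beta B x s
  simp only [GradedSubalgebra.actV] at hA hB
  simp only [hb, twist_apply, FlatModel.act_add, FlatModel.act_lie, map_add, map_sub, map_zero,
    LinearMap.add_apply, LinearMap.sub_apply, LinearMap.zero_apply, Submodule.coe_zero, hA, hB,
    FlatModel.act_zero, AddMemClass.coe_add]
  abel

/-- The `V` component is the first cocycle condition. The twisted component is the polarised
`ThetaKappa`, free of `A` by invariance of `γ`. -/
theorem jacobi_even_odd_odd (x : V) (A : 𝔞.h) (s t : 𝔞.S') :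
    D.bracket (x, 0, A) (D.bracket (0, s, 0) (0, t, 0))
        = D.bracket (D.bracket (x, 0, A) (0, s, 0)) (0, t, 0)
          + D.bracket (0, s, 0) (D.bracket (x, 0, A) (0, t, 0)) ↔
      D.theta (𝔰.κ s t) x + D.gamma s (D.vsS x t) + D.gamma t (D.vsS x s)
        - ⁅D.lam x, D.gamma s t⁆ = 0 := by
  have hg : ∀ v t, D.gamma v t = 𝔞.gammaL D.cocycle v t := fun _ _ => rfl
  have h := D.isCocyclePair
  rw [D.ext_twist, D.bracket_even_odd, D.bracket_even_odd]
  have h1 : (D.bracket (x, 0, A) (D.bracket (0, s, 0) (0, t, 0))).1 =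
      (D.bracket (0, 𝔞.act A s + D.vsS x s, 0) (0, t, 0)
        + D.bracket (0, s, 0) (0, 𝔞.act A t + D.vsS x t, 0)).1 := by
    rw [← sub_eq_zero, ← neg_eq_zero]
    refine Eq.trans ?_ (h.vss x s t)
    have ht := 𝔰.κ_symm t (𝔞.betaL D.cocycle x s)
    simp [bracket_fst, twist_bracket, D.bracket_odd_odd_snd_fst, FlatModel.apply_κ, twist_apply,
      coe_vsS, GradedSubalgebra.coe_act, ht]
    abel
  have h2 : ((D.bracket (x, 0, A) (D.bracket (0, s, 0) (0, t, 0))).2.1 : S) =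
      (D.bracket (0, 𝔞.act A s + D.vsS x s, 0) (0, t, 0)
        + D.bracket (0, s, 0) (0, 𝔞.act A t + D.vsS x t, 0)).2.1 := by
    simp [coe_bracket_snd_fst, D.bracket_odd_odd_snd_fst]
  rw [and_iff_right h1, and_iff_right h2, ← sub_eq_zero, ← neg_eq_zero]
  refine Eq.congr_left ?_
  simp only [hg, twist_add, twist_bracket, bracket_fst, twist_apply,
    D.bracket_odd_odd_snd_fst]
  rw [D.theta_skew _ x, h.symm t]
  simp [h.inv_gamma]
  abel

/-- Exactly the second cocycle condition, hence no new equation. -/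
theorem jacobi_odd_odd_odd (s t u : 𝔞.S') :
    D.bracket (0, s, 0) (D.bracket (0, t, 0) (0, u, 0))
        = D.bracket (D.bracket (0, s, 0) (0, t, 0)) (0, u, 0)
          - D.bracket (0, t, 0) (D.bracket (0, s, 0) (0, u, 0)) := by
  rw [sub_eq_add_neg, D.ext_twist]
  refine ⟨?_, ?_, ?_⟩
  · simp [bracket_fst, D.bracket_odd_odd_snd_fst]
  · rw [← sub_eq_zero, ← neg_eq_zero, ← D.isCocyclePair.sss s t u]
    rw [D.isCocyclePair.symm u s, 𝔰.κ_symm u s]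
    simp [coe_bracket_snd_fst, D.bracket_odd_odd_snd_fst, twist_bracket, bracket_fst]
    abel
  · simp [twist_bracket, D.bracket_odd_odd_snd_fst]

theorem thetaKappa_iff : D.ThetaKappa ↔ ∀ (v : V) (s t : 𝔞.S'),
    D.theta (𝔰.κ s t) v + D.gamma s (D.vsS v t) + D.gamma t (D.vsS v s)
        - ⁅D.lam v, D.gamma s t⁆ = 0 := by
  have hg : ∀ v t, D.gamma v t = 𝔞.gammaL D.cocycle v t := fun _ _ => rfl
  constructor
  · intro h v s t
    have hadd : D.vsS v (s + t) = D.vsS v s + D.vsS v t := by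
      apply Subtype.ext
      simp only [coe_vsS, Submodule.coe_add, map_add]
      abel
    have h1 := h v (s + t)
    have h2 := h v s
    have h3 := h v t
    simp only [hg, hadd, Submodule.coe_add, map_add, LinearMap.add_apply, lie_add,
      𝔰.κ_symm t s, D.isCocyclePair.symm t s] at h1 h2 h3 ⊢
    have h4 : (2 : ℝ) • (D.theta (𝔰.κ s t) v + 𝔞.gammaL D.cocycle s (D.vsS v t)
        + 𝔞.gammaL D.cocycle t (D.vsS v s) - ⁅D.lam v, 𝔞.gammaL D.cocycle s t⁆) = 0 := by
      rw [← sub_zero (0 : so 𝔰.η)]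
      nth_rw 1 [← h1]
      rw [← add_zero (0 : so 𝔰.η)]
      nth_rw 1 [← h2]
      rw [← h3]
      module
    exact (smul_eq_zero.1 h4).resolve_left two_ne_zero
  · intro h v s
    rw [← h v s s]
    module

theorem bracket_even_right (Y : 𝔞.Alg) {X : 𝔞.Alg} (hX : X.2.1 = 0) :
    D.bracket Y X = -D.bracket X Y := by
  rw [D.bracket_skew_of_even X Y hX, neg_neg]

/-- Here and in the next three lemmas super-skew-symmetry carries the Jacobi identity to other
orderings, so each parity type needs checking in one order only. -/
theorem jacobi_rotate_even_odd_even {X Y Z : 𝔞.Alg} (hX : X.2.1 = 0) (hY : Y.2.1 = 0)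
    (h : D.bracket X (D.bracket Y Z) = D.bracket (D.bracket X Y) Z + D.bracket Y (D.bracket X Z)) :
    D.bracket X (D.bracket Z Y) = D.bracket (D.bracket X Z) Y + D.bracket Z (D.bracket X Y) := by
  rw [D.bracket_even_right Z hY, bracket_neg_right, h,
    D.bracket_even_right (D.bracket X Z) hY,
    D.bracket_even_right Z (D.bracket_even_even_snd_fst X Y hX hY)]
  abel

theorem jacobi_rotate_odd_even_even {X Y Z : 𝔞.Alg} (hX : X.2.1 = 0) (hY : Y.2.1 = 0)
    (h : D.bracket X (D.bracket Y Z) = D.bracket (D.bracket X Y) Z + D.bracket Y (D.bracket X Z)) :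
    D.bracket Z (D.bracket X Y) = D.bracket (D.bracket Z X) Y + D.bracket X (D.bracket Z Y) := by
  rw [D.bracket_even_right Z hX, D.bracket_even_right Z hY, bracket_neg_right, h,
    bracket_neg_left, D.bracket_even_right (D.bracket X Z) hY,
    D.bracket_even_right Z (D.bracket_even_even_snd_fst X Y hX hY)]
  abel

theorem jacobi_rotate_odd_even_odd {X Y Z : 𝔞.Alg} (hX : X.2.1 = 0)
    (h : D.bracket X (D.bracket Y Z) = D.bracket (D.bracket X Y) Z + D.bracket Y (D.bracket X Z)) :
    D.bracket Y (D.bracket X Z) = D.bracket (D.bracket Y X) Z + D.bracket X (D.bracket Y Z) := by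
  rw [D.bracket_even_right Y hX, bracket_neg_left, h]
  abel

theorem jacobi_rotate_odd_odd_even (x : V) (A : 𝔞.h) (s t : 𝔞.S')
    (h : D.bracket (x, 0, A) (D.bracket (0, s, 0) (0, t, 0))
        = D.bracket (D.bracket (x, 0, A) (0, s, 0)) (0, t, 0)
          + D.bracket (0, s, 0) (D.bracket (x, 0, A) (0, t, 0))) :
    D.bracket (0, s, 0) (D.bracket (0, t, 0) (x, 0, A))
      = D.bracket (D.bracket (0, s, 0) (0, t, 0)) (x, 0, A)
        - D.bracket (0, t, 0) (D.bracket (0, s, 0) (x, 0, A)) := by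
  have hs : D.bracket (0, t, 0) (D.bracket (x, 0, A) (0, s, 0))
      = D.bracket (D.bracket (x, 0, A) (0, s, 0)) (0, t, 0) := by
    rw [D.bracket_even_odd x A s, D.bracket_comm_of_odd]
  have ht : D.bracket (D.bracket (0, s, 0) (0, t, 0)) (x, 0, A) =
      -D.bracket (x, 0, A) (D.bracket (0, s, 0) (0, t, 0)) := D.bracket_even_right _ rfl
  have hu : ∀ u, D.bracket (0, u, 0) (x, 0, A) = -D.bracket (x, 0, A) (0, u, 0) :=
    fun u => D.bracket_even_right _ rfl
  rw [ht, hu s, hu t, bracket_neg_right, bracket_neg_right, hs, h]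
  abel

/-- The Jacobi identities for the deformed bracket reduce to four equations. -/
theorem jacobi_iff : D.Jacobi ↔ D.ThetaKappa ∧ D.ThetaSpinor ∧ D.Bianchi ∧ D.LamBianchi := by
  have e1 : ((-1 : ℤ) : ZMod 2) = 1 := by decide
  have e2 : ((-2 : ℤ) : ZMod 2) = 0 := by decide
  constructor
  · intro h
    -- The resulting equations do not involve the `𝔥`-components, so testing on `V` with these equal
    -- to zero loses nothing.
    have h3 := fun x y z => (D.jacobi_even_even_even x y z 0 0 0).1 (by
      have := h (-2) (-2) (-2) _ (𝔞.mem_piece_v x) _ (𝔞.mem_piece_v y) _ (𝔞.mem_piece_v z)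
      rwa [e2, GradedSubalgebra.sgn_zero_left, one_smul] at this)
    refine ⟨D.thetaKappa_iff.2 fun x s t => (D.jacobi_even_odd_odd x 0 s t).1 ?_,
      fun x y s => (D.jacobi_even_even_odd x y 0 0 s).1 ?_, fun x y z => (h3 x y z).1,
      fun x y z => (h3 x y z).2⟩
    · have := h (-2) (-1) (-1) _ (𝔞.mem_piece_v x) _ (𝔞.mem_piece_s s) _ (𝔞.mem_piece_s t)
      rwa [e2, GradedSubalgebra.sgn_zero_left, one_smul] at this
    · have := h (-2) (-2) (-1) _ (𝔞.mem_piece_v x) _ (𝔞.mem_piece_v y) _ (𝔞.mem_piece_s s)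
      rwa [e2, GradedSubalgebra.sgn_zero_left, one_smul] at this
  · rintro ⟨h1, h2, h3, h4⟩ k l m X hX Y hY Z hZ
    have eee := fun x y z A B C => (D.jacobi_even_even_even x y z A B C).2 ⟨h3 x y z, h4 x y z⟩
    have eeo := fun x y A B s => (D.jacobi_even_even_odd x y A B s).2 (h2 x y s)
    have eoo := fun x A s t => (D.jacobi_even_odd_odd x A s t).2 (D.thetaKappa_iff.1 h1 x s t)
    rcases 𝔞.piece_cases hX with ⟨hk, hX⟩ | ⟨hk, hX⟩ <;>
    rcases 𝔞.piece_cases hY with ⟨hl, hY⟩ | ⟨hl, hY⟩ <;>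
    rcases 𝔞.piece_cases hZ with ⟨hm, hZ⟩ | ⟨hm, hZ⟩ <;>
    rw [hX, hY, hZ, hk, hl] <;>
    generalize X.1 = x <;> generalize X.2.1 = s <;> generalize X.2.2 = A <;>
    generalize Y.1 = y <;> generalize Y.2.1 = t <;> generalize Y.2.2 = B <;>
    generalize Z.1 = z <;> generalize Z.2.1 = u <;> generalize Z.2.2 = C <;>
    simp only [GradedSubalgebra.sgn_zero_left, GradedSubalgebra.sgn_zero_right,
      GradedSubalgebra.sgn_one_one, one_smul, neg_one_smul]
    · exact eee _ _ _ _ _ _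
    · exact eeo _ _ _ _ _
    · exact D.jacobi_rotate_even_odd_even rfl rfl (eeo _ _ _ _ _)
    · exact eoo _ _ _ _
    · exact D.jacobi_rotate_odd_even_even rfl rfl (eeo _ _ _ _ _)
    · exact D.jacobi_rotate_odd_even_odd rfl (eoo _ _ _ _)
    · rw [D.jacobi_rotate_odd_odd_even _ _ _ _ (eoo _ _ _ _), sub_eq_add_neg]
    · rw [D.jacobi_odd_odd_odd, sub_eq_add_neg]

end DeformingMaps

end KillingAlg

namespace KillingAlg

variable {V S : Type*} [AddCommGroup V] [Module ℝ V] [FiniteDimensional ℝ V]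
  [AddCommGroup S] [Module ℝ S] {𝔰 : FlatModel V S} {𝔞 : GradedSubalgebra 𝔰}

/-! ### Linear presentations of filtered deformations -/

/-- The homogeneous component of degree `k` of an element of `𝔞`. -/
def GradedSubalgebra.component (𝔞 : GradedSubalgebra 𝔰) (k : ℤ) (X : 𝔞.Alg) : 𝔞.Alg :=
  (if k = -2 then X.1 else 0, if k = -1 then X.2.1 else 0, if k = 0 then X.2.2 else 0)

theorem GradedSubalgebra.component_mem (𝔞 : GradedSubalgebra 𝔰) (k : ℤ) (X : 𝔞.Alg) :
    𝔞.component k X ∈ 𝔞.piece k := by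
  by_cases h1 : k = -2
  · subst h1
    simp [component, piece, Submodule.mem_prod]
  by_cases h2 : k = -1
  · subst h2
    simp [component, piece, Submodule.mem_prod]
  by_cases h3 : k = 0
  · subst h3
    simp [component, piece, Submodule.mem_prod]
  · simp only [component, h1, h2, h3, if_false]
    exact Submodule.zero_mem _

theorem GradedSubalgebra.component_of_mem (𝔞 : GradedSubalgebra 𝔰) {k : ℤ} {X : 𝔞.Alg}
    (hX : X ∈ 𝔞.piece k) : 𝔞.component k X = X := by
  unfold piece at hX
  obtain ⟨x, s, A⟩ := X
  split_ifs at hX with h1 h2 h3 <;>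
  simp [Submodule.mem_prod, Prod.ext_iff] at hX <;>
  simp [component, *]

/-! ### Splitting the filtration compatibly with parity. -/

namespace FilteredDeformation

variable {F : Type*} [AddCommGroup F] [Module ℝ F] (L : FilteredDeformation 𝔞 F)

theorem gr_cls_sub {k : ℤ} {x y : F} (hx : x ∈ L.fil k) (hy : y ∈ L.fil k) :
    L.gr k (L.cls k (x - y) (Submodule.sub_mem _ hx hy))
      = L.gr k (L.cls k x hx) - L.gr k (L.cls k y hy) := by
  rw [← map_sub]
  rfl

theorem gr_cls_eq_zero_iff {k : ℤ} {x : F} (hx : x ∈ L.fil k) :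
    L.gr k (L.cls k x hx) = 0 ↔ x ∈ L.fil (k + 1) := by
  rw [LinearEquiv.map_eq_zero_iff, FilteredLieSuperalgebra.cls, Submodule.Quotient.mk_eq_zero]
  rfl

theorem gr_cls_eq_iff {k : ℤ} {x y : F} (hx : x ∈ L.fil k) (hy : y ∈ L.fil k) :
    L.gr k (L.cls k x hx) = L.gr k (L.cls k y hy) ↔ x - y ∈ L.fil (k + 1) := by
  rw [← sub_eq_zero, ← L.gr_cls_sub, L.gr_cls_eq_zero_iff]

/-- `Gr F` lives in degrees `-2`, `-1`, `0`, so the filtration is constant elsewhere; finiteness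
then yields `F^{-2} = F` and `F^1 = 0`. -/
theorem fil_le_succ {k : ℤ} (h1 : k ≠ -2) (h2 : k ≠ -1) (h3 : k ≠ 0) :
    L.fil k ≤ L.fil (k + 1) := by
  intro x hx
  rw [← L.gr_cls_eq_zero_iff hx]
  apply Subtype.ext
  have h := (L.gr k (L.cls k x hx)).2
  simpa [GradedSubalgebra.piece, h1, h2, h3] using h

theorem fil_eq_top {k : ℤ} (hk : k ≤ -2) : L.fil k = ⊤ := by
  have hle : ∀ n : ℕ, L.fil (-2 - n) ≤ L.fil (-2) := by
    intro n
    induction n with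
    | zero => simp
    | succ n ih =>
      have h := L.fil_le_succ (k := -2 - (n + 1 : ℕ)) (by push_cast; omega) (by push_cast; omega)
        (by push_cast; omega)
      rw [show (-2 - ((n + 1 : ℕ) : ℤ) + 1) = -2 - n by push_cast; ring] at h
      exact h.trans ih
  have h2 : L.fil (-2) = ⊤ := by
    obtain ⟨j, hj⟩ := L.fil_exhaustive
    rw [eq_top_iff, ← hj]
    refine le_trans (L.fil_anti ?_) (hle (-2 - j).toNat)
    omega
  rw [eq_top_iff, ← h2]
  exact L.fil_anti hk

theorem fil_eq_bot {k : ℤ} (hk : 0 < k) : L.fil k = ⊥ := by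
  have hle : ∀ n : ℕ, L.fil 1 ≤ L.fil (1 + n) := by
    intro n
    induction n with
    | zero => simp
    | succ n ih =>
      have h := L.fil_le_succ (k := 1 + n) (by omega) (by omega) (by omega)
      rw [show (1 + (n : ℤ) + 1) = 1 + ((n + 1 : ℕ) : ℤ) by push_cast; ring] at h
      exact ih.trans h
  have h2 : L.fil 1 = ⊥ := by
    obtain ⟨j, hj⟩ := L.fil_separated
    rw [eq_bot_iff, ← hj]
    refine le_trans (hle (j - 1).toNat) (L.fil_anti ?_)
    omega
  rw [eq_bot_iff, ← h2]
  exact L.fil_anti hk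

/-- The component of wrong parity of an element of `F^k` lies in `F^{k+1}`, by `fil_even` and
`fil_odd`. Dropping it leaves the class unchanged, so every class has a representative of parity
`k`. -/
theorem exists_lift_piece (k : ℤ) : ∃ f : 𝔞.piece k →ₗ[ℝ] F,
    ∀ X, f X ∈ L.part k ∧ ∃ h : f X ∈ L.fil k, L.gr k (L.cls k (f X) h) = X := by
  let P := L.fil k ⊓ L.part k
  let π : P →ₗ[ℝ] 𝔞.piece k := (L.gr k).toLinearMap.comp
    ((Submodule.mkQ _).comp (Submodule.inclusion inf_le_left))
  have hπ : Function.Surjective π := by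
    intro X
    obtain ⟨⟨x, hx⟩, hq⟩ := Submodule.Quotient.mk_surjective _ ((L.gr k).symm X)
    have hX : L.gr k (L.cls k x hx) = X := by
      rw [← LinearEquiv.eq_symm_apply]
      exact hq
    have hx' := hx
    rw [L.fil_split] at hx'
    obtain ⟨a, ha, b, hb, rfl⟩ := Submodule.mem_sup.1 hx'
    rcases Int.even_or_odd' k with ⟨j, rfl | rfl⟩
    · have e : ((2 * j : ℤ) : ZMod 2) = 0 := by
        push_cast
        rw [show (2 : ZMod 2) = 0 by decide, zero_mul]
      have hb' := hb
      rw [L.fil_odd] at hb'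
      refine ⟨⟨a, ha.1, by rw [e]; exact ha.2⟩, ?_⟩
      rw [← hX]
      refine (L.gr_cls_eq_iff ha.1 hx).2 ?_
      rw [sub_add_cancel_left]
      exact Submodule.neg_mem _ hb'.1
    · have e : ((2 * j + 1 : ℤ) : ZMod 2) = 1 := by
        push_cast
        rw [show (2 : ZMod 2) = 0 by decide, zero_mul, zero_add]
      have ha' := ha
      rw [show 2 * j + 1 = 2 * (j + 1) - 1 by ring, L.fil_even] at ha'
      refine ⟨⟨b, hb.1, by rw [e]; exact hb.2⟩, ?_⟩
      rw [← hX]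
      refine (L.gr_cls_eq_iff hb.1 hx).2 ?_
      rw [sub_add_cancel_right]
      refine Submodule.neg_mem _ ?_
      rw [show 2 * j + 1 + 1 = 2 * (j + 1) by ring]
      exact ha'.1
  have : Module.Free ℝ (𝔞.piece k) := Module.Free.of_divisionRing ℝ _
  have : Module.Projective ℝ (𝔞.piece k) := Module.Projective.of_free
  obtain ⟨r, hr⟩ := LinearMap.exists_rightInverse_of_surjective π (LinearMap.range_eq_top.2 hπ)
  exact ⟨P.subtype.comp r, fun X => ⟨(r X).2.2, (r X).2.1, LinearMap.congr_fun hr X⟩⟩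

/-- A filtered parity-preserving linear isomorphism `𝔞 → F` lifting `𝔞 ≅ Gr F`. -/
structure IsLift (Φ : 𝔞.Alg ≃ₗ[ℝ] F) : Prop where
  mem_fil : ∀ k, ∀ X ∈ 𝔞.piece k, Φ X ∈ L.fil k
  mem_part : ∀ k : ℤ, ∀ X ∈ 𝔞.piece k, Φ X ∈ L.part k
  gr_eq : ∀ k X (hX : X ∈ 𝔞.piece k),
    (L.gr k (L.cls k (Φ X) (mem_fil k X hX)) : 𝔞.Alg) = X

/-- The sum of the sections in the three degrees. Injectivity reads off graded components from the
lowest degree upwards; surjectivity is a three-step approximation whose error lies in `F^1 = 0`. -/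
theorem exists_isLift : ∃ Φ : 𝔞.Alg ≃ₗ[ℝ] F, L.IsLift Φ := by
  choose f hpart hfil hgr using L.exists_lift_piece
  let comp : ∀ k : ℤ, 𝔞.Alg →ₗ[ℝ] 𝔞.piece k := fun k =>
    { toFun := fun X => ⟨𝔞.component k X, 𝔞.component_mem k X⟩
      map_add' := fun X Y => Subtype.ext (by
        simp only [GradedSubalgebra.component, Submodule.coe_add]
        ext1
        · simp only [Prod.fst_add]; split_ifs <;> simp
        · ext1
          · simp only [Prod.snd_add, Prod.fst_add]; split_ifs <;> simp
          · simp only [Prod.snd_add]; split_ifs <;> simp)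
      map_smul' := fun c X => Subtype.ext (by
        simp only [GradedSubalgebra.component, Submodule.coe_smul, RingHom.id_apply]
        ext1
        · simp only [Prod.smul_fst]; split_ifs <;> simp
        · ext1
          · simp only [Prod.smul_snd, Prod.smul_fst]; split_ifs <;> simp
          · simp only [Prod.smul_snd]; split_ifs <;> simp) }
  let g : ℤ → 𝔞.Alg →ₗ[ℝ] F := fun k => (f k).comp (comp k)
  have gfil : ∀ k X, g k X ∈ L.fil k := fun k X => hfil k _
  have ggr : ∀ k X, (L.gr k (L.cls k (g k X) (gfil k X)) : 𝔞.Alg) = 𝔞.component k X :=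
    fun k X => congrArg Subtype.val (hgr k (comp k X))
  have gzero : ∀ k X, g k X ∈ L.fil (k + 1) → 𝔞.component k X = 0 := by
    intro k X h
    rw [← ggr, (L.gr_cls_eq_zero_iff (gfil k X)).2 h]
    rfl
  have hext : ∀ X : 𝔞.Alg, 𝔞.component (-2) X = 0 → 𝔞.component (-1) X = 0 →
      𝔞.component 0 X = 0 → X = 0 := by
    intro X h1 h2 h3
    simp [GradedSubalgebra.component] at h1 h2 h3
    exact Prod.ext h1 (Prod.ext h2 h3)
  let Φ₀ : 𝔞.Alg →ₗ[ℝ] F := g (-2) + g (-1) + g 0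
  have hΦ₀ : ∀ X, Φ₀ X = g (-2) X + g (-1) X + g 0 X := fun _ => rfl
  have anti := L.fil_anti
  have hinj : Function.Injective Φ₀ := by
    rw [← LinearMap.ker_eq_bot, LinearMap.ker_eq_bot']
    intro X hX
    rw [hΦ₀] at hX
    have h0 : g 0 X ∈ L.fil (-1) := anti (by norm_num) (gfil 0 X)
    have h0' : g (-1) X ∈ L.fil (-2 + 1) := anti (by norm_num) (gfil (-1) X)
    have h1 : 𝔞.component (-2) X = 0 := by
      apply gzero
      rw [add_assoc] at hX
      rw [eq_neg_of_add_eq_zero_left hX]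
      exact Submodule.neg_mem _ (Submodule.add_mem _ h0' h0)
    have e1 : g (-2) X = 0 := by
      have : comp (-2) X = 0 := Subtype.ext h1
      simp only [g, LinearMap.comp_apply, this, map_zero]
    rw [e1, zero_add] at hX
    have h2 : 𝔞.component (-1) X = 0 := by
      apply gzero
      rw [eq_neg_of_add_eq_zero_left hX]
      exact Submodule.neg_mem _ (gfil 0 X)
    have e2 : g (-1) X = 0 := by
      have : comp (-1) X = 0 := Subtype.ext h2
      simp only [g, LinearMap.comp_apply, this, map_zero]
    rw [e2, zero_add] at hX
    refine hext X h1 h2 (gzero 0 X ?_)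
    rw [hX]
    exact Submodule.zero_mem _
  have happrox : ∀ k x, x ∈ L.fil k → ∃ X, 𝔞.component k X = X ∧ x - g k X ∈ L.fil (k + 1) := by
    intro k x hx
    have hX := 𝔞.component_of_mem (L.gr k (L.cls k x hx)).2
    refine ⟨_, hX, (L.gr_cls_eq_iff hx (gfil k _)).1 (Subtype.ext ?_)⟩
    rw [ggr, hX]
  have gother : ∀ k l X, k ≠ l → 𝔞.component k X = X → g l X = 0 := by
    intro k l X hkl hX
    have : comp l X = 0 := by
      apply Subtype.ext
      change 𝔞.component l X = 0
      rw [← hX]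
      simp only [GradedSubalgebra.component]
      refine Prod.ext ?_ (Prod.ext ?_ ?_) <;>
      · dsimp only
        split_ifs <;> first | rfl | omega
    simp only [g, LinearMap.comp_apply, this, map_zero]
  have hsurj : Function.Surjective Φ₀ := by
    intro x
    obtain ⟨X, hX, h1⟩ := happrox (-2) x (by rw [L.fil_eq_top le_rfl]; trivial)
    obtain ⟨Y, hY, h2⟩ := happrox (-1) _ h1
    obtain ⟨Z, hZ, h3⟩ := happrox 0 _ h2
    rw [L.fil_eq_bot (by norm_num), Submodule.mem_bot] at h3
    refine ⟨X + Y + Z, ?_⟩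
    rw [hΦ₀]
    simp only [map_add]
    rw [gother _ (-1) X (by decide) hX, gother _ 0 X (by decide) hX,
      gother _ (-2) Y (by decide) hY, gother _ 0 Y (by decide) hY,
      gother _ (-2) Z (by decide) hZ, gother _ (-1) Z (by decide) hZ]
    rw [← sub_eq_zero, ← neg_eq_zero]
    refine Eq.trans ?_ h3
    abel
  have key : ∀ k X, X ∈ 𝔞.piece k → Φ₀ X = g k X := by
    intro k X hX
    have h := 𝔞.component_of_mem hX
    rw [hΦ₀]
    by_cases h1 : k = -2
    · subst h1
      rw [gother _ (-1) X (by decide) h, gother _ 0 X (by decide) h, add_zero, add_zero]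
    by_cases h2 : k = -1
    · subst h2
      rw [gother _ (-2) X (by decide) h, gother _ 0 X (by decide) h, add_zero, zero_add]
    by_cases h3 : k = 0
    · subst h3
      rw [gother _ (-1) X (by decide) h, gother _ (-2) X (by decide) h, zero_add, zero_add]
    · have : X = 0 := by
        rw [← h]
        simp only [GradedSubalgebra.component, h1, h2, h3, if_false]
        rfl
      simp [this]
  have hk : ∀ k X, X ∈ 𝔞.piece k → LinearEquiv.ofBijective Φ₀ ⟨hinj, hsurj⟩ X = g k X := key
  refine ⟨LinearEquiv.ofBijective Φ₀ ⟨hinj, hsurj⟩, fun k X hX => ?_, fun k X hX => ?_,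
    fun k X hX => ?_⟩
  · rw [hk k X hX]
    exact gfil k X
  · rw [hk k X hX]
    exact hpart k _
  · simp only [hk k X hX]
    rw [ggr, 𝔞.component_of_mem hX]

end FilteredDeformation

namespace FilteredDeformation.IsLift

variable {F : Type*} [AddCommGroup F] [Module ℝ F] {L : FilteredDeformation 𝔞 F}
  {Φ : 𝔞.Alg ≃ₗ[ℝ] F}

theorem apply_eq (Φ : 𝔞.Alg ≃ₗ[ℝ] F) (X : 𝔞.Alg) :
    Φ X = Φ (X.1, 0, 0) + Φ (0, X.2.1, 0) + Φ (0, 0, X.2.2) := by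
  rw [← map_add, ← map_add]
  congr 1
  simp

theorem mem_fil_iff (hΦ : L.IsLift Φ) (k : ℤ) (X : 𝔞.Alg) : Φ X ∈ L.fil k ↔
    (-2 < k → X.1 = 0) ∧ (-1 < k → X.2.1 = 0) ∧ (0 < k → X.2.2 = 0) := by
  have hv := hΦ.mem_fil _ _ (𝔞.mem_piece_v X.1)
  have hs := hΦ.mem_fil _ _ (𝔞.mem_piece_s X.2.1)
  have hh := hΦ.mem_fil _ _ (𝔞.mem_piece_h X.2.2)
  have anti := L.fil_anti
  constructor
  · intro h
    have h1 : -2 < k → X.1 = 0 := by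
      intro hk
      have h' : Φ X ∈ L.fil (-2 + 1) := anti (by omega) h
      have h3 : Φ (X.1, 0, 0) ∈ L.fil (-2 + 1) := by
        have : Φ (X.1, 0, 0) = Φ X - Φ (0, X.2.1, 0) - Φ (0, 0, X.2.2) := by
          rw [apply_eq Φ X]; abel
        rw [this]
        exact Submodule.sub_mem _ (Submodule.sub_mem _ h' (anti (by norm_num) hs))
          (anti (by norm_num) hh)
      have h4 := hΦ.gr_eq _ _ (𝔞.mem_piece_v X.1)
      rw [(L.gr_cls_eq_zero_iff hv).2 h3] at h4
      exact (congrArg Prod.fst h4).symm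
    have h2 : -1 < k → X.2.1 = 0 := by
      intro hk
      have h' : Φ X ∈ L.fil (-1 + 1) := anti (by omega) h
      have h3 : Φ (0, X.2.1, 0) ∈ L.fil (-1 + 1) := by
        have : Φ (0, X.2.1, 0) = Φ X - Φ (0, 0, X.2.2) := by
          rw [apply_eq Φ X, h1 (by omega)]
          simp
        rw [this]
        exact Submodule.sub_mem _ h' hh
      have h4 := hΦ.gr_eq _ _ (𝔞.mem_piece_s X.2.1)
      rw [(L.gr_cls_eq_zero_iff hs).2 h3] at h4
      exact (congrArg (fun Y => Y.2.1) h4).symm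
    refine ⟨h1, h2, fun hk => ?_⟩
    rw [L.fil_eq_bot hk, Submodule.mem_bot, LinearEquiv.map_eq_zero_iff] at h
    rw [h]
    rfl
  · rintro ⟨h1, h2, h3⟩
    by_cases k1 : k ≤ -2
    · rw [L.fil_eq_top k1]
      trivial
    rw [apply_eq Φ X, h1 (by omega)]
    rw [show ((0, 0, 0) : 𝔞.Alg) = 0 from rfl, map_zero, zero_add]
    by_cases k2 : k ≤ -1
    · exact Submodule.add_mem _ (anti (by omega) hs) (anti (by omega) hh)
    rw [h2 (by omega), show ((0, 0, 0) : 𝔞.Alg) = 0 from rfl, map_zero, zero_add]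
    by_cases k3 : k ≤ 0
    · exact anti k3 hh
    · rw [h3 (by omega), show ((0, 0, 0) : 𝔞.Alg) = 0 from rfl, map_zero]
      exact Submodule.zero_mem _

/-- Extends `gr_eq` to inhomogeneous elements: their class is that of the leading component. -/
theorem gr_apply (hΦ : L.IsLift Φ) (k : ℤ) (X : 𝔞.Alg) (h : Φ X ∈ L.fil k) :
    (L.gr k (L.cls k (Φ X) h) : 𝔞.Alg) = 𝔞.component k X := by
  rw [← hΦ.gr_eq k _ (𝔞.component_mem k X)]
  congr 1
  rw [L.gr_cls_eq_iff, ← map_sub, hΦ.mem_fil_iff]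
  rw [hΦ.mem_fil_iff] at h
  obtain ⟨h1, h2, h3⟩ := h
  simp only [GradedSubalgebra.component, Prod.fst_sub, Prod.snd_sub]
  refine ⟨fun hk => ?_, fun hk => ?_, fun hk => ?_⟩
  · split_ifs with h
    · exact sub_self _
    · rw [h1 (by omega), sub_zero]
  · split_ifs with h
    · exact sub_self _
    · rw [h2 (by omega), sub_zero]
  · split_ifs with h
    · exact sub_self _
    · rw [h3 (by omega), sub_zero]

theorem mem_part_zero_iff (hΦ : L.IsLift Φ) (X : 𝔞.Alg) : Φ X ∈ L.part 0 ↔ X.2.1 = 0 := by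
  have hv : Φ (X.1, 0, 0) ∈ L.part 0 := hΦ.mem_part _ _ (𝔞.mem_piece_v X.1)
  have hs : Φ (0, X.2.1, 0) ∈ L.part 1 := hΦ.mem_part _ _ (𝔞.mem_piece_s X.2.1)
  have hh : Φ (0, 0, X.2.2) ∈ L.part 0 := by
    simpa using hΦ.mem_part _ _ (𝔞.mem_piece_h X.2.2)
  constructor
  · intro h
    have h1 : Φ (0, X.2.1, 0) ∈ L.part 0 := by
      have : Φ (0, X.2.1, 0) = Φ X - Φ (X.1, 0, 0) - Φ (0, 0, X.2.2) := by
        rw [apply_eq Φ X]; abel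
      rw [this]
      exact Submodule.sub_mem _ (Submodule.sub_mem _ h hv) hh
    have h2 := Submodule.disjoint_def.1 L.isCompl.disjoint _ h1 hs
    rw [LinearEquiv.map_eq_zero_iff] at h2
    exact congrArg (fun Y => Y.2.1) h2
  · intro h
    rw [apply_eq Φ X, h, show ((0, 0, 0) : 𝔞.Alg) = 0 from rfl, map_zero, add_zero]
    exact Submodule.add_mem _ hv hh

theorem mem_part_one_iff (hΦ : L.IsLift Φ) (X : 𝔞.Alg) : Φ X ∈ L.part 1 ↔ X.1 = 0 ∧ X.2.2 = 0 := by
  have hs : Φ (0, X.2.1, 0) ∈ L.part 1 := hΦ.mem_part _ _ (𝔞.mem_piece_s X.2.1)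
  have he : Φ (X.1, 0, X.2.2) ∈ L.part 0 := (hΦ.mem_part_zero_iff _).2 rfl
  constructor
  · intro h
    have h1 : Φ (X.1, 0, X.2.2) ∈ L.part 1 := by
      have : Φ (X.1, 0, X.2.2) = Φ X - Φ (0, X.2.1, 0) := by
        rw [eq_sub_iff_add_eq, ← map_add]
        congr 1
        simp
      rw [this]
      exact Submodule.sub_mem _ h hs
    have h2 := Submodule.disjoint_def.1 L.isCompl.disjoint _ he h1
    rw [LinearEquiv.map_eq_zero_iff] at h2
    exact ⟨congrArg (fun Y => Y.1) h2, congrArg (fun Y => Y.2.2) h2⟩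
  · rintro ⟨h1, h2⟩
    rw [show X = (0, X.2.1, 0) from Prod.ext h1 (Prod.ext rfl h2)]
    exact hs

end FilteredDeformation.IsLift

end KillingAlg

namespace KillingAlg

variable {V S : Type*} [AddCommGroup V] [Module ℝ V] [FiniteDimensional ℝ V]
  [AddCommGroup S] [Module ℝ S] {𝔰 : FlatModel V S} {𝔞 : GradedSubalgebra 𝔰}

/-! ### Existence of presentations by deforming maps -/

/-- The components of a bilinear bracket on `𝔞` which deforms the bracket of `𝔞` in positive
degrees. -/
structure IsDeformedBracket (B : 𝔞.Alg →ₗ[ℝ] 𝔞.Alg →ₗ[ℝ] 𝔞.Alg) : Prop where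
  hh : ∀ A C : 𝔞.h, B (0, 0, A) (0, 0, C) = (0, 0, ⁅A, C⁆)
  hs : ∀ (A : 𝔞.h) (s : 𝔞.S'), B (0, 0, A) (0, s, 0) = (0, 𝔞.act A s, 0)
  hv_fst : ∀ (A : 𝔞.h) (v : V), (B (0, 0, A) (v, 0, 0)).1 = 𝔞.actV A v
  ss_fst : ∀ s t : 𝔞.S', (B (0, s, 0) (0, t, 0)).1 = 𝔰.κ s t
  even : ∀ X Y : 𝔞.Alg, X.2.1 = 0 → Y.2.1 = 0 → (B X Y).2.1 = 0
  mixed : ∀ (X : 𝔞.Alg) (s : 𝔞.S'), X.2.1 = 0 →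
    (B X (0, s, 0)).1 = 0 ∧ (B X (0, s, 0)).2.2 = 0
  odd : ∀ s t : 𝔞.S', (B (0, s, 0) (0, t, 0)).2.1 = 0
  skew : ∀ X Y : 𝔞.Alg, X.2.1 = 0 → B Y X = -B X Y
  symm : ∀ s t : 𝔞.S', B (0, s, 0) (0, t, 0) = B (0, t, 0) (0, s, 0)
  jacobi : ∀ X Y Z : 𝔞.Alg, X.2.1 = 0 → B X (B Y Z) = B (B X Y) Z + B Y (B X Z)
  jacobi_odd : ∀ s t u : 𝔞.S', B (0, s, 0) (B (0, t, 0) (0, u, 0))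
    = B (B (0, s, 0) (0, t, 0)) (0, u, 0) - B (0, t, 0) (B (0, s, 0) (0, u, 0))

namespace FilteredDeformation

variable {F : Type*} [AddCommGroup F] [Module ℝ F] (L : FilteredDeformation 𝔞 F)

/-- The bracket of `F` transported to `𝔞`. -/
noncomputable def transported (Φ : 𝔞.Alg ≃ₗ[ℝ] F) : 𝔞.Alg →ₗ[ℝ] 𝔞.Alg →ₗ[ℝ] 𝔞.Alg :=
  (L.bracket.compl₁₂ Φ.toLinearMap Φ.toLinearMap).compr₂ Φ.symm.toLinearMap

variable {L}

theorem apply_transported (Φ : 𝔞.Alg ≃ₗ[ℝ] F) (X Y : 𝔞.Alg) :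
    Φ (L.transported Φ X Y) = L.bracket (Φ X) (Φ Y) :=
  Φ.apply_symm_apply _

theorem IsLift.mem_fil_transported {Φ : 𝔞.Alg ≃ₗ[ℝ] F} (hΦ : L.IsLift Φ) {k l : ℤ}
    {X Y : 𝔞.Alg} (hX : X ∈ 𝔞.piece k) (hY : Y ∈ 𝔞.piece l) :
    Φ (L.transported Φ X Y) ∈ L.fil (k + l) := by
  rw [apply_transported]
  exact L.fil_bracket _ _ _ (hΦ.mem_fil k X hX) _ (hΦ.mem_fil l Y hY)

theorem IsLift.component_transported {Φ : 𝔞.Alg ≃ₗ[ℝ] F} (hΦ : L.IsLift Φ) {k l : ℤ}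
    {X Y : 𝔞.Alg} (hX : X ∈ 𝔞.piece k) (hY : Y ∈ 𝔞.piece l) :
    𝔞.component (k + l) (L.transported Φ X Y) = 𝔞.bracket X Y := by
  have h := L.gr_bracket k l (Φ X) (Φ Y) (hΦ.mem_fil k X hX) (hΦ.mem_fil l Y hY)
  rw [hΦ.gr_eq k X hX, hΦ.gr_eq l Y hY] at h
  rw [← h, ← hΦ.gr_apply (k + l) _ (hΦ.mem_fil_transported hX hY)]
  simp only [apply_transported]

theorem IsLift.exists_parts {Φ : 𝔞.Alg ≃ₗ[ℝ] F} (hΦ : L.IsLift Φ) (X : 𝔞.Alg) :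
    ∃ a ∈ L.part 0, ∃ b ∈ L.part 1, Φ X = a + b := by
  refine ⟨Φ (X.1, 0, X.2.2), (hΦ.mem_part_zero_iff _).2 rfl, Φ (0, X.2.1, 0),
    (hΦ.mem_part_one_iff _).2 ⟨rfl, rfl⟩, ?_⟩
  rw [← map_add]
  congr 1
  simp

theorem jacobi_of_even {x y z : F} (hx : x ∈ L.part 0)
    (hy : ∃ a ∈ L.part 0, ∃ b ∈ L.part 1, y = a + b)
    (hz : ∃ a ∈ L.part 0, ∃ b ∈ L.part 1, z = a + b) :
    L.bracket x (L.bracket y z) = L.bracket (L.bracket x y) z + L.bracket y (L.bracket x z) := by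
  obtain ⟨a, ha, b, hb, rfl⟩ := hy
  obtain ⟨c, hc, d, hd, rfl⟩ := hz
  have h1 := L.jacobi 0 0 0 x hx a ha c hc
  have h2 := L.jacobi 0 0 1 x hx a ha d hd
  have h3 := L.jacobi 0 1 0 x hx b hb c hc
  have h4 := L.jacobi 0 1 1 x hx b hb d hd
  simp only [GradedSubalgebra.sgn_zero_left, one_smul] at h1 h2 h3 h4
  simp only [map_add, LinearMap.add_apply, h1, h2, h3, h4]
  abel

/-- Since `F^1 = 0`, `[𝔥,𝔥]` has no correction; parity excludes one for `[𝔥,S']`. In the other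
brackets only the leading component is prescribed. -/
theorem IsLift.isDeformedBracket {Φ : 𝔞.Alg ≃ₗ[ℝ] F} (hΦ : L.IsLift Φ) :
    IsDeformedBracket (L.transported Φ) := by
  have p0 : ∀ X : 𝔞.Alg, X.2.1 = 0 → Φ X ∈ L.part 0 := fun X h => (hΦ.mem_part_zero_iff X).2 h
  have p1 : ∀ s : 𝔞.S', Φ (0, s, 0) ∈ L.part 1 :=
    fun s => (hΦ.mem_part_one_iff _).2 ⟨rfl, rfl⟩
  have e3 : (1 + 1 : ZMod 2) = 0 := by decide
  have even : ∀ X Y : 𝔞.Alg, X.2.1 = 0 → Y.2.1 = 0 → (L.transported Φ X Y).2.1 = 0 := by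
    intro X Y hX hY
    rw [← hΦ.mem_part_zero_iff, apply_transported]
    simpa using L.bracket_mem 0 0 _ (p0 X hX) _ (p0 Y hY)
  have mixed : ∀ (X : 𝔞.Alg) (s : 𝔞.S'), X.2.1 = 0 →
      (L.transported Φ X (0, s, 0)).1 = 0 ∧ (L.transported Φ X (0, s, 0)).2.2 = 0 := by
    intro X s hX
    rw [← hΦ.mem_part_one_iff, apply_transported]
    simpa using L.bracket_mem 0 1 _ (p0 X hX) _ (p1 s)
  have odd : ∀ s t : 𝔞.S', (L.transported Φ (0, s, 0) (0, t, 0)).2.1 = 0 := by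
    intro s t
    rw [← hΦ.mem_part_zero_iff, apply_transported]
    simpa [e3] using L.bracket_mem 1 1 _ (p1 s) _ (p1 t)
  refine ⟨fun A C => ?_, fun A s => ?_, fun A v => ?_, fun s t => ?_, even, mixed, odd,
    fun X Y hX => ?_, fun s t => ?_, fun X Y Z hX => ?_, fun s t u => ?_⟩
  · have h := hΦ.component_transported (𝔞.mem_piece_h A) (𝔞.mem_piece_h C)
    have h2 := hΦ.mem_fil_transported (𝔞.mem_piece_h A) (𝔞.mem_piece_h C)
    rw [hΦ.mem_fil_iff] at h2
    refine Prod.ext (h2.1 (by norm_num)) (Prod.ext (h2.2.1 (by norm_num)) ?_)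
    have := congrArg (fun X => X.2.2) h
    simpa [GradedSubalgebra.component, GradedSubalgebra.bracket] using this
  · have h := hΦ.component_transported (𝔞.mem_piece_h A) (𝔞.mem_piece_s s)
    obtain ⟨h1, h2⟩ := mixed (0, 0, A) s rfl
    refine Prod.ext h1 (Prod.ext ?_ h2)
    have := congrArg (fun X => X.2.1) h
    simpa [GradedSubalgebra.component, GradedSubalgebra.bracket] using this
  · have h := hΦ.component_transported (𝔞.mem_piece_h A) (𝔞.mem_piece_v v)
    have := congrArg (fun X => X.1) h
    simpa [GradedSubalgebra.component, GradedSubalgebra.bracket] using this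
  · have h := hΦ.component_transported (𝔞.mem_piece_s s) (𝔞.mem_piece_s t)
    have := congrArg (fun X => X.1) h
    simpa [GradedSubalgebra.component, GradedSubalgebra.bracket] using this
  · apply Φ.injective
    obtain ⟨a, ha, b, hb, hY⟩ := hΦ.exists_parts Y
    rw [map_neg, apply_transported, apply_transported, hY, map_add, map_add, LinearMap.add_apply,
      L.skew 0 0 a ha _ (p0 X hX), L.skew 1 0 b hb _ (p0 X hX)]
    simp only [GradedSubalgebra.sgn_zero_right, one_smul]
    abel
  · apply Φ.injective
    rw [apply_transported, apply_transported, L.skew 1 1 _ (p1 s) _ (p1 t),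
      GradedSubalgebra.sgn_one_one, neg_one_smul, neg_neg]
  · apply Φ.injective
    rw [map_add]
    simp only [apply_transported]
    exact jacobi_of_even (p0 X hX) (hΦ.exists_parts Y) (hΦ.exists_parts Z)
  · apply Φ.injective
    simp only [map_sub, apply_transported]
    rw [L.jacobi 1 1 1 _ (p1 s) _ (p1 t) _ (p1 u), GradedSubalgebra.sgn_one_one, neg_one_smul,
      sub_eq_add_neg]

end FilteredDeformation

namespace IsDeformedBracket

variable {B : 𝔞.Alg →ₗ[ℝ] 𝔞.Alg →ₗ[ℝ] 𝔞.Alg}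

set_option maxHeartbeats 1000000 in
-- Parity and filtration leave `α`, `ω`, `β`, `γ` of degree 2 and `θ` of degree 4 as the only
-- corrections.
theorem exists_components (hB : IsDeformedBracket B) :
    ∃ (α : V →ₗ[ℝ] V →ₗ[ℝ] V) (θ : V →ₗ[ℝ] V →ₗ[ℝ] 𝔞.h) (ω : 𝔞.h →ₗ[ℝ] V →ₗ[ℝ] 𝔞.h)
      (β : V →ₗ[ℝ] 𝔞.S' →ₗ[ℝ] 𝔞.S') (γ : 𝔞.S' →ₗ[ℝ] 𝔞.S' →ₗ[ℝ] 𝔞.h),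
      (∀ v, α v v = 0) ∧ (∀ v, θ v v = 0) ∧ (∀ s t, γ s t = γ t s) ∧
      (∀ x A y C, B (x, 0, A) (y, 0, C) = (α x y + 𝔞.actV A y - 𝔞.actV C x, 0,
        θ x y + ω A y - ω C x + ⁅A, C⁆)) ∧
      (∀ x A s, B (x, 0, A) (0, s, 0) = (0, β x s + 𝔞.act A s, 0)) ∧
      (∀ s t : 𝔞.S', B (0, s, 0) (0, t, 0) = (𝔰.κ s t, 0, γ s t)) := by
  obtain ⟨iV, hV⟩ : ∃ i : V →ₗ[ℝ] 𝔞.Alg, ∀ v, i v = (v, 0, 0) :=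
    ⟨LinearMap.inl ℝ V (𝔞.S' × 𝔞.h), fun _ => rfl⟩
  obtain ⟨iS, hS⟩ : ∃ i : 𝔞.S' →ₗ[ℝ] 𝔞.Alg, ∀ s, i s = (0, s, 0) :=
    ⟨(LinearMap.inr ℝ V (𝔞.S' × 𝔞.h)).comp (LinearMap.inl ℝ 𝔞.S' 𝔞.h), fun _ => rfl⟩
  obtain ⟨iH, hH⟩ : ∃ i : 𝔞.h →ₗ[ℝ] 𝔞.Alg, ∀ A, i A = (0, 0, A) :=
    ⟨(LinearMap.inr ℝ V (𝔞.S' × 𝔞.h)).comp (LinearMap.inr ℝ 𝔞.S' 𝔞.h), fun _ => rfl⟩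
  obtain ⟨pV, hpV⟩ : ∃ p : 𝔞.Alg →ₗ[ℝ] V, ∀ X, p X = X.1 :=
    ⟨LinearMap.fst ℝ V (𝔞.S' × 𝔞.h), fun _ => rfl⟩
  obtain ⟨pS, hpS⟩ : ∃ p : 𝔞.Alg →ₗ[ℝ] 𝔞.S', ∀ X, p X = X.2.1 :=
    ⟨(LinearMap.fst ℝ 𝔞.S' 𝔞.h).comp (LinearMap.snd ℝ V (𝔞.S' × 𝔞.h)), fun _ => rfl⟩
  obtain ⟨pH, hpH⟩ : ∃ p : 𝔞.Alg →ₗ[ℝ] 𝔞.h, ∀ X, p X = X.2.2 :=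
    ⟨(LinearMap.snd ℝ 𝔞.S' 𝔞.h).comp (LinearMap.snd ℝ V (𝔞.S' × 𝔞.h)), fun _ => rfl⟩
  have hself : ∀ v, B (v, 0, 0) (v, 0, 0) = 0 := by
    intro v
    have h := hB.skew (v, 0, 0) (v, 0, 0) rfl
    rw [eq_neg_iff_add_eq_zero, ← two_smul ℝ] at h
    exact (smul_eq_zero.1 h).resolve_left two_ne_zero
  have hsplit : ∀ (x : V) (A : 𝔞.h), ((x, 0, A) : 𝔞.Alg) = (x, 0, 0) + (0, 0, A) := by
    intro x A
    simp
  refine ⟨(B.compl₁₂ iV iV).compr₂ pV, (B.compl₁₂ iV iV).compr₂ pH, (B.compl₁₂ iH iV).compr₂ pH,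
    (B.compl₁₂ iV iS).compr₂ pS, (B.compl₁₂ iS iS).compr₂ pH, fun v => ?_, fun v => ?_,
    fun s t => ?_, fun x A y C => ?_, fun x A s => ?_, fun s t => ?_⟩ <;>
    simp only [LinearMap.compr₂_apply, LinearMap.compl₁₂_apply, hV, hS, hH, hpV, hpS, hpH]
  · rw [hself]
    rfl
  · rw [hself]
    rfl
  · rw [hB.symm s t]
  · have h : B (x, 0, A) (y, 0, C) = B (x, 0, 0) (y, 0, 0) + B (0, 0, A) (y, 0, 0)
        - B (0, 0, C) (x, 0, 0) + (0, 0, ⁅A, C⁆) := by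
      rw [hsplit x A, hsplit y C, map_add, map_add, LinearMap.add_apply, LinearMap.add_apply,
        hB.skew (0, 0, C) (x, 0, 0) rfl, hB.hh]
      abel
    refine Prod.ext ?_ (Prod.ext (hB.even _ _ rfl rfl) ?_)
    · rw [h]
      simp only [Prod.fst_add, Prod.fst_sub, hB.hv_fst, add_zero]
    · rw [h]
      simp only [Prod.snd_add, Prod.snd_sub]
  · obtain ⟨h1, h2⟩ := hB.mixed (x, 0, A) s rfl
    refine Prod.ext h1 (Prod.ext ?_ h2)
    rw [hsplit x A, map_add, LinearMap.add_apply, hB.hs]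
    simp only [Prod.fst_add, Prod.snd_add]
  · exact Prod.ext (hB.ss_fst s t) (Prod.ext (hB.odd s t) rfl)

set_option maxHeartbeats 1000000 in
-- Taking `l` with torsion `α`, the formulas for `β`, `γ`, `θ` solve the required shape of the
-- bracket for the deforming maps. Their properties are components of the Jacobi identities of `B`.
theorem exists_deformingMaps (hB : IsDeformedBracket B) :
    ∃ D : DeformingMaps 𝔞, ∀ X Y, D.bracket X Y = B X Y := by
  obtain ⟨α, θ', ω, β', γ', hα, hθ', hγ', hee, heo, hoo⟩ := hB.exists_components
  obtain ⟨l, hl⟩ := 𝔰.exists_contorsion α hα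
  have hoe : ∀ x A s, B (0, s, 0) (x, 0, A) = -(0, β' x s + 𝔞.act A s, 0) := by
    intro x A s
    rw [hB.skew (x, 0, A) (0, s, 0) rfl, heo]
  have jvV : ∀ A v w, 𝔞.actV A (α v w) = α (𝔞.actV A v) w + 𝔞.actV (ω A v) w
      + (α v (𝔞.actV A w) - 𝔞.actV (ω A w) v) := by
    intro A v w
    have h := hB.jacobi (0, 0, A) (v, 0, 0) (w, 0, 0) rfl
    simp only [hee] at h
    simpa using congrArg (fun X => X.1) h
  have jvH : ∀ A v w, ω A (α v w) + ⁅A, θ' v w⁆ = θ' (𝔞.actV A v) w + ω (ω A v) w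
      + (θ' v (𝔞.actV A w) - ω (ω A w) v) := by
    intro A v w
    have h := hB.jacobi (0, 0, A) (v, 0, 0) (w, 0, 0) rfl
    simp only [hee] at h
    simpa using congrArg (fun X => X.2.2) h
  have jb : ∀ A v s, 𝔞.act A (β' v s) = β' (𝔞.actV A v) s + 𝔞.act (ω A v) s
      + β' v (𝔞.act A s) := by
    intro A v s
    have h := hB.jacobi (0, 0, A) (v, 0, 0) (0, s, 0) rfl
    simp only [hee, heo] at h
    simpa using congrArg (fun X => X.2.1) h
  have jg : ∀ A (s t : 𝔞.S'), ω A (𝔰.κ s t) + ⁅A, γ' s t⁆ = γ' (𝔞.act A s) t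
      + γ' s (𝔞.act A t) := by
    intro A s t
    have h := hB.jacobi (0, 0, A) (0, s, 0) (0, t, 0) rfl
    simp only [hee, heo, hoo] at h
    simpa using congrArg (fun X => X.2.2) h
  have jss : ∀ v (s t : 𝔞.S'), α v (𝔰.κ s t) - 𝔞.actV (γ' s t) v
      = 𝔰.κ (β' v s) t + 𝔰.κ s (β' v t) := by
    intro v s t
    have h := hB.jacobi (v, 0, 0) (0, s, 0) (0, t, 0) rfl
    simp only [hee, heo, hoo] at h
    simpa using congrArg (fun X => X.1) h
  have jsss : ∀ s t u : 𝔞.S', β' (𝔰.κ s t) u + β' (𝔰.κ t u) s + β' (𝔰.κ u s) t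
      + 𝔞.act (γ' s t) u + 𝔞.act (γ' t u) s + 𝔞.act (γ' u s) t = 0 := by
    intro s t u
    have h := hB.jacobi_odd s t u
    simp only [hoe, heo, hoo] at h
    have h' := congrArg (fun X => X.2.1) h
    simp only [Prod.snd_neg, Prod.fst_neg, Prod.snd_sub, Prod.fst_sub] at h'
    rw [← sub_eq_zero, ← neg_eq_zero] at h'
    rw [hγ' u s, 𝔰.κ_symm u s]
    refine Eq.trans ?_ h'
    abel
  obtain ⟨β, hβ⟩ : ∃ β : V →ₗ[ℝ] 𝔞.S' →ₗ[ℝ] S, ∀ v s, β v s = β' v s - 𝔰.act (l v) s :=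
    ⟨LinearMap.mk₂ ℝ (fun v s => β' v s - 𝔰.act (l v) s)
      (fun v v' s => by
        simp only [map_add, LinearMap.add_apply, Submodule.coe_add, FlatModel.act_add]; abel)
      (fun c v s => by
        simp only [map_smul, LinearMap.smul_apply, Submodule.coe_smul, FlatModel.act_smul,
          smul_sub])
      (fun v s s' => by
        simp only [map_add, Submodule.coe_add]; abel)
      (fun c v s => by
        simp only [map_smul, Submodule.coe_smul, smul_sub]), fun _ _ => rfl⟩
  obtain ⟨γ, hγ⟩ : ∃ γ : 𝔞.S' →ₗ[ℝ] 𝔞.S' →ₗ[ℝ] so 𝔰.η,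
      ∀ s t, γ s t = (γ' s t : so 𝔰.η) + l (𝔰.κ s t) :=
    ⟨LinearMap.mk₂ ℝ (fun s t => (γ' s t : so 𝔰.η) + l (𝔰.κ s t))
      (fun v v' s => by
        simp only [map_add, LinearMap.add_apply, AddMemClass.coe_add]; abel)
      (fun c v s => by
        simp only [map_smul, LinearMap.smul_apply, SetLike.val_smul,
          smul_add])
      (fun v s s' => by
        simp only [map_add, AddMemClass.coe_add]; abel)
      (fun c v s => by
        simp only [map_smul, SetLike.val_smul, smul_add]), fun _ _ => rfl⟩
  obtain ⟨θ, hθ⟩ : ∃ θ : V →ₗ[ℝ] V →ₗ[ℝ] so 𝔰.η,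
      ∀ v w, θ v w = (θ' v w : so 𝔰.η) + l (α v w) - ⁅l v, l w⁆ :=
    ⟨LinearMap.mk₂ ℝ (fun v w => (θ' v w : so 𝔰.η) + l (α v w) - ⁅l v, l w⁆)
      (fun v v' s => by
        simp only [map_add, LinearMap.add_apply, AddMemClass.coe_add, add_lie]; abel)
      (fun c v s => by
        simp only [map_smul, LinearMap.smul_apply, SetLike.val_smul, smul_add, smul_sub,
          smul_lie])
      (fun v s s' => by
        simp only [map_add, AddMemClass.coe_add, lie_add]; abel)
      (fun c v s => by
        simp only [map_smul, SetLike.val_smul, smul_add, smul_sub, lie_smul]), fun _ _ => rfl⟩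
  -- By `jvV` both sides have the same torsion, and the first prolongation of `𝔰𝔬(V)` is zero.
  have hω : ∀ (A : 𝔞.h) v, (ω A v : so 𝔰.η) = ⁅(A : so 𝔰.η), l v⁆ - l (𝔞.actV A v) := by
    intro A v
    rw [← sub_eq_zero]
    refine 𝔰.eq_zero_of_torsion_eq_zero
      (fun v => (ω A v : so 𝔰.η) - (⁅(A : so 𝔰.η), l v⁆ - l (𝔞.actV A v))) (fun v w => ?_) v
    have h := jvV A v w
    simp only [← hl, GradedSubalgebra.actV, map_sub] at h
    simp only [AddSubgroupClass.coe_sub, LinearMap.sub_apply, FlatModel.coe_lie_apply,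
      GradedSubalgebra.actV]
    rw [← sub_eq_zero] at h ⊢
    rw [← neg_eq_zero]
    refine Eq.trans ?_ h
    abel
  have hpair : 𝔞.IsCocyclePair β γ := by
    refine ⟨fun s t => ?_, fun v s t => ?_, fun s t u => ?_, fun A v s => ?_, fun A s t => ?_⟩
    · rw [hγ, hγ, hγ' s t, 𝔰.κ_symm]
    · have h := jss v s t
      rw [← sub_eq_zero] at h
      rw [← neg_eq_zero]
      refine Eq.trans ?_ h
      rw [← hl, 𝔰.apply_κ]
      simp only [hβ, hγ, GradedSubalgebra.actV, AddMemClass.coe_add, LinearMap.add_apply, map_sub,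
        𝔰.κ_symm (t : S) (β' v s : S), 𝔰.κ_symm (t : S) (𝔰.act (l v) s)]
      abel
    · have h := congrArg Subtype.val (jsss s t u)
      refine Eq.trans ?_ h
      simp only [hβ, hγ, Submodule.coe_add, GradedSubalgebra.coe_act, FlatModel.act_add,
        LinearMap.add_apply]
      abel
    · have h := congrArg Subtype.val (jb A v s)
      simp only [Submodule.coe_add, GradedSubalgebra.coe_act, hω, FlatModel.act_sub,
        FlatModel.act_lie, LinearMap.sub_apply] at h
      simp only [hβ, map_sub, h, GradedSubalgebra.coe_act]
      abel
    · have h := congrArg Subtype.val (jg A s t)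
      have hκ : 𝔞.actV A (𝔰.κ s t) = 𝔰.κ (𝔞.act A s) t + 𝔰.κ s (𝔞.act A t) :=
        𝔰.apply_κ (A : so 𝔰.η) s t
      simp only [AddMemClass.coe_add, LieSubalgebra.coe_bracket, hω, hκ, map_add] at h
      simp only [hγ, lie_add]
      rw [← sub_eq_zero] at h ⊢
      refine Eq.trans ?_ h
      abel
  have hβof : ∀ v s, 𝔞.betaOf (𝔞.ofPair β γ) v s = β v s := by
    intro v s
    simp [GradedSubalgebra.betaOf, GradedSubalgebra.ofPair_apply]
  have hγof : ∀ s t, 𝔞.gammaOf (𝔞.ofPair β γ) s t = γ s t := by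
    intro s t
    simp [GradedSubalgebra.gammaOf, GradedSubalgebra.ofPair_apply]
  have hvw : ∀ v w, θ v w - l ((l v : Module.End ℝ V) w - (l w : Module.End ℝ V) v)
      + ⁅l v, l w⁆ = θ' v w := by
    intro v w
    rw [hl, hθ]
    abel
  have hθinv : ∀ (A : 𝔞.h) (v w : V),
      ⁅(A : so 𝔰.η), θ v w⁆ = θ (𝔞.actV A v) w + θ v (𝔞.actV A w) := by
    intro A v w
    have h := congrArg Subtype.val (jvH A v w)
    simp only [AddMemClass.coe_add, AddSubgroupClass.coe_sub, LieSubalgebra.coe_bracket, hω,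
      jvV A v w, map_add, map_sub, sub_lie] at h
    simp only [hθ, lie_add, lie_sub]
    rw [leibniz_lie (A : so 𝔰.η) (l v), ← lie_skew (l v) ⁅(A : so 𝔰.η), l w⁆,
      ← lie_skew (l v) (l (𝔞.actV A w))]
    rw [← sub_eq_zero] at h ⊢
    refine Eq.trans ?_ h
    abel
  let D : DeformingMaps 𝔞 :=
    { cocycle := 𝔞.ofPair β γ
      cocycle_mem := 𝔞.ofPair_mem hpair
      lam := l
      theta := θ
      theta_alt := fun v => by rw [hθ, hα, hθ', map_zero, lie_self]; simp
      theta_inv := hθinv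
      mem_vs := fun v s => by
        rw [hβof, hβ, sub_add_cancel]
        exact (β' v s).2
      mem_ss := fun s t => by
        rw [hγof, hγ, add_sub_cancel_right]
        exact (γ' s t).2
      mem_hv := fun A v => by
        rw [← hω]
        exact (ω A v).2
      mem_vw := fun v w => by
        rw [hvw]
        exact (θ' v w).2 }
  have dvs : ∀ v s, D.vsS v s = β' v s := fun v s => Subtype.ext (by
    change 𝔞.betaOf (𝔞.ofPair β γ) v s + 𝔰.act (l v) s = _
    rw [hβof, hβ, sub_add_cancel])
  have dss : ∀ s t, D.ssH s t = γ' s t := fun s t => Subtype.ext (by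
    change 𝔞.gammaOf (𝔞.ofPair β γ) s t - l (𝔰.κ s t) = _
    rw [hγof, hγ, add_sub_cancel_right])
  have dhv : ∀ A v, D.hvH A v = ω A v := fun A v => Subtype.ext (hω A v).symm
  have dV : ∀ v w, D.vwV v w = α v w := hl
  have dvw : ∀ v w, D.vwH v w = θ' v w := fun v w => Subtype.ext (hvw v w)
  refine ⟨D, fun X Y => ?_⟩
  obtain ⟨x, s, A⟩ := X
  obtain ⟨y, t, C⟩ := Y
  have hX : ((x, s, A) : 𝔞.Alg) = (x, 0, A) + (0, s, 0) := by simp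
  have hY : ((y, t, C) : 𝔞.Alg) = (y, 0, C) + (0, t, 0) := by simp
  rw [hX, hY, map_add, map_add, LinearMap.add_apply, LinearMap.add_apply, hee, heo, hoe, hoo,
    ← hX, ← hY]
  refine Prod.ext ?_ (Prod.ext ?_ ?_)
  · simp only [DeformingMaps.bracket, dV, Prod.fst_add, Prod.fst_neg]
    abel
  · simp only [DeformingMaps.bracket, dvs, Prod.fst_add, Prod.snd_add, Prod.fst_neg, Prod.snd_neg]
    abel
  · simp only [DeformingMaps.bracket, dhv, dss, dvw, Prod.snd_add, Prod.snd_neg]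
    abel

end IsDeformedBracket

namespace FilteredDeformation

theorem exists_presentation {F : Type*} [AddCommGroup F] [Module ℝ F]
    (L : FilteredDeformation 𝔞 F) :
    ∃ (D : DeformingMaps 𝔞) (Φ : 𝔞.Alg ≃ₗ[ℝ] F), D.IsPresentation L Φ := by
  obtain ⟨Φ, hΦ⟩ := L.exists_isLift
  obtain ⟨D, hD⟩ := hΦ.isDeformedBracket.exists_deformingMaps
  refine ⟨D, Φ, hΦ.mem_fil, hΦ.mem_part, hΦ.gr_eq, fun X Y => ?_⟩
  rw [hD, apply_transported]

end FilteredDeformation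

end KillingAlg

namespace KillingAlg

variable {V S : Type*} [AddCommGroup V] [Module ℝ V] [FiniteDimensional ℝ V]
  [AddCommGroup S] [Module ℝ S] {𝔰 : FlatModel V S} {𝔞 : GradedSubalgebra 𝔰}

/-! ### The isomorphism criterion -/

namespace DeformingMaps

variable {F F' : Type*} [AddCommGroup F] [Module ℝ F] [AddCommGroup F'] [Module ℝ F']
  {L : FilteredDeformation 𝔞 F} {L' : FilteredDeformation 𝔞 F'} {D D' : DeformingMaps 𝔞}
  {Φ : 𝔞.Alg ≃ₗ[ℝ] F} {Φ' : 𝔞.Alg ≃ₗ[ℝ] F'}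

theorem IsPresentation.isLift (h : D.IsPresentation L Φ) : L.IsLift Φ :=
  ⟨h.mem_fil, h.mem_part, h.gr_eq⟩

theorem IsPresentation.jacobi (h : D.IsPresentation L Φ) : D.Jacobi := by
  intro k l m X hX Y hY Z hZ
  apply Φ.injective
  simp only [map_add, map_smul, h.map_bracket]
  exact L.jacobi k l m _ (h.mem_part k X hX) _ (h.mem_part l Y hY) _ (h.mem_part m Z hZ)

theorem IsPresentation.thetaKappa (h : D.IsPresentation L Φ) : D.ThetaKappa :=
  (D.jacobi_iff.1 h.jacobi).1

/-- A linear isomorphism of deformed brackets that respects `V` and `S'`-coordinates and the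
twisted coordinates forces the cocycles to agree. -/
theorem cocycle_eq_of_twist (G : 𝔞.Alg → 𝔞.Alg)
    (h1 : ∀ X, (G X).1 = X.1) (h2 : ∀ X, (G X).2.1 = X.2.1)
    (h3 : ∀ X, D'.twist (G X) = D.twist X)
    (hG : ∀ X Y, G (D.bracket X Y) = D'.bracket (G X) (G Y)) : D.cocycle = D'.cocycle := by
  have hβ : 𝔞.betaL D.cocycle = 𝔞.betaL D'.cocycle := by
    refine LinearMap.ext fun v => LinearMap.ext fun s => ?_
    have h := congrArg (fun X => (X.2.1 : S)) (hG (v, 0, 0) (0, s, 0))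
    simp only [h2, coe_bracket_snd_fst, h1, h3] at h
    simpa using h
  have hγ : 𝔞.gammaL D.cocycle = 𝔞.gammaL D'.cocycle := by
    refine LinearMap.ext fun s => LinearMap.ext fun t => ?_
    have h := congrArg D'.twist (hG (0, s, 0) (0, t, 0))
    simp only [h3, twist_bracket, h1, h2] at h
    simpa using h
  rw [𝔞.eq_ofPair D.cocycle_mem.1, 𝔞.eq_ofPair D'.cocycle_mem.1, hβ, hγ]

/-- In presentations the isomorphism becomes a map `G` of `𝔞`. By strictness, parity and the
identity on `Gr`, it fixes `S'` and `𝔥` and moves `v` only by an element of `𝔥`. -/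
theorem cocycle_eq_of_iso (h : D.IsPresentation L Φ) (h' : D'.IsPresentation L' Φ')
    {Ψ : F ≃ₗ[ℝ] F'} (hΨ : IsDeformationIso L L' Ψ) : D.cocycle = D'.cocycle := by
  let G : 𝔞.Alg ≃ₗ[ℝ] 𝔞.Alg := (Φ.trans Ψ).trans Φ'.symm
  have hGΦ : ∀ X, Φ' (G X) = Ψ (Φ X) := fun X => Φ'.apply_symm_apply _
  have hG : ∀ X Y, G (D.bracket X Y) = D'.bracket (G X) (G Y) := by
    intro X Y
    apply Φ'.injective
    rw [h'.map_bracket, hGΦ, hGΦ, hGΦ, h.map_bracket, hΨ.map_bracket]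
  have hfil : ∀ k X, Φ' (G X) ∈ L'.fil k ↔ Φ X ∈ L.fil k := fun k X => by
    rw [hGΦ, hΨ.map_fil]
  have hpart : ∀ k X, Φ' (G X) ∈ L'.part k ↔ Φ X ∈ L.part k := fun k X => by
    rw [hGΦ, hΨ.map_part]
  have hcomp : ∀ k X, Φ X ∈ L.fil k → 𝔞.component k (G X) = 𝔞.component k X := by
    intro k X hX
    have hX' := (hfil k X).2 hX
    rw [← h.isLift.gr_apply k X hX, ← h'.isLift.gr_apply k (G X) hX']
    have := congrArg Subtype.val (hΨ.map_gr k (Φ X) hX)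
    rw [← this]
    simp only [hGΦ]
  have gv : ∀ v, (G (v, 0, 0)).1 = v ∧ (G (v, 0, 0)).2.1 = 0 := by
    intro v
    have hv := h.mem_fil _ _ (𝔞.mem_piece_v v)
    refine ⟨?_, ?_⟩
    · simpa [GradedSubalgebra.component] using congrArg Prod.fst (hcomp _ _ hv)
    · exact (h'.isLift.mem_part_zero_iff _).1
        ((hpart _ _).2 ((h.isLift.mem_part_zero_iff _).2 rfl))
  have gs : ∀ s, G (0, s, 0) = (0, s, 0) := by
    intro s
    have hs := h.mem_fil _ _ (𝔞.mem_piece_s s)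
    obtain ⟨h1, h2⟩ := (h'.isLift.mem_part_one_iff _).1
      ((hpart _ _).2 ((h.isLift.mem_part_one_iff (0, s, 0)).2 ⟨rfl, rfl⟩))
    refine Prod.ext h1 (Prod.ext ?_ h2)
    simpa [GradedSubalgebra.component] using congrArg (fun X => X.2.1) (hcomp _ _ hs)
  have gh : ∀ A, G (0, 0, A) = (0, 0, A) := by
    intro A
    have hA := h.mem_fil _ _ (𝔞.mem_piece_h A)
    obtain ⟨h1, h2, -⟩ := (h'.isLift.mem_fil_iff _ _).1 ((hfil _ _).2 hA)
    refine Prod.ext (h1 (by norm_num)) (Prod.ext (h2 (by norm_num)) ?_)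
    simpa [GradedSubalgebra.component] using congrArg (fun X => X.2.2) (hcomp _ _ hA)
  have hX : ∀ X, G X = (X.1, X.2.1, X.2.2 + (G (X.1, 0, 0)).2.2) := by
    intro X
    have hsum : X = (X.1, 0, 0) + ((0, X.2.1, 0) + (0, 0, X.2.2)) :=
      Prod.ext (by simp) (Prod.ext (by simp) (by simp))
    conv_lhs => rw [hsum, map_add, map_add, gs, gh]
    obtain ⟨h1, h2⟩ := gv X.1
    refine Prod.ext ?_ (Prod.ext ?_ ?_)
    · simp [h1]
    · simp [h2]
    · simp [add_comm]
  have h1 : ∀ X, (G X).1 = X.1 := fun X => by rw [hX]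
  have h2 : ∀ X, (G X).2.1 = X.2.1 := fun X => by rw [hX]
  -- The `V`-component of `G [v,w] = [Gv, Gw]` equates the torsions of `λ` and of `v ↦ D'.twist (G
  -- v)`, so the maps themselves agree.
  have hlam : ∀ v, D'.twist (G (v, 0, 0)) - D.lam v = 0 := by
    refine 𝔰.eq_zero_of_torsion_eq_zero _ fun v w => ?_
    have h := congrArg Prod.fst (hG (v, 0, 0) (w, 0, 0))
    simp only [h1, bracket_fst] at h
    simp only [twist_apply, ZeroMemClass.coe_zero, zero_add, h2, map_zero, add_zero] at h
    simp only [AddSubgroupClass.coe_sub, LinearMap.sub_apply]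
    rw [← sub_eq_zero] at h ⊢
    rw [← neg_eq_zero]
    refine Eq.trans ?_ h
    abel
  refine cocycle_eq_of_twist G h1 h2 (fun X => ?_) hG
  have h3 := hlam X.1
  rw [sub_eq_zero, twist, h1] at h3
  rw [twist, h1, hX, twist, ← h3, AddMemClass.coe_add]
  dsimp only
  abel

/-- With equal `γ`, the value of `λ - λ'` at `κ_s` is a difference of two elements `γ(s,s) -
λ'(κ_s)` and `γ(s,s) - λ(κ_s)` of `𝔥`; such vectors span `V`. -/
theorem lam_sub_mem (hc : D.cocycle = D'.cocycle)
    (hspan : Submodule.span ℝ {v : V | ∃ s ∈ 𝔞.S', v = 𝔰.κ s s} = ⊤) (v : V) :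
    D.lam v - D'.lam v ∈ 𝔞.h := by
  have hle : Submodule.span ℝ {v : V | ∃ s ∈ 𝔞.S', v = 𝔰.κ s s}
      ≤ 𝔞.h.toSubmodule.comap (D.lam - D'.lam) := by
    rw [Submodule.span_le]
    rintro _ ⟨s, hs, rfl⟩
    have h1 := 𝔞.h.sub_mem (D'.mem_ss ⟨s, hs⟩ ⟨s, hs⟩) (D.mem_ss ⟨s, hs⟩ ⟨s, hs⟩)
    rw [hc, sub_sub_sub_cancel_left] at h1
    exact h1
  rw [hspan] at hle
  exact hle (Submodule.mem_top (x := v))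

/-- `ThetaKappa` determines `θ(κ_s, w)` from `γ`, `β` and `λ`. Changing `λ(w)` by an element of `𝔥`
does not affect it, because `γ` is invariant. -/
theorem theta_eq (h : D.ThetaKappa) (h' : D'.ThetaKappa) (hc : D.cocycle = D'.cocycle)
    (hspan : Submodule.span ℝ {v : V | ∃ s ∈ 𝔞.S', v = 𝔰.κ s s} = ⊤) (v w : V) :
    D.theta v w = D'.theta v w := by
  have hle : Submodule.span ℝ {v : V | ∃ s ∈ 𝔞.S', v = 𝔰.κ s s}
      ≤ LinearMap.eqLocus (D.theta.flip w) (D'.theta.flip w) := by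
    rw [Submodule.span_le]
    rintro _ ⟨s, hs, rfl⟩
    change D.theta (𝔰.κ s s) w = D'.theta (𝔰.κ s s) w
    let t : 𝔞.S' := ⟨s, hs⟩
    have e1 := h w t
    have e2 := h' w t
    let A : 𝔞.h := ⟨_, lam_sub_mem hc hspan w⟩
    have hlam : D.lam w = D'.lam w + A := by
      change _ = D'.lam w + (D.lam w - D'.lam w)
      abel
    have hvs : D.vsS w t = D'.vsS w t + 𝔞.act A t := by
      apply Subtype.ext
      rw [Submodule.coe_add, coe_vsS, coe_vsS, hc, hlam, FlatModel.act_add,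
        GradedSubalgebra.coe_act, LinearMap.add_apply, add_assoc]
    have hg : ∀ s t, D.gamma s t = 𝔞.gammaL D'.cocycle s t := fun s t => by
      rw [← hc]; rfl
    have hg' : ∀ s t, D'.gamma s t = 𝔞.gammaL D'.cocycle s t := fun s t => rfl
    have hinv := D'.isCocyclePair.inv_gamma A t t
    have hsym := D'.isCocyclePair.symm (𝔞.act A t) t
    rw [hg, hg, hvs, hlam, map_add, add_lie, hinv, hsym] at e1
    rw [hg', hg'] at e2
    change D.theta (𝔰.κ s s) w + _ - _ = 0 at e1
    change D'.theta (𝔰.κ s s) w + _ - _ = 0 at e2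
    rw [← sub_eq_zero]
    rw [← sub_self (0 : so 𝔰.η)]
    nth_rw 1 [← e1]
    rw [← e2]
    module
  rw [hspan] at hle
  exact hle (Submodule.mem_top (x := v))

theorem exists_shift (δ : V →ₗ[ℝ] 𝔞.h) :
    ∃ G : 𝔞.Alg ≃ₗ[ℝ] 𝔞.Alg, ∀ X, G X = (X.1, X.2.1, X.2.2 + δ X.1) :=
  ⟨{ toFun := fun X => (X.1, X.2.1, X.2.2 + δ X.1)
     invFun := fun X => (X.1, X.2.1, X.2.2 - δ X.1)
     map_add' := fun X Y => by
       refine Prod.ext rfl (Prod.ext rfl ?_)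
       simp only [Prod.fst_add, Prod.snd_add, map_add]
       abel
     map_smul' := fun c X => by
       refine Prod.ext rfl (Prod.ext rfl ?_)
       simp only [Prod.smul_fst, Prod.smul_snd, map_smul, smul_add, RingHom.id_apply]
     left_inv := fun X => by simp
     right_inv := fun X => by simp }, fun _ => rfl⟩

/-- A shift `V → 𝔥` raises the degree by two, so it preserves parity and filtration and is the
identity on `Gr`. -/
theorem isDeformationIso_of_shift (h : D.IsPresentation L Φ) (h' : D'.IsPresentation L' Φ')
    (δ : V →ₗ[ℝ] 𝔞.h) (G : 𝔞.Alg ≃ₗ[ℝ] 𝔞.Alg) (hG : ∀ X, G X = (X.1, X.2.1, X.2.2 + δ X.1))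
    (hbr : ∀ X Y, G (D.bracket X Y) = D'.bracket (G X) (G Y)) :
    IsDeformationIso L L' ((Φ.symm.trans G).trans Φ') := by
  have hΨ : ∀ X, ((Φ.symm.trans G).trans Φ') (Φ X) = Φ' (G X) := by
    intro X
    simp
  have hfil : ∀ k X, Φ' (G X) ∈ L'.fil k ↔ Φ X ∈ L.fil k := by
    intro k X
    rw [h.isLift.mem_fil_iff, h'.isLift.mem_fil_iff, hG]
    constructor
    · rintro ⟨h1, h2, h3⟩
      refine ⟨h1, h2, fun hk => ?_⟩
      have h4 := h3 hk
      dsimp only at h4 h1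
      rwa [h1 (by omega), map_zero, add_zero] at h4
    · rintro ⟨h1, h2, h3⟩
      refine ⟨h1, h2, fun hk => ?_⟩
      dsimp only
      rw [h1 (by omega), map_zero, add_zero, h3 hk]
  refine ⟨?_, ?_, ?_, ?_⟩
  · intro x y
    obtain ⟨X, rfl⟩ := Φ.surjective x
    obtain ⟨Y, rfl⟩ := Φ.surjective y
    rw [← h.map_bracket, hΨ, hΨ, hΨ, hbr, h'.map_bracket]
  · intro i x
    obtain ⟨X, rfl⟩ := Φ.surjective x
    rw [hΨ]
    have hi : i = 0 ∨ i = 1 := by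
      revert i
      decide
    rcases hi with rfl | rfl
    · rw [h.isLift.mem_part_zero_iff, h'.isLift.mem_part_zero_iff, hG]
    · rw [h.isLift.mem_part_one_iff, h'.isLift.mem_part_one_iff, hG]
      refine and_congr_right fun h1 => ?_
      dsimp only at h1 ⊢
      rw [h1, map_zero, add_zero]
  · intro k x
    obtain ⟨X, rfl⟩ := Φ.surjective x
    rw [hΨ, hfil]
  · intro k x hx
    obtain ⟨X, rfl⟩ := Φ.surjective x
    apply Subtype.ext
    simp only [hΨ]
    rw [h.isLift.gr_apply, h'.isLift.gr_apply]
    simp only [GradedSubalgebra.component, hG]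
    refine Prod.ext rfl (Prod.ext rfl ?_)
    dsimp only
    split_ifs with hk
    · rw [((h.isLift.mem_fil_iff k X).1 hx).1 (by omega), map_zero, add_zero]
    · rfl

/-- The shift by `λ - λ'` matches the twisted coordinates of the two brackets, which are then given
by the same formulas because `β`, `γ` and `θ` agree. -/
theorem exists_iso_of_cocycle_eq (h : D.IsPresentation L Φ) (h' : D'.IsPresentation L' Φ')
    (hc : D.cocycle = D'.cocycle)
    (hspan : Submodule.span ℝ {v : V | ∃ s ∈ 𝔞.S', v = 𝔰.κ s s} = ⊤) :
    ∃ Ψ : F ≃ₗ[ℝ] F', IsDeformationIso L L' Ψ := by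
  have hθ := theta_eq h.thetaKappa h'.thetaKappa hc hspan
  obtain ⟨δ, hδ⟩ : ∃ δ : V →ₗ[ℝ] 𝔞.h, ∀ v, (δ v : so 𝔰.η) = D.lam v - D'.lam v :=
    ⟨{ toFun := fun v => ⟨_, lam_sub_mem hc hspan v⟩
       map_add' := fun v w => Subtype.ext (map_add (D.lam - D'.lam) v w)
       map_smul' := fun c v => Subtype.ext (map_smul (D.lam - D'.lam) c v) }, fun _ => rfl⟩
  obtain ⟨G, hG⟩ := exists_shift δ
  have hfst : ∀ X, (G X).1 = X.1 := fun X => by rw [hG]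
  have hsnd : ∀ X, (G X).2.1 = X.2.1 := fun X => by rw [hG]
  have htwist : ∀ X, D'.twist (G X) = D.twist X := by
    intro X
    simp only [twist, hG, AddMemClass.coe_add, hδ]
    abel
  have hbr : ∀ X Y, G (D.bracket X Y) = D'.bracket (G X) (G Y) := by
    intro X Y
    rw [D'.ext_twist]
    refine ⟨?_, ?_, ?_⟩
    · rw [hfst, bracket_fst, bracket_fst, htwist, htwist, hfst, hfst, hsnd, hsnd]
    · rw [hsnd, coe_bracket_snd_fst, coe_bracket_snd_fst, htwist, htwist, hfst, hfst, hsnd, hsnd,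
        hc]
    · rw [htwist, twist_bracket, twist_bracket, htwist, htwist, hfst, hfst, hsnd, hsnd, hc, hθ]
  exact ⟨_, isDeformationIso_of_shift h h' δ G hG hbr⟩

end DeformingMaps

end KillingAlg

theorem proposition4p14 {V : Type*} {S : Type*} [AddCommGroup V] [Module ℝ V]
    [FiniteDimensional ℝ V] [AddCommGroup S] [Module ℝ S] [FiniteDimensional ℝ S]
    (𝔰 : KillingAlg.FlatModel V S) (hdim : 2 < Module.finrank ℝ V)
    (hLor : KillingAlg.IsLorentzian 𝔰.η) (hcausal : 𝔰.IsCausal) (hnondeg : 𝔰.IsNondegenerate)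
    (𝔞 : KillingAlg.GradedSubalgebra 𝔰) (hsusy : 𝔞.IsHighlySupersymmetric) :
    -- every filtered deformation has a presentation by deforming maps
    (∀ (F : Type*) [AddCommGroup F] [Module ℝ F] (L : KillingAlg.FilteredDeformation 𝔞 F),
      ∃ (D : KillingAlg.DeformingMaps 𝔞) (Φ : 𝔞.Alg ≃ₗ[ℝ] F), D.IsPresentation L Φ) ∧
    -- the remaining Jacobi identities
    (∀ D : KillingAlg.DeformingMaps 𝔞,
      D.Jacobi ↔ D.ThetaKappa ∧ D.ThetaSpinor ∧ D.Bianchi ∧ D.LamBianchi) ∧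
    -- the isomorphism criterion
    (∀ (F F' : Type*) [AddCommGroup F] [Module ℝ F] [AddCommGroup F'] [Module ℝ F']
      (L : KillingAlg.FilteredDeformation 𝔞 F) (L' : KillingAlg.FilteredDeformation 𝔞 F')
      (D D' : KillingAlg.DeformingMaps 𝔞) (Φ : 𝔞.Alg ≃ₗ[ℝ] F) (Φ' : 𝔞.Alg ≃ₗ[ℝ] F'),
      D.IsPresentation L Φ → D'.IsPresentation L' Φ' →
        ((∃ Ψ : F ≃ₗ[ℝ] F', KillingAlg.IsDeformationIso L L' Ψ) ↔
          D.cocycle = D'.cocycle)) := by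
  -- Homogeneity is what the passage from equal cocycles to an isomorphism needs.
  have hspan := 𝔰.span_κ_eq_top hdim hLor hcausal hnondeg 𝔞.S' hsusy
  refine ⟨fun F _ _ L => L.exists_presentation, fun D => D.jacobi_iff,
    fun F F' _ _ _ _ L L' D D' Φ Φ' h h' => ⟨?_, fun hc => ?_⟩⟩
  · rintro ⟨Ψ, hΨ⟩
    exact KillingAlg.DeformingMaps.cocycle_eq_of_iso h h' hΨ
  · exact KillingAlg.DeformingMaps.exists_iso_of_cocycle_eq h h' hc hspan
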